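/- Let $n\ge 1$, let $M$ be a smooth manifold with a quaternionic-Kähler structure: a Riemannian metric $h$, a constant $\lambda\neq 0$, and a maximal family of local frames covering $M$. A frame consists of a vielbein of complex 1-forms $U^{A\alpha}$ ($A=1,2$; $\alpha=(I,\dot I)$, $I=1,\dots,n$), an $SU(2)$ connection $\omega^x$ ($x=1,2,3$) and a $\mathfrak{usp}(2n)$-valued connection $\Delta^\alpha{}_\beta$; two frames differ locally by a smooth $SU(2)\times USp(2n)$ gauge transformation. With $\epsilon_{12}=1=-\epsilon_{21}$, $C_{I\dot J}=\delta_{IJ}=-C_{\dot J I}$, $C^{\alpha\beta}=C_{\alpha\beta}$ numerically, standard Pauli matrices $(\sigma_x)_A{}^B=:(\sigma_x)^B{}_A$, indices lowered by $V_A=\epsilon_{AB}V^B$, $V_\alpha=C_{\alpha\beta}V^\beta$, the frames satisfy: $(U^{A\alpha})^*=\epsilon_{AB}C_{\alpha\beta}U^{B\beta}$; $U$ maps each tangent space isomorphically onto the real form of $\mathbb C^2\otimes\mathbb C^{2n}$ so defined; $h=U^{A\alpha}\otimes U^{B\beta}C_{\alpha\beta}\epsilon_{AB}$; $dU^{A\alpha}+\tfrac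 i2\omega^x(\sigma_x)^A{}_B\wedge U^{B\alpha}+\Delta^\alpha{}_\beta\wedge U^{A\beta}=0$; and $\Omega^x:=d\omega^x+\tfrac12\epsilon^{xyz}\omega^y\wedge\omega^z=i\lambda C_{\alpha\beta}(\sigma_x)_{AB}U^{A\alpha}\wedge U^{B\beta}$. Let $R^\alpha{}_\beta:=d\Delta^\alpha{}_\beta+\Delta^\alpha{}_\gamma\wedge\Delta^\gamma{}_\beta$. (0) At every point there is exactly one completely symmetric tensor $\Omega_{\alpha\beta\gamma\delta}$ with $R^\alpha{}_\beta=\lambda\epsilon_{AB}U^{A\alpha}\wedge U^B{}_\beta+U^{A\gamma}\wedge U^{B\delta}\epsilon_{AB}C^{\alpha\rho}\Omega_{\rho\beta\gamma\delta}$. (1) Let $P\subset T_xM$ be a real subspace. In a given frame, $\Omega^1=\Omega^2=0$ on $P$ if and only if $\sum_I U^{1I}\wedge(U^{2I})^*=0$ on $P$, and if and only if after a constant $USp(2n)$ rotation of the frame (which does not change $\omega^x$) one has $U^{2I}=0$ on $P$. In this case $\dim_{\mathbb R}P\le 2n$. (2) Suppose that $\omega^1=\omega^2=\Delta^I{}_{\dot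 J}=0$ on $P$. The Frobenius involution conditions $d\omega^1=d\omega^2=d\Delta^I{}_{\dot J}=0$ on $P$ are equivalent to $\Omega^1=\Omega^2=R^I{}_{\dot J}=0$ on $P$. Suppose moreover that $U^{2I}=0$ on $P$. Then $dU^{2I}=0$ on $P$; if $\Omega_{\dot I\dot J K\dot L}=0$ at $x$, the involution conditions hold; and if $\dim_{\mathbb R}P=2n$, the involution conditions hold if and only if $\Omega_{\dot I\dot J K\dot L}=0$ at $x$. (3) Let $\iota:N\to M$ be a nonempty immersed submanifold. (a) In a frame in which $\omega^1=\omega^2=\Delta^I{}_{\dot J}=0$ along an open piece of $N$, all tangent spaces of this piece satisfy the involution conditions. (b) If $\dim_{\mathbb R}N=2n$, then, for a frame defined along an open piece of $N$, $\Omega^1=\Omega^2=0$ on this piece if and only if locally, after a smooth $USp(2n)$ gauge transformation of the frame, $U^{2I}=0$ on it. (c) Suppose that $N$ is covered by frames in which $U^{2I}=\omega^1=\omega^2=\Delta^I{}_{\dot J}=0$ on $N$, and that the $SU(2)$ parts of the gauge transformations between them take values in the diagonal $U(1)$ along $N$ (the $SU(2)$ bundle is reduced to $U(1)$). Then $\dim_{\mathbb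 R}N\le 2n$. If $\dim_{\mathbb R}N=2n$, then $\Omega_{\dot I\dot J K\dot L}=0$ on $N$, and the tangent spaces of $N$ are stable under the complex structure $J$ determined by $U^{1I}\circ J=iU^{1I}$. Whenever the tangent spaces of $N$ are stable in this sense (so that $N$ has complex dimension at most $n$), $N$ with the induced metric $g$ and with $J$ is Kähler–Hodge ($J$ smooth, orthogonal and integrable in the sense that its Nijenhuis tensor vanishes; $g(J\cdot,\cdot)$ closed), and $\Omega^3$ is its Kähler form up to normalization: $\Omega^3|_N=-2\lambda\,g(J\cdot,\cdot)$ (that is, $\Omega^3(v,w)=2\lambda\, g(v,Jw)$), and $\Omega^3|_N$ is the curvature of a Hermitian line bundle over $N$ with local connection forms $\omega^3$. -/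

import Mathlib

open scoped Manifold ContDiff Topology Matrix

noncomputable section

namespace QK

/-! ### Differential forms on a manifold without boundary -/

section Forms

variable (E : Type*) [NormedAddCommGroup E] [NormedSpace ℝ E]
  (M : Type*) [TopologicalSpace M] [ChartedSpace E M]

/-- A (not necessarily continuous) `k`-form on `M` with values in `V`. -/
abbrev Form (k : ℕ) (V : Type*) [NormedAddCommGroup V] [NormedSpace ℝ V] : Type _ :=
  (x : M) → (TangentSpace 𝓘(ℝ, E) x) [⋀^Fin k]→L[ℝ] V

variable {E M} {k : ℕ} {V : Type*} [NormedAddCommGroup V] [NormedSpace ℝ V]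

/-- The expression of a form in the preferred chart at `x₀` (pull-back by the inverse chart). -/
def chartForm (α : Form E M k V) (x₀ : M) (y : E) : E [⋀^Fin k]→L[ℝ] V :=
  (α ((extChartAt 𝓘(ℝ, E) x₀).symm y)).compContinuousLinearMap
    (mfderiv 𝓘(ℝ, E) 𝓘(ℝ, E) (extChartAt 𝓘(ℝ, E) x₀).symm y)

/-- A form is smooth on `D` if its expression in every chart is. -/
def SmoothFormOn (α : Form E M k V) (D : Set M) : Prop :=
  ∀ x₀ : M, ContDiffOn ℝ ∞ (chartForm α x₀)
    ((extChartAt 𝓘(ℝ, E) x₀).target ∩ (extChartAt 𝓘(ℝ, E) x₀).symm ⁻¹' D)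

/-- The exterior derivative, computed at `x` in the preferred chart at `x` (the chart through
which the tangent space at `x` is identified with the model space). -/
def mextDeriv (α : Form E M k V) : Form E M (k + 1) V :=
  fun x => (extDeriv (𝕜 := ℝ) (E := E) (chartForm α x) (extChartAt 𝓘(ℝ, E) x x) :
    E [⋀^Fin (k + 1)]→L[ℝ] V)

/-- The differential `df(v)` of a complex function. -/
def scalarDeriv (f : M → ℂ) (x : M) (v : TangentSpace 𝓘(ℝ, E) x) : ℂ :=
  mfderiv 𝓘(ℝ, E) 𝓘(ℝ, ℂ) f x v

/-- Pull-back of a form along a map. -/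
def pullbackForm {F : Type*} [NormedAddCommGroup F] [NormedSpace ℝ F]
    {N : Type*} [TopologicalSpace N] [ChartedSpace F N]
    (ι : N → M) (α : Form E M k V) : Form F N k V :=
  fun p => (α (ι p)).compContinuousLinearMap (mfderiv 𝓘(ℝ, F) 𝓘(ℝ, E) ι p)

end Forms

/-- The wedge product of two 1-forms at a point, evaluated on two vectors. -/
def wedge {V R : Type*} [Mul R] [Sub R] (f g : V → R) (v w : V) : R :=
  f v * g w - f w * g v

/-! ### Index conventions -/

/-- Indices `α = (I, İ)` of the fundamental representation of `Sp(2n)`: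
`Sum.inl I` is the undotted index `I`, `Sum.inr I` the dotted index `İ`. -/
abbrev Idx (n : ℕ) : Type := Fin n ⊕ Fin n

/-- `ε_{AB}`; the values `1, 2` of `A` are the elements `0, 1` of `Fin 2`. -/
def eps : Matrix (Fin 2) (Fin 2) ℂ := !![0, 1; -1, 0]

/-- The symplectic metric `C_{αβ}`, with `C_{I J̇} = δ_{IJ} = - C_{J̇ I}`. -/
def symp (n : ℕ) : Matrix (Idx n) (Idx n) ℂ := Matrix.fromBlocks 0 1 (-1) 0

/-- The Pauli matrices `(σ_x)_A^B`; the values `1, 2, 3` of `x` are `0, 1, 2 : Fin 3`. -/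
def pauli : Fin 3 → Matrix (Fin 2) (Fin 2) ℂ :=
  ![!![0, 1; 1, 0], !![0, -Complex.I; Complex.I, 0], !![1, 0; 0, -1]]

/-- `(σ_x)_{AB}`: the upper index of `(σ_x)_A^C` lowered by the rule `V_B = ε_{BC} V^C`. -/
def pauliLow (c : Fin 3) (A B : Fin 2) : ℂ := ∑ C, eps B C * pauli c A C

/-- The compact symplectic group `Sp(2n)` (also written `USp(2n)`): unitary matrices that preserve
the symplectic metric. -/
def IsUSp {n : ℕ} (g : Matrix (Idx n) (Idx n) ℂ) : Prop :=
  g ∈ Matrix.unitaryGroup (Idx n) ℂ ∧ gᵀ * symp n * g = symp n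

/-! ### Local `SU(2) × Sp(2n)` frames -/

section Frames

variable (n : ℕ) (E : Type*) [NormedAddCommGroup E] [NormedSpace ℝ E]
  (M : Type*) [TopologicalSpace M] [ChartedSpace E M]

/-- The data of a local frame on an open set: the vielbein `U^{Aα}`, the `SU(2)` connection `ω^x`
and the `Sp(2n)` connection `Δ^α_β` (all of them meaningful on `dom` only). -/
structure Frame where
  dom : Set M
  U : Fin 2 → Idx n → Form E M 1 ℂ
  su2Form : Fin 3 → Form E M 1 ℝ
  spForm : Idx n → Idx n → Form E M 1 ℂ

variable {n E M}

namespace Frame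

variable (D : Frame n E M)

/-- The vielbein at a point as a function of one vector. -/
def u (A : Fin 2) (α : Idx n) (x : M) (v : TangentSpace 𝓘(ℝ, E) x) : ℂ := D.U A α x ![v]

/-- The `SU(2)` connection at a point as a function of one vector. -/
def om (c : Fin 3) (x : M) (v : TangentSpace 𝓘(ℝ, E) x) : ℝ := D.su2Form c x ![v]

/-- The `Sp(2n)` connection at a point as a function of one vector. -/
def de (α β : Idx n) (x : M) (v : TangentSpace 𝓘(ℝ, E) x) : ℂ := D.spForm α β x ![v]

/-- The `SU(2)` connection as a matrix of 1-forms `(i/2) ω^x (σ_x)^A_B` acting on `U^{Bα}`,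
where `(σ_x)^A_B = (σ_x)_B^A`. -/
def su2Conn (x : M) (v : TangentSpace 𝓘(ℝ, E) x) : Matrix (Fin 2) (Fin 2) ℂ :=
  fun A B => Complex.I / 2 * ∑ c, (D.om c x v : ℂ) * pauli c B A

/-- The `Sp(2n)` connection as a matrix. -/
def spConn (x : M) (v : TangentSpace 𝓘(ℝ, E) x) : Matrix (Idx n) (Idx n) ℂ :=
  fun α β => D.de α β x v

/-- The `SU(2)` curvature `Ω^x = dω^x + (1/2) ε^{xyz} ω^y ∧ ω^z`. -/
def su2Curv (c : Fin 3) (x : M) (v w : TangentSpace 𝓘(ℝ, E) x) : ℝ :=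
  mextDeriv (D.su2Form c) x ![v, w] + wedge (D.om (c + 1) x) (D.om (c + 2) x) v w

/-- The `Sp(2n)` curvature `R^α_β = dΔ^α_β + Δ^α_γ ∧ Δ^γ_β`. -/
def spCurv (α β : Idx n) (x : M) (v w : TangentSpace 𝓘(ℝ, E) x) : ℂ :=
  mextDeriv (D.spForm α β) x ![v, w] + ∑ γ, wedge (D.de α γ x) (D.de γ β x) v w

/-- The vielbein with its second index lowered, `U^A_β = C_{βγ} U^{Aγ}`. -/
def uLow (A : Fin 2) (β : Idx n) (x : M) (v : TangentSpace 𝓘(ℝ, E) x) : ℂ :=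
  ∑ γ, symp n β γ * D.u A γ x v

/-- The frame is a torsion-free `SU(2) × Sp(2n)` frame whose `SU(2)` curvature is `lam` times the
triplet of fundamental 2-forms. -/
structure IsQuaternionic (lam : ℝ) : Prop where
  isOpen_dom : IsOpen D.dom
  smooth_U : ∀ A α, SmoothFormOn (D.U A α) D.dom
  smooth_su2 : ∀ c, SmoothFormOn (D.su2Form c) D.dom
  smooth_sp : ∀ α β, SmoothFormOn (D.spForm α β) D.dom
  /-- `(U^{Aα})^* = ε_{AB} C_{αβ} U^{Bβ}` -/
  reality : ∀ x ∈ D.dom, ∀ v A α,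
    (starRingEnd ℂ) (D.u A α x v) = ∑ B, ∑ β, eps A B * symp n α β * D.u B β x v
  /-- the vielbein identifies every tangent space with the real form of `ℂ² ⊗ ℂ²ⁿ` -/
  injective : ∀ x ∈ D.dom, ∀ v, (∀ A α, D.u A α x v = 0) → v = 0
  surjective : ∀ x ∈ D.dom, ∀ z : Fin 2 → Idx n → ℂ,
    (∀ A α, (starRingEnd ℂ) (z A α) = ∑ B, ∑ β, eps A B * symp n α β * z B β) →
    ∃ v, ∀ A α, D.u A α x v = z A α
  /-- `Δ` takes its values in the Lie algebra of `USp(2n)` -/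
  sp_antiherm : ∀ x ∈ D.dom, ∀ v, (D.spConn x v)ᴴ = - D.spConn x v
  sp_symp : ∀ x ∈ D.dom, ∀ v, (D.spConn x v)ᵀ * symp n + symp n * D.spConn x v = 0
  /-- `dU^{Aα} + (i/2) ω^x (σ_x)^A_B ∧ U^{Bα} + Δ^α_β ∧ U^{Aβ} = 0` -/
  torsion : ∀ x ∈ D.dom, ∀ v w A α,
    mextDeriv (D.U A α) x ![v, w]
      + ∑ B, wedge (fun t => D.su2Conn x t A B) (D.u B α x) v w
      + ∑ β, wedge (D.de α β x) (D.u A β x) v w = 0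
  /-- `Ω^x = i λ C_{αβ} (σ_x)_{AB} U^{Aα} ∧ U^{Bβ}` -/
  su2Curv_eq : ∀ x ∈ D.dom, ∀ v w c,
    (D.su2Curv c x v w : ℂ) = Complex.I * lam *
      ∑ A, ∑ B, ∑ α, ∑ β, symp n α β * pauliLow c A B * wedge (D.u A α x) (D.u B β x) v w

/-- Two local frames differ near `x` by a smooth `SU(2) × Sp(2n)` gauge transformation `(a, g)`:
`U'^{Aα} = a^A_B g^α_β U^{Bβ}`, and both connections transform accordingly.  The set `O` is a
neighbourhood of `x` on which this holds. -/
structure IsGauge (D D' : Frame n E M) (O : Set M)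
    (a : M → Matrix (Fin 2) (Fin 2) ℂ) (g : M → Matrix (Idx n) (Idx n) ℂ) : Prop where
  isOpen : IsOpen O
  subset : O ⊆ D.dom ∩ D'.dom
  smooth_a : ∀ A B, ContMDiffOn 𝓘(ℝ, E) 𝓘(ℝ, ℂ) ∞ (fun y => a y A B) O
  smooth_g : ∀ α β, ContMDiffOn 𝓘(ℝ, E) 𝓘(ℝ, ℂ) ∞ (fun y => g y α β) O
  mem_SU2 : ∀ y ∈ O, a y ∈ Matrix.specialUnitaryGroup (Fin 2) ℂ
  mem_USp : ∀ y ∈ O, IsUSp (g y)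
  vielbein : ∀ y ∈ O, ∀ v A α,
    D'.u A α y v = ∑ B, ∑ β, a y A B * g y α β * D.u B β y v
  su2 : ∀ y ∈ O, ∀ v : TangentSpace 𝓘(ℝ, E) y, ∀ A B,
    (D'.su2Conn y v * a y) A B = (a y * D.su2Conn y v) A B
      - scalarDeriv (fun z => a z A B) y v
  sp : ∀ y ∈ O, ∀ v : TangentSpace 𝓘(ℝ, E) y, ∀ α β,
    (D'.spConn y v * g y) α β = (g y * D.spConn y v) α β
      - scalarDeriv (fun z => g z α β) y v

/-- Local gauge equivalence near `x`. -/
def GaugeRelatedAt (D D' : Frame n E M) (x : M) : Prop :=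
  ∃ O a g, x ∈ O ∧ IsGauge D D' O a g

/-- `T` is the completely symmetric tensor `Ω_{αβγδ}` of the `Sp(2n)` curvature at `x`:
`R^α_β = λ ε_{AB} U^{Aα} ∧ U^B_β + U^{Aγ} ∧ U^{Bδ} ε_{AB} C^{αρ} Ω_{ρβγδ}`
(numerically, `C^{αβ} = C_{αβ}`). -/
def IsOmegaTensor (lam : ℝ) (x : M) (T : Idx n → Idx n → Idx n → Idx n → ℂ) : Prop :=
  (∀ α β γ δ, T β α γ δ = T α β γ δ) ∧ (∀ α β γ δ, T α γ β δ = T α β γ δ) ∧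
  (∀ α β γ δ, T α β δ γ = T α β γ δ) ∧
  ∀ α β v w, D.spCurv α β x v w =
    lam * (∑ A, ∑ B, eps A B * wedge (D.u A α x) (D.uLow B β x) v w)
    + ∑ A, ∑ B, ∑ γ, ∑ δ, ∑ ρ,
        wedge (D.u A γ x) (D.u B δ x) v w * eps A B * symp n α ρ * T ρ β γ δ

/-! #### Conditions on a subspace of a tangent space -/

variable (x : M) (P : Submodule ℝ (TangentSpace 𝓘(ℝ, E) x))

/-- `ω^1 = ω^2 = Δ^I_{J̇} = 0` on the subspace `P`. -/
def ConnVanish : Prop :=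
  ∀ v ∈ P, D.om 0 x v = 0 ∧ D.om 1 x v = 0 ∧ ∀ I J, D.de (.inl I) (.inr J) x v = 0

/-- `U^{2I} = 0` on the subspace `P`. -/
def HalfVanish : Prop := ∀ v ∈ P, ∀ I, D.u 1 (.inl I) x v = 0

/-- The Frobenius involution conditions for the 1-forms `ω^1, ω^2, Δ^I_{J̇}`: their exterior
derivatives vanish on the subspace `P` (on which the forms themselves vanish). -/
def Involution : Prop :=
  ∀ v ∈ P, ∀ w ∈ P, mextDeriv (D.su2Form 0) x ![v, w] = 0 ∧ mextDeriv (D.su2Form 1) x ![v, w] = 0 ∧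
    ∀ I J, mextDeriv (D.spForm (.inl I) (.inr J)) x ![v, w] = 0

/-- `Ω^1 = Ω^2 = 0` on `P`. -/
def SU2CurvVanish : Prop :=
  ∀ v ∈ P, ∀ w ∈ P, D.su2Curv 0 x v w = 0 ∧ D.su2Curv 1 x v w = 0

/-- `R^I_{J̇} = 0` on `P`. -/
def SpCurvVanish : Prop :=
  ∀ v ∈ P, ∀ w ∈ P, ∀ I J, D.spCurv (.inl I) (.inr J) x v w = 0

/-- `∑_I U^{1I} ∧ (U^{2I})^* = 0` on `P`. -/
def WedgeVanish : Prop :=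
  ∀ v ∈ P, ∀ w ∈ P,
    ∑ I : Fin n, wedge (D.u 0 (.inl I) x) (fun t => (starRingEnd ℂ) (D.u 1 (.inl I) x t)) v w = 0

end Frame

/-- `Ω_{İ J̇ K L̇} = 0`. -/
def OmegaVanish (T : Idx n → Idx n → Idx n → Idx n → ℂ) : Prop :=
  ∀ I J K L : Fin n, T (.inr I) (.inr J) (.inl K) (.inr L) = 0

end Frames

/-! ### Quaternionic-Kähler manifolds -/

/-- A quaternionic-Kähler structure on `M`, with holonomy in `SU(2) × Sp(2n)`: a Riemannian metric
`h`, a nonzero constant `lam` and a maximal family of local frames that cover `M`, differ by gauge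
transformations, and satisfy `h_{uv} = U^{Aα}_u U^{Bβ}_v C_{αβ} ε_{AB}`. -/
structure QKStructure (n : ℕ) (E : Type*) [NormedAddCommGroup E] [NormedSpace ℝ E]
    (M : Type*) [TopologicalSpace M] [ChartedSpace E M] [IsManifold 𝓘(ℝ, E) ∞ M] where
  h : Bundle.ContMDiffRiemannianMetric 𝓘(ℝ, E) ∞ E (fun x : M => TangentSpace 𝓘(ℝ, E) x)
  lam : ℝ
  lam_ne : lam ≠ 0
  frames : Set (Frame n E M)
  isQuaternionic : ∀ D ∈ frames, D.IsQuaternionic lam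
  cover : ∀ x, ∃ D ∈ frames, x ∈ D.dom
  compat : ∀ D ∈ frames, ∀ D' ∈ frames, ∀ x ∈ D.dom ∩ D'.dom, D.GaugeRelatedAt D' x
  maximal : ∀ D : Frame n E M, D.IsQuaternionic lam →
    (∀ D' ∈ frames, ∀ x ∈ D.dom ∩ D'.dom, D'.GaugeRelatedAt D x) → D ∈ frames
  metric_eq : ∀ D ∈ frames, ∀ x ∈ D.dom, ∀ v w,
    (h.inner x v w : ℂ) =
      ∑ A, ∑ B, ∑ α, ∑ β, symp n α β * eps A B * D.u A α x v * D.u B β x w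

/-! ### Kähler-Hodge manifolds -/

section KahlerHodge

variable {F : Type*} [NormedAddCommGroup F] [NormedSpace ℝ F] [FiniteDimensional ℝ F]
  {N : Type*} [TopologicalSpace N] [ChartedSpace F N] [IsManifold 𝓘(ℝ, F) ∞ N]

/-- `(g, J)` is a Kähler structure with Kähler form `Φ(v, w) = g(Jv, w)`: `J` is a smooth
orthogonal almost complex structure which is integrable (its Nijenhuis tensor vanishes), and `Φ` is
smooth and closed. -/
structure IsKahler
    (g : Bundle.ContMDiffRiemannianMetric 𝓘(ℝ, F) ∞ F (fun p : N => TangentSpace 𝓘(ℝ, F) p))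
    (J : (p : N) → TangentSpace 𝓘(ℝ, F) p →L[ℝ] TangentSpace 𝓘(ℝ, F) p)
    (Φ : Form F N 2 ℝ) : Prop where
  smooth_J : ContMDiff 𝓘(ℝ, F) (𝓘(ℝ, F).prod 𝓘(ℝ, F →L[ℝ] F)) ∞
    (fun p => Bundle.TotalSpace.mk' (F →L[ℝ] F)
      (E := fun p : N => TangentSpace 𝓘(ℝ, F) p →L[ℝ] TangentSpace 𝓘(ℝ, F) p) p (J p))
  sq : ∀ p v, J p (J p v) = -v
  orthogonal : ∀ p v w, g.inner p (J p v) (J p w) = g.inner p v w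
  nijenhuis : ∀ (X Y : (p : N) → TangentSpace 𝓘(ℝ, F) p) (p : N),
    MDifferentiableAt 𝓘(ℝ, F) 𝓘(ℝ, F).tangent
      (fun q => (⟨q, X q⟩ : TangentBundle 𝓘(ℝ, F) N)) p →
    MDifferentiableAt 𝓘(ℝ, F) 𝓘(ℝ, F).tangent
      (fun q => (⟨q, Y q⟩ : TangentBundle 𝓘(ℝ, F) N)) p →
    VectorField.mlieBracket 𝓘(ℝ, F) (fun q => J q (X q)) (fun q => J q (Y q)) p
      - J p (VectorField.mlieBracket 𝓘(ℝ, F) (fun q => J q (X q)) Y p)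
      - J p (VectorField.mlieBracket 𝓘(ℝ, F) X (fun q => J q (Y q)) p)
      - VectorField.mlieBracket 𝓘(ℝ, F) X Y p = 0
  form_eq : ∀ p v w, Φ p ![v, w] = g.inner p (J p v) w
  smooth_form : SmoothFormOn Φ Set.univ
  closed : ∀ p, mextDeriv Φ p = 0

/-- The 1-forms `A i` on the members `W i` of an open cover are the connection forms of a unitary
connection on a Hermitian line bundle with curvature `K`: for smooth `U(1)`-valued transition
functions `t i j` (local unit sections are related by `s_j = t_{ij} s_i`, and `∇ s_i = i A_i s_i`)
one has the cocycle condition, `t_{ij}⁻¹ dt_{ij} = i (A_j - A_i)` and `dA_i = K`. -/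
structure IsHodgeBundle {κ : Type*} (W : κ → Set N) (A : κ → Form F N 1 ℝ) (K : Form F N 2 ℝ) :
    Prop where
  isOpen : ∀ i, IsOpen (W i)
  cover : ∀ p, ∃ i, p ∈ W i
  smooth : ∀ i, SmoothFormOn (A i) (W i)
  curvature : ∀ i, ∀ p ∈ W i, mextDeriv (A i) p = K p
  transition : ∃ t : κ → κ → N → ℂ,
    (∀ i j, ContMDiffOn 𝓘(ℝ, F) 𝓘(ℝ, ℂ) ∞ (t i j) (W i ∩ W j)) ∧
    (∀ i j, ∀ p ∈ W i ∩ W j, ‖t i j p‖ = 1) ∧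
    (∀ i j k, ∀ p ∈ W i ∩ W j ∩ W k, t i k p = t i j p * t j k p) ∧
    ∀ i j, ∀ p ∈ W i ∩ W j, ∀ v : TangentSpace 𝓘(ℝ, F) p,
      scalarDeriv (t i j) p v
        = Complex.I * ((A j p ![v] - A i p ![v] : ℝ) : ℂ) * t i j p

end KahlerHodge

/-! ### Truncations -/

section Truncation

variable {n : ℕ} {E : Type*} [NormedAddCommGroup E] [NormedSpace ℝ E]
  {M : Type*} [TopologicalSpace M] [ChartedSpace E M] [IsManifold 𝓘(ℝ, E) ∞ M]
  {F : Type*} [NormedAddCommGroup F] [NormedSpace ℝ F] [FiniteDimensional ℝ F]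
  {N : Type*} [TopologicalSpace N] [ChartedSpace F N] [IsManifold 𝓘(ℝ, F) ∞ N]

/-- The differential of `ι` at `p`. -/
abbrev dmap (ι : N → M) (p : N) : TangentSpace 𝓘(ℝ, F) p →L[ℝ] TangentSpace 𝓘(ℝ, E) (ι p) :=
  mfderiv 𝓘(ℝ, F) 𝓘(ℝ, E) ι p

/-- The tangent plane of an (immersed) submanifold, as a subspace of the ambient tangent space. -/
def tangentPlane (ι : N → M) (p : N) : Submodule ℝ (TangentSpace 𝓘(ℝ, E) (ι p)) :=
  (dmap (E := E) (F := F) ι p).toLinearMap.range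

/-- `ι` is a smooth immersion. -/
structure IsSubmanifold (ι : N → M) : Prop where
  smooth : ContMDiff 𝓘(ℝ, F) 𝓘(ℝ, E) ∞ ι
  immersion : ∀ p, Function.Injective (dmap (E := E) (F := F) ι p)

/-- The truncation conditions `U^{2I} = ω^1 = ω^2 = Δ^I_{J̇} = 0` on a submanifold `ι : N → M`, for
a family `R` of local frames along `N` (pairs of an open subset of `N` and an ambient frame defined
on its image) which cover `N`.  The `SU(2)` bundle is reduced to a `U(1)` bundle over `N`: the
`SU(2)` parts of the gauge transformations between members of `R` are diagonal on `N`. -/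
structure IsTruncation (S : QKStructure n E M) (ι : N → M) (R : Set (Set N × Frame n E M)) :
    Prop where
  mem : ∀ r ∈ R, r.2 ∈ S.frames
  isOpen : ∀ r ∈ R, IsOpen r.1
  mapsTo : ∀ r ∈ R, Set.MapsTo ι r.1 r.2.dom
  cover : ∀ p, ∃ r ∈ R, p ∈ r.1
  conn : ∀ r ∈ R, ∀ p ∈ r.1, r.2.ConnVanish (ι p) (tangentPlane (F := F) ι p)
  half : ∀ r ∈ R, ∀ p ∈ r.1, r.2.HalfVanish (ι p) (tangentPlane (F := F) ι p)
  reduced : ∀ r ∈ R, ∀ s ∈ R, ∀ p ∈ r.1 ∩ s.1, ∃ O a g, ι p ∈ O ∧ r.2.IsGauge s.2 O a g ∧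
    ∀ᶠ q in 𝓝 p, a (ι q) 0 1 = 0

/-- The tangent spaces of the submanifold are stable under the complex structure for which the
`U^{1I}` are of type `(1,0)`. -/
def IsComplexSubmanifold (ι : N → M) (R : Set (Set N × Frame n E M)) : Prop :=
  ∀ r ∈ R, ∀ p ∈ r.1, ∀ v : TangentSpace 𝓘(ℝ, F) p, ∃ w : TangentSpace 𝓘(ℝ, F) p,
    ∀ I, r.2.u 0 (.inl I) (ι p) (dmap ι p w) = Complex.I * r.2.u 0 (.inl I) (ι p) (dmap ι p v)

/-- With the induced metric and the complex structure for which the `U^{1I}` are of type `(1,0)`,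
the submanifold is Kähler; the 2-form `Ω^3` on it is `-2λ` times the form `g(J·,·)` (that is,
`Ω^3(v, w) = 2 λ g(v, Jw)`), and it is the curvature of a Hermitian line bundle with connection
forms `ω^3`. -/
def IsKahlerHodge (S : QKStructure n E M) (ι : N → M) (R : Set (Set N × Frame n E M)) : Prop :=
  ∃ (g : Bundle.ContMDiffRiemannianMetric 𝓘(ℝ, F) ∞ F (fun p : N => TangentSpace 𝓘(ℝ, F) p))
    (J : (p : N) → TangentSpace 𝓘(ℝ, F) p →L[ℝ] TangentSpace 𝓘(ℝ, F) p) (Φ : Form F N 2 ℝ),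
    (∀ p v w, g.inner p v w = S.h.inner (ι p) (dmap ι p v) (dmap ι p w)) ∧
    IsKahler g J Φ ∧
    (∀ r ∈ R, ∀ p ∈ r.1, ∀ v I, r.2.u 0 (.inl I) (ι p) (dmap ι p (J p v))
      = Complex.I * r.2.u 0 (.inl I) (ι p) (dmap ι p v)) ∧
    (∀ r ∈ R, ∀ p ∈ r.1, ∀ v w, r.2.su2Curv 2 (ι p) (dmap ι p v) (dmap ι p w)
      = -2 * S.lam * Φ p ![v, w]) ∧
    IsHodgeBundle (fun r : R => r.1.1) (fun r : R => pullbackForm ι (r.1.2.su2Form 2))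
      (fun p => (-2 * S.lam) • Φ p)

end Truncation

end QK

end

noncomputable section

namespace QK

/-! ### Calculus of forms on manifolds -/

section FormCalculus

variable {E : Type*} [NormedAddCommGroup E] [NormedSpace ℝ E]
  {M : Type*} [TopologicalSpace M] [ChartedSpace E M]
  {F : Type*} [NormedAddCommGroup F] [NormedSpace ℝ F]
  {N : Type*} [TopologicalSpace N] [ChartedSpace F N]
  {G : Type*} [NormedAddCommGroup G] [NormedSpace ℝ G]
  {K : Type*} [TopologicalSpace K] [ChartedSpace G K]
  {k : ℕ} {V : Type*} [NormedAddCommGroup V] [NormedSpace ℝ V]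

/-! The reality condition makes each U^{2α} plus or minus the conjugate of a U^{1β}, so z^α = U^{1α}
identifies each tangent space with ℂ^{2n} (`theta`). There C becomes a complex symplectic form
(`sympPair`), and USp(2n) acts by unitary symplectic matrices. Everything pointwise is linear
algebra in this model: Ω^1 and Ω^2 are -4λ and 4λ times the imaginary and the real part of the
symplectic form, the metric and Ω^3 come from the Hermitian form when the dotted coordinates vanish,
and U^{2I} = 0 says exactly that those dotted coordinates vanish.

The symmetric tensor. Differentiating the torsion equation gives the first Bianchi identity
(`Frame.bianchi`). The λ-part of the Sp(2n) curvature cancels the SU(2) curvature in it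
(`Frame.bianchi_spCurv₀`), so the remainder Q satisfies Q ∧ U = 0 and takes values in sp(2n).
Evaluated on the complexified dual basis, this kills the components of Q along U^1 ∧ U^1 and U^2 ∧
U^2 and makes the mixed ones totally symmetric (`existsUnique_symmetric_tensor`); they are the
tensor Ω.

Planes. Ω^1 = Ω^2 = 0 on P means that P is isotropic. Its complex span then lies in a Lagrangian
subspace, and an orthonormal basis of that subspace gives the rows of an element of USp(2n) which
moves it to the undotted coordinate plane (`isUSp_lagMatrix`). This yields the rotation and the
bound 2n. On such a plane R^I_J̇ is the antisymmetrization of a sesquilinear form with coefficients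
Ω_{İJ̇KL̇}; if P has dimension 2n the U^{1K} fill ℂⁿ, and the coefficients can be recovered by
inserting z and iz.

Submanifolds. Exterior differentiation commutes with pull-back (`mextDeriv_pullbackForm`), so forms
that vanish along N have derivatives that vanish on its tangent planes. To rotate a frame smoothly,
a pointwise complex basis is extended with constant chart coefficients, orthonormalized by
Gram-Schmidt, and extended off N through a local retraction; maximality of the family of frames
makes the result admissible (`Frame.exists_half_frame`).

Kähler-Hodge structure. The forms θ^I = U^{1I} embed each T_pN in ℂⁿ, so J is determined by θ∘J =
iθ, patches over frames related by diagonal SU(2) parts, and is smooth. The torsion equation reduces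
to dθ^I = -η^I_K ∧ θ^K, whence the Nijenhuis tensor vanishes (`nijenhuis_flat`). Since ω^1 = ω^2 = 0
on N, Ω^3 is there dω^3, hence closed, and it equals -2λ g(J·,·). The transition functions of the
line bundle are the squares of the conjugate U(1) parts: a gauge pair (a, g) is ambiguous by a
common sign, so only the square obeys an exact cocycle condition (`IsTruncation.isHodgeBundle`). -/

theorem pullbackForm_apply (f : N → M) (α : Form E M k V) (p : N)
    (v : Fin k → TangentSpace 𝓘(ℝ, F) p) :
    pullbackForm f α p v = α (f p) (fun i => mfderiv 𝓘(ℝ, F) 𝓘(ℝ, E) f p (v i)) := rfl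

theorem pullbackForm_comp {f : N → M} {g : K → N} (α : Form E M k V) {p : K}
    (hf : MDifferentiableAt 𝓘(ℝ, F) 𝓘(ℝ, E) f (g p))
    (hg : MDifferentiableAt 𝓘(ℝ, G) 𝓘(ℝ, F) g p) :
    pullbackForm (F := G) (f ∘ g) α p = pullbackForm g (pullbackForm (F := F) f α) p := by
  ext v
  simp only [pullbackForm_apply]
  rw [mfderiv_comp p hf hg]
  rfl

theorem pullbackForm_congr {f f' : N → M} (α : Form E M k V) {p : N} (h : f =ᶠ[𝓝 p] f') :
    pullbackForm (F := F) f α p = pullbackForm f' α p := by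
  have h1 : (mfderiv 𝓘(ℝ, F) 𝓘(ℝ, E) f p : F →L[ℝ] E) = mfderiv 𝓘(ℝ, F) 𝓘(ℝ, E) f' p :=
    h.mfderiv_eq
  have h2 : (α (f p) : E [⋀^Fin k]→L[ℝ] V) = α (f' p) := by rw [h.self_of_nhds]
  show (α (f p) : E [⋀^Fin k]→L[ℝ] V).compContinuousLinearMap
    (mfderiv 𝓘(ℝ, F) 𝓘(ℝ, E) f p : F →L[ℝ] E) = _
  rw [h1, h2]
  rfl

theorem pullbackForm_id (α : Form E M k V) (p : M) : pullbackForm id α p = α p := by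
  ext v
  simp only [pullbackForm_apply, mfderiv_id]
  rfl

theorem pullbackForm_flat (f : F → E) (α : Form E E k V) (y : F) :
    (pullbackForm f α y : F [⋀^Fin k]→L[ℝ] V)
      = (α (f y) : E [⋀^Fin k]→L[ℝ] V).compContinuousLinearMap (fderiv ℝ f y) := by
  show (α (f y) : E [⋀^Fin k]→L[ℝ] V).compContinuousLinearMap
    (mfderiv 𝓘(ℝ, F) 𝓘(ℝ, E) f y : F →L[ℝ] E) = _
  rw [mfderiv_eq_fderiv]
  rfl

theorem chartForm_eq_pullbackForm (α : Form E M k V) (x₀ : M) :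
    chartForm α x₀ = pullbackForm (extChartAt 𝓘(ℝ, E) x₀).symm α := rfl

variable [IsManifold 𝓘(ℝ, E) ∞ M] [IsManifold 𝓘(ℝ, F) ∞ N]

theorem mdifferentiableAt_extChartAt_symm' {x₀ : M} {y : E}
    (hy : y ∈ (extChartAt 𝓘(ℝ, E) x₀).target) :
    MDifferentiableAt 𝓘(ℝ, E) 𝓘(ℝ, E) (extChartAt 𝓘(ℝ, E) x₀).symm y := by
  have : IsManifold 𝓘(ℝ, E) 1 M := IsManifold.of_le (n := ∞) (by simp)
  have h := mdifferentiableWithinAt_extChartAt_symm hy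
  rwa [modelWithCornersSelf_coe, Set.range_id, mdifferentiableWithinAt_univ] at h

theorem contMDiffAt_extChartAt_symm' {x₀ : M} {y : E}
    (hy : y ∈ (extChartAt 𝓘(ℝ, E) x₀).target) :
    ContMDiffAt 𝓘(ℝ, E) 𝓘(ℝ, E) ∞ (extChartAt 𝓘(ℝ, E) x₀).symm y :=
  (contMDiffOn_extChartAt_symm x₀).contMDiffAt
    ((isOpen_extChartAt_target x₀).mem_nhds hy)

omit [IsManifold 𝓘(ℝ, E) ∞ M] in
theorem eventually_extChartAt_target {x₀ : M} {y : E}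
    (hy : y ∈ (extChartAt 𝓘(ℝ, E) x₀).target) :
    ∀ᶠ z in 𝓝 y, z ∈ (extChartAt 𝓘(ℝ, E) x₀).target :=
  (isOpen_extChartAt_target x₀).mem_nhds hy

theorem continuousAt_extChartAt_symm_of_mem {x₀ : M} {y : E}
    (hy : y ∈ (extChartAt 𝓘(ℝ, E) x₀).target) :
    ContinuousAt (extChartAt 𝓘(ℝ, E) x₀).symm y :=
  (mdifferentiableAt_extChartAt_symm' hy).continuousAt

/-- The local expression of a map in charts. -/
def localMap (f : N → M) (p₀ : N) (x₀ : M) : F → E :=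
  extChartAt 𝓘(ℝ, E) x₀ ∘ f ∘ (extChartAt 𝓘(ℝ, F) p₀).symm

omit [IsManifold 𝓘(ℝ, E) ∞ M] in
theorem localMap_eventuallyEq {f : N → M} {p₀ : N} {x₀ : M} {y : F}
    (hy : y ∈ (extChartAt 𝓘(ℝ, F) p₀).target)
    (hf : ContinuousAt f ((extChartAt 𝓘(ℝ, F) p₀).symm y))
    (hx : f ((extChartAt 𝓘(ℝ, F) p₀).symm y) ∈ (extChartAt 𝓘(ℝ, E) x₀).source) :
    f ∘ (extChartAt 𝓘(ℝ, F) p₀).symm =ᶠ[𝓝 y]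
      (extChartAt 𝓘(ℝ, E) x₀).symm ∘ localMap (E := E) (F := F) f p₀ x₀ := by
  have hc : ContinuousAt (f ∘ (extChartAt 𝓘(ℝ, F) p₀).symm) y :=
    ContinuousAt.comp hf (continuousAt_extChartAt_symm_of_mem hy)
  filter_upwards [hc.preimage_mem_nhds ((isOpen_extChartAt_source x₀).mem_nhds hx)] with z hz
  exact ((extChartAt 𝓘(ℝ, E) x₀).left_inv hz).symm

theorem localMap_contDiffAt {f : N → M} {p₀ : N} {x₀ : M} {y : F}
    (hy : y ∈ (extChartAt 𝓘(ℝ, F) p₀).target)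
    (hf : ContMDiffAt 𝓘(ℝ, F) 𝓘(ℝ, E) ∞ f ((extChartAt 𝓘(ℝ, F) p₀).symm y))
    (hx : f ((extChartAt 𝓘(ℝ, F) p₀).symm y) ∈ (extChartAt 𝓘(ℝ, E) x₀).source) :
    ContDiffAt ℝ ∞ (localMap (E := E) (F := F) f p₀ x₀) y := by
  rw [← contMDiffAt_iff_contDiffAt]
  have h1 : ContMDiffAt 𝓘(ℝ, E) 𝓘(ℝ, E) ∞ (extChartAt 𝓘(ℝ, E) x₀)
      (f ((extChartAt 𝓘(ℝ, F) p₀).symm y)) :=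
    contMDiffAt_extChartAt' (by simpa using hx)
  exact h1.comp y (hf.comp y (contMDiffAt_extChartAt_symm' hy))

/-- Near y the map f followed through the charts is `localMap`, so functoriality of pull-back,
applied to the two factorizations of f ∘ chart⁻¹, gives the flat formula. -/
theorem chartForm_pullbackForm {f : N → M} (α : Form E M k V) {p₀ : N} {x₀ : M} {y : F}
    (hy : y ∈ (extChartAt 𝓘(ℝ, F) p₀).target)
    (hf : ContMDiffAt 𝓘(ℝ, F) 𝓘(ℝ, E) ∞ f ((extChartAt 𝓘(ℝ, F) p₀).symm y))
    (hx : f ((extChartAt 𝓘(ℝ, F) p₀).symm y) ∈ (extChartAt 𝓘(ℝ, E) x₀).source) :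
    chartForm (pullbackForm (F := F) f α) p₀ y =
      (chartForm α x₀ (localMap (E := E) (F := F) f p₀ x₀ y)).compContinuousLinearMap
        (fderiv ℝ (localMap (E := E) (F := F) f p₀ x₀) y) := by
  have hdf := hf.mdifferentiableAt (by simp)
  have hd := mdifferentiableAt_extChartAt_symm' hy
  rw [chartForm_eq_pullbackForm]
  erw [← pullbackForm_comp (F := F) α hdf hd,
    pullbackForm_congr α (localMap_eventuallyEq hy hf.continuousAt hx)]
  have hm : localMap (E := E) (F := F) f p₀ x₀ y ∈ (extChartAt 𝓘(ℝ, E) x₀).target :=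
    (extChartAt 𝓘(ℝ, E) x₀).map_source hx
  have h2 : MDifferentiableAt 𝓘(ℝ, F) 𝓘(ℝ, E) (localMap (E := E) (F := F) f p₀ x₀) y :=
    ((localMap_contDiffAt hy hf hx).differentiableAt (by simp)).mdifferentiableAt
  erw [pullbackForm_comp (F := E) α (mdifferentiableAt_extChartAt_symm' hm) h2]
  rw [← chartForm_eq_pullbackForm]
  exact pullbackForm_flat _ _ _

omit [ChartedSpace E M] [IsManifold 𝓘(ℝ, E) ∞ M] in
theorem eventually_mem_of_continuousAt {f : N → M} {p₀ : N} {y : F}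
    (hy : y ∈ (extChartAt 𝓘(ℝ, F) p₀).target) {O : Set M} (hO : IsOpen O)
    (hf : ContinuousAt f ((extChartAt 𝓘(ℝ, F) p₀).symm y))
    (hx : f ((extChartAt 𝓘(ℝ, F) p₀).symm y) ∈ O) :
    ∀ᶠ z in 𝓝 y, f ((extChartAt 𝓘(ℝ, F) p₀).symm z) ∈ O :=
  (ContinuousAt.comp (f := (extChartAt 𝓘(ℝ, F) p₀).symm) hf
    (continuousAt_extChartAt_symm_of_mem hy)).preimage_mem_nhds (hO.mem_nhds hx)

omit [IsManifold 𝓘(ℝ, F) ∞ N] in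
theorem SmoothFormOn.contDiffAt {α : Form F N k V} {D : Set N} (h : SmoothFormOn α D)
    [IsManifold 𝓘(ℝ, F) ∞ N]
    (hD : IsOpen D) {p₀ : N} {y : F} (hy : y ∈ (extChartAt 𝓘(ℝ, F) p₀).target)
    (hyD : (extChartAt 𝓘(ℝ, F) p₀).symm y ∈ D) : ContDiffAt ℝ ∞ (chartForm α p₀) y :=
  (h p₀).contDiffAt (Filter.inter_mem (eventually_extChartAt_target hy)
    ((continuousAt_extChartAt_symm_of_mem hy).preimage_mem_nhds (hD.mem_nhds hyD)))

omit [IsManifold 𝓘(ℝ, F) ∞ N] in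
theorem smoothFormOn_of_contDiffAt {α : Form F N k V} {D : Set N}
    (h : ∀ p₀ y, y ∈ (extChartAt 𝓘(ℝ, F) p₀).target → (extChartAt 𝓘(ℝ, F) p₀).symm y ∈ D →
      ContDiffAt ℝ ∞ (chartForm α p₀) y) : SmoothFormOn α D :=
  fun p₀ y hy => (h p₀ y hy.1 hy.2).contDiffWithinAt

omit [IsManifold 𝓘(ℝ, F) ∞ N] in
theorem SmoothFormOn.mono {α : Form F N k V} {D D' : Set N} (h : SmoothFormOn α D)
    (hD : D' ⊆ D) : SmoothFormOn α D' :=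
  fun p₀ => (h p₀).mono fun _ hy => ⟨hy.1, hD hy.2⟩

/-- Naturality of d: in the two preferred charts the claim is the flat identity d(f^*α) = f^*(dα).
The map must be smooth near p, not only at p, because the chart expression has to be known on a
neighbourhood before it is differentiated. -/
theorem mextDeriv_pullbackForm {f : N → M} {α : Form E M k V} {D : Set M} (hD : IsOpen D)
    (hα : SmoothFormOn α D) {p : N} (hp : f p ∈ D)
    (hf : ∀ᶠ q in 𝓝 p, ContMDiffAt 𝓘(ℝ, F) 𝓘(ℝ, E) ∞ f q) :
    mextDeriv (pullbackForm (F := F) f α) p = pullbackForm f (mextDeriv α) p := by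
  set y₀ := extChartAt 𝓘(ℝ, F) p p with hy₀
  have hy : y₀ ∈ (extChartAt 𝓘(ℝ, F) p).target := mem_extChartAt_target p
  have hsy : (extChartAt 𝓘(ℝ, F) p).symm y₀ = p := extChartAt_to_inv p
  have hfp := hf.self_of_nhds
  have hx : f ((extChartAt 𝓘(ℝ, F) p).symm y₀) ∈ (extChartAt 𝓘(ℝ, E) (f p)).source := by
    rw [hsy]; exact mem_extChartAt_source (f p)
  have hfy : ContMDiffAt 𝓘(ℝ, F) 𝓘(ℝ, E) ∞ f ((extChartAt 𝓘(ℝ, F) p).symm y₀) := by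
    rwa [hsy]
  have hev : chartForm (pullbackForm (F := F) f α) p =ᶠ[𝓝 y₀] fun y =>
      (chartForm α (f p) (localMap (E := E) (F := F) f p (f p) y)).compContinuousLinearMap
        (fderiv ℝ (localMap (E := E) (F := F) f p (f p)) y) := by
    have h1 : ∀ᶠ z in 𝓝 y₀, ContMDiffAt 𝓘(ℝ, F) 𝓘(ℝ, E) ∞ f
        ((extChartAt 𝓘(ℝ, F) p).symm z) := by
      refine (continuousAt_extChartAt_symm_of_mem hy).eventually ?_
      rwa [hsy]
    filter_upwards [eventually_extChartAt_target hy, h1, eventually_mem_of_continuousAt hy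
      (isOpen_extChartAt_source (f p)) hfy.continuousAt hx] with z hz hz1 hz2
    exact chartForm_pullbackForm α hz hz1 hz2
  have hloc : localMap (E := E) (F := F) f p (f p) y₀ = extChartAt 𝓘(ℝ, E) (f p) (f p) := by
    simp [localMap, hy₀]
  have hα' : DifferentiableAt ℝ (chartForm α (f p)) (localMap (E := E) (F := F) f p (f p) y₀) := by
    rw [hloc]
    refine (hα.contDiffAt hD (mem_extChartAt_target (f p)) ?_).differentiableAt (by simp)
    rwa [extChartAt_to_inv]
  have hlc := localMap_contDiffAt hy hfy hx
  have key := extDeriv_pullback hα' hlc (by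
    rw [minSmoothness_of_isRCLikeNormedField]
    exact WithTop.coe_le_coe.2 le_top)
  have hmf : (mfderiv 𝓘(ℝ, F) 𝓘(ℝ, E) f p : F →L[ℝ] E) = fderiv ℝ (localMap (E := E) (F := F) f p (f p)) y₀ := by
    have := (hfp.mdifferentiableAt (by simp)).mfderiv
    rw [this]
    simp [writtenInExtChartAt, localMap, hy₀]
    rfl
  show (extDeriv (chartForm (pullbackForm (F := F) f α) p) y₀ : F [⋀^Fin (k + 1)]→L[ℝ] V) =
    (extDeriv (chartForm α (f p)) (extChartAt 𝓘(ℝ, E) (f p) (f p)) :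
      E [⋀^Fin (k + 1)]→L[ℝ] V).compContinuousLinearMap
        (mfderiv 𝓘(ℝ, F) 𝓘(ℝ, E) f p : F →L[ℝ] E)
  rw [hev.extDeriv_eq, key, hloc, hmf]
  rfl

end FormCalculus

/-! ### One-forms in charts, read as fields of linear maps. -/

section OneForms

variable {E : Type*} [NormedAddCommGroup E] [NormedSpace ℝ E]
  {M : Type*} [TopologicalSpace M] [ChartedSpace E M]
  {F : Type*} [NormedAddCommGroup F] [NormedSpace ℝ F]
  {N : Type*} [TopologicalSpace N] [ChartedSpace F N]
  {k : ℕ} {V : Type*} [NormedAddCommGroup V] [NormedSpace ℝ V]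

variable (E V) in
/-- Alternating maps in one variable are linear maps. -/
def oneFormEquiv : (E →L[ℝ] V) ≃ₗᵢ[ℝ] (E [⋀^Fin 1]→L[ℝ] V) :=
  ContinuousAlternatingMap.ofSubsingletonLIE (0 : Fin 1)

/-- A 1-form on a vector space as a field of continuous linear maps. -/
def flatLin (η : E → E [⋀^Fin 1]→L[ℝ] V) (y : E) : E →L[ℝ] V :=
  (oneFormEquiv E V).symm (η y)

theorem vec1_eq {T : Type*} (v : Fin 1 → T) : v = ![v 0] := by
  ext i; fin_cases i; rfl

theorem flatLin_apply (η : E → E [⋀^Fin 1]→L[ℝ] V) (y v : E) : flatLin η y v = η y ![v] := by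
  obtain ⟨L, hL⟩ :=
    (oneFormEquiv E V).surjective (η y)
  rw [flatLin, ← hL, LinearIsometryEquiv.symm_apply_apply]
  rfl

theorem contDiffAt_flatLin_iff {η : E → E [⋀^Fin 1]→L[ℝ] V} {y : E} {r : WithTop ℕ∞} :
    ContDiffAt ℝ r (flatLin η) y ↔ ContDiffAt ℝ r η y :=
  (oneFormEquiv E V).symm.toContinuousLinearEquiv.comp_contDiffAt_iff

/-- Turns exterior derivatives of one-forms into antisymmetrized `fderiv`s, the shape in which the
Leibniz rule and the Bianchi and Nijenhuis computations are carried out. -/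
theorem extDeriv_one_apply {η : E → E [⋀^Fin 1]→L[ℝ] V} {y : E} (hη : DifferentiableAt ℝ η y)
    (v w : E) :
    extDeriv η y ![v, w] = fderiv ℝ (flatLin η) y v w - fderiv ℝ (flatLin η) y w v := by
  have hd : DifferentiableAt ℝ (flatLin η) y :=
    (oneFormEquiv E V).symm.toContinuousLinearEquiv.differentiableAt.comp y hη
  have h : ∀ a b : E, fderiv ℝ (flatLin η) y a b = fderiv ℝ (fun z => η z ![b]) y a := by
    intro a b
    have : (fun z => η z ![b]) = fun z => flatLin η z b := by
      ext z; rw [flatLin_apply]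
    rw [this, fderiv_clm_apply hd (differentiableAt_const b)]
    simp
  rw [extDeriv_apply hη, h, h]
  have h0 : Fin.removeNth (0 : Fin 2) ![v, w] = ![w] := by ext i; fin_cases i; rfl
  have h1 : Fin.removeNth (1 : Fin 2) ![v, w] = ![v] := by ext i; fin_cases i; rfl
  simp [Fin.sum_univ_two, h0, h1, sub_eq_add_neg]

theorem mextDeriv_flat (α : Form E E k V) (y : E) :
    (mextDeriv α y : E [⋀^Fin (k + 1)]→L[ℝ] V) = extDeriv (𝕜 := ℝ) (E := E) α y := by
  have h : chartForm α y = α := by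
    funext z
    rw [chartForm_eq_pullbackForm]
    exact pullbackForm_id α z
  show (extDeriv (𝕜 := ℝ) (E := E) (chartForm α y) (extChartAt 𝓘(ℝ, E) y y)) = _
  rw [h]
  rfl

variable [IsManifold 𝓘(ℝ, E) ∞ M] [IsManifold 𝓘(ℝ, F) ∞ N]

/-- `mextDeriv` uses a different chart at each point. Naturality along an inverse chart shows that
one fixed chart computes it at all points of that chart. -/
theorem SmoothFormOn.chartForm_flat {α : Form E M k V} {D : Set M} (hD : IsOpen D)
    (hα : SmoothFormOn α D) {x₀ : M} {y : E} (hy : y ∈ (extChartAt 𝓘(ℝ, E) x₀).target)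
    (hyD : (extChartAt 𝓘(ℝ, E) x₀).symm y ∈ D) :
    chartForm (mextDeriv α) x₀ y = extDeriv (𝕜 := ℝ) (E := E) (chartForm α x₀) y := by
  rw [← mextDeriv_flat (chartForm α x₀) y, chartForm_eq_pullbackForm, chartForm_eq_pullbackForm]
  refine (mextDeriv_pullbackForm (F := E) hD hα hyD ?_).symm
  filter_upwards [eventually_extChartAt_target hy] with z hz
  exact contMDiffAt_extChartAt_symm' hz

theorem mextDeriv_one_apply {α : Form E M 1 V} {D : Set M} (hD : IsOpen D)
    (hα : SmoothFormOn α D) {x₀ : M} {y : E} (hy : y ∈ (extChartAt 𝓘(ℝ, E) x₀).target)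
    (hyD : (extChartAt 𝓘(ℝ, E) x₀).symm y ∈ D) (v w : E) :
    mextDeriv α ((extChartAt 𝓘(ℝ, E) x₀).symm y)
      ![mfderiv 𝓘(ℝ, E) 𝓘(ℝ, E) (extChartAt 𝓘(ℝ, E) x₀).symm y v,
        mfderiv 𝓘(ℝ, E) 𝓘(ℝ, E) (extChartAt 𝓘(ℝ, E) x₀).symm y w] =
      fderiv ℝ (flatLin (chartForm α x₀)) y v w - fderiv ℝ (flatLin (chartForm α x₀)) y w v := by
  rw [← extDeriv_one_apply ((hα.contDiffAt hD hy hyD).differentiableAt (by simp)),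
    ← SmoothFormOn.chartForm_flat hD hα hy hyD]
  show _ = mextDeriv α ((extChartAt 𝓘(ℝ, E) x₀).symm y) _
  congr 1
  ext i; fin_cases i <;> rfl

theorem mfderiv_extChartAt_symm_self (x : M) :
    (mfderiv 𝓘(ℝ, E) 𝓘(ℝ, E) (extChartAt 𝓘(ℝ, E) x).symm (extChartAt 𝓘(ℝ, E) x x) : E →L[ℝ] E)
      = ContinuousLinearMap.id ℝ E := by
  have : IsManifold 𝓘(ℝ, E) 1 M := IsManifold.of_le (n := ∞) (by simp)
  have h := mfderivWithin_range_extChartAt_symm (I := 𝓘(ℝ, E)) (x := x)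
  rw [modelWithCornersSelf_coe, Set.range_id, mfderivWithin_univ] at h
  exact h

theorem chartForm_self (α : Form E M k V) (x : M) :
    chartForm α x (extChartAt 𝓘(ℝ, E) x x) = α x := by
  have h := extChartAt_to_inv (I := 𝓘(ℝ, E)) x
  have h2 : (α ((extChartAt 𝓘(ℝ, E) x).symm (extChartAt 𝓘(ℝ, E) x x)) : E [⋀^Fin k]→L[ℝ] V)
    = α x := by rw [h]
  show (α ((extChartAt 𝓘(ℝ, E) x).symm (extChartAt 𝓘(ℝ, E) x x)) :
    E [⋀^Fin k]→L[ℝ] V).compContinuousLinearMap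
      (mfderiv 𝓘(ℝ, E) 𝓘(ℝ, E) (extChartAt 𝓘(ℝ, E) x).symm (extChartAt 𝓘(ℝ, E) x x) :
        E →L[ℝ] E) = _
  rw [h2, mfderiv_extChartAt_symm_self]
  ext v; rfl

theorem mextDeriv_one_self {α : Form E M 1 V} {D : Set M} (hD : IsOpen D)
    (hα : SmoothFormOn α D) {x : M} (hx : x ∈ D) (v w : E) :
    mextDeriv α x ![v, w] = fderiv ℝ (flatLin (chartForm α x)) (extChartAt 𝓘(ℝ, E) x x) v w
      - fderiv ℝ (flatLin (chartForm α x)) (extChartAt 𝓘(ℝ, E) x x) w v := by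
  rw [← extDeriv_one_apply]
  · rfl
  · refine (hα.contDiffAt hD (mem_extChartAt_target x) ?_).differentiableAt (by simp)
    rwa [extChartAt_to_inv]

omit [IsManifold 𝓘(ℝ, E) ∞ M] in
theorem flatLin_chartForm_apply (α : Form E M 1 V) (x₀ : M) (y v : E) :
    flatLin (chartForm α x₀) y v = α ((extChartAt 𝓘(ℝ, E) x₀).symm y)
      ![mfderiv 𝓘(ℝ, E) 𝓘(ℝ, E) (extChartAt 𝓘(ℝ, E) x₀).symm y v] := by
  rw [flatLin_apply]
  show α ((extChartAt 𝓘(ℝ, E) x₀).symm y) _ = _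
  congr 1
  ext i; fin_cases i; rfl

theorem flatLin_chartForm_self (α : Form E M 1 V) (x : M) (v : E) :
    flatLin (chartForm α x) (extChartAt 𝓘(ℝ, E) x x) v = α x ![v] := by
  rw [flatLin_apply, chartForm_self]
  rfl

/-- For one-forms the pull-back is a composition of linear maps, the form at `localMap` with the
derivative of `localMap`, so smoothness follows from that of the two factors. -/
theorem SmoothFormOn.pullbackForm {f : N → M} {α : Form E M 1 V} {D : Set M} (hD : IsOpen D)
    (hα : SmoothFormOn α D) {W : Set N} (hW : Set.MapsTo f W D)
    (hf : ∀ p ∈ W, ContMDiffAt 𝓘(ℝ, F) 𝓘(ℝ, E) ∞ f p) (hWo : IsOpen W) :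
    SmoothFormOn (pullbackForm (F := F) f α) W := by
  refine smoothFormOn_of_contDiffAt fun p₀ y hy hyW => ?_
  set q := (extChartAt 𝓘(ℝ, F) p₀).symm y with hq
  have hx : f q ∈ (extChartAt 𝓘(ℝ, E) (f q)).source := mem_extChartAt_source _
  have hev : chartForm (QK.pullbackForm (F := F) f α) p₀ =ᶠ[𝓝 y] fun y =>
      (chartForm α (f q) (localMap (E := E) (F := F) f p₀ (f q) y)).compContinuousLinearMap
        (fderiv ℝ (localMap (E := E) (F := F) f p₀ (f q)) y) := by
    filter_upwards [eventually_extChartAt_target hy,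
      (continuousAt_extChartAt_symm_of_mem hy).preimage_mem_nhds (hWo.mem_nhds hyW),
      eventually_mem_of_continuousAt hy (isOpen_extChartAt_source (f q)) (hf q hyW).continuousAt hx]
      with z hz hz1 hz2
    exact chartForm_pullbackForm α hz (hf _ hz1) hz2
  refine ContDiffAt.congr_of_eventuallyEq ?_ hev
  rw [← contDiffAt_flatLin_iff]
  have hl := localMap_contDiffAt hy (hf q hyW) hx
  have hl0 : localMap (E := E) (F := F) f p₀ (f q) y = extChartAt 𝓘(ℝ, E) (f q) (f q) := rfl
  have ha : ContDiffAt ℝ ∞ (flatLin (chartForm α (f q)))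
      (localMap (E := E) (F := F) f p₀ (f q) y) := by
    rw [contDiffAt_flatLin_iff, hl0]
    refine hα.contDiffAt hD (mem_extChartAt_target _) ?_
    rw [extChartAt_to_inv]
    exact hW hyW
  have hd : ContDiffAt ℝ ∞ (fderiv ℝ (localMap (E := E) (F := F) f p₀ (f q))) y :=
    hl.fderiv_right (by simp)
  refine ((ha.comp y hl).clm_comp hd).congr_of_eventuallyEq (Filter.Eventually.of_forall ?_)
  intro z
  ext v
  rw [flatLin_apply]
  simp only [ContinuousLinearMap.comp_apply, Function.comp_apply, flatLin_apply]
  show chartForm α (f q) _ _ = _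
  congr 1
  ext i; fin_cases i; rfl

end OneForms

/-! ### Linear combinations of 1-forms with function coefficients -/

section Combinations

variable {E : Type*} [NormedAddCommGroup E] [NormedSpace ℝ E]
  {M : Type*} [TopologicalSpace M] [ChartedSpace E M] {ι : Type*} [Fintype ι]

/-- `∑ f_i α_i`. -/
def combForm (f : ι → M → ℂ) (α : ι → Form E M 1 ℂ) : Form E M 1 ℂ :=
  fun x => ∑ i, f i x • α i x

theorem combForm_apply (f : ι → M → ℂ) (α : ι → Form E M 1 ℂ) (x : M)
    (v : Fin 1 → TangentSpace 𝓘(ℝ, E) x) : combForm f α x v = ∑ i, f i x * α i x v := by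
  simp [combForm, ContinuousAlternatingMap.sum_apply]

theorem flatLin_chartForm_combForm (f : ι → M → ℂ) (α : ι → Form E M 1 ℂ) (x₀ : M) :
    flatLin (chartForm (combForm f α) x₀) = fun y =>
      ∑ i, f i ((extChartAt 𝓘(ℝ, E) x₀).symm y) • flatLin (chartForm (α i) x₀) y := by
  ext y v
  simp only [_root_.sum_apply, _root_.smul_apply,
    flatLin_chartForm_apply]
  exact combForm_apply f α _ _

variable [IsManifold 𝓘(ℝ, E) ∞ M]

theorem contDiffAt_comp_extChartAt_symm {f : M → ℂ} {O : Set M} (hO : IsOpen O)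
    (hf : ContMDiffOn 𝓘(ℝ, E) 𝓘(ℝ, ℂ) ∞ f O) {x₀ : M} {y : E}
    (hy : y ∈ (extChartAt 𝓘(ℝ, E) x₀).target) (hyO : (extChartAt 𝓘(ℝ, E) x₀).symm y ∈ O) :
    ContDiffAt ℝ ∞ (fun z => f ((extChartAt 𝓘(ℝ, E) x₀).symm z)) y := by
  rw [← contMDiffAt_iff_contDiffAt]
  exact (hf.contMDiffAt (hO.mem_nhds hyO)).comp y (contMDiffAt_extChartAt_symm' hy)

theorem SmoothFormOn.combForm {f : ι → M → ℂ} {α : ι → Form E M 1 ℂ} {O : Set M} (hO : IsOpen O)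
    (hf : ∀ i, ContMDiffOn 𝓘(ℝ, E) 𝓘(ℝ, ℂ) ∞ (f i) O) (hα : ∀ i, SmoothFormOn (α i) O) :
    SmoothFormOn (combForm f α) O := by
  refine smoothFormOn_of_contDiffAt fun x₀ y hy hyO => ?_
  rw [← contDiffAt_flatLin_iff, flatLin_chartForm_combForm]
  refine ContDiffAt.sum fun i _ => ?_
  exact (contDiffAt_comp_extChartAt_symm hO (hf i) hy hyO).smul
    (contDiffAt_flatLin_iff.2 ((hα i).contDiffAt hO hy hyO))

theorem scalarDeriv_eq_fderiv {f : M → ℂ} {x : M}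
    (hf : MDifferentiableAt 𝓘(ℝ, E) 𝓘(ℝ, ℂ) f x) (v : TangentSpace 𝓘(ℝ, E) x) :
    scalarDeriv f x v = fderiv ℝ (fun z => f ((extChartAt 𝓘(ℝ, E) x).symm z))
      (extChartAt 𝓘(ℝ, E) x x) v := by
  rw [scalarDeriv, hf.mfderiv]
  simp [writtenInExtChartAt]
  rfl

theorem fderiv_sum_smul_alt {φ : ι → E → ℂ} {L : ι → E → E →L[ℝ] ℂ} {y : E}
    (hφ : ∀ i, DifferentiableAt ℝ (φ i) y) (hL : ∀ i, DifferentiableAt ℝ (L i) y) (v w : E) :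
    fderiv ℝ (fun z => ∑ i, φ i z • L i z) y v w - fderiv ℝ (fun z => ∑ i, φ i z • L i z) y w v =
      ∑ i, (fderiv ℝ (φ i) y v * L i y w - fderiv ℝ (φ i) y w * L i y v
        + φ i y * (fderiv ℝ (L i) y v w - fderiv ℝ (L i) y w v)) := by
  rw [fderiv_fun_sum (fun i _ => (hφ i).fun_smul (hL i))]
  simp only [_root_.sum_apply, ← Finset.sum_sub_distrib]
  refine Finset.sum_congr rfl fun i _ => ?_
  rw [fderiv_fun_smul (hφ i) (hL i)]
  simp only [_root_.add_apply, _root_.smul_apply,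
    ContinuousLinearMap.smulRight_apply, smul_eq_mul]
  ring

/-- The Leibniz rule d(∑ f α) = ∑ (df ∧ α + f dα); it yields the torsion of a gauge transformed
vielbein. -/
theorem mextDeriv_combForm {f : ι → M → ℂ} {α : ι → Form E M 1 ℂ} {O : Set M} (hO : IsOpen O)
    (hf : ∀ i, ContMDiffOn 𝓘(ℝ, E) 𝓘(ℝ, ℂ) ∞ (f i) O) (hα : ∀ i, SmoothFormOn (α i) O)
    {x : M} (hx : x ∈ O) (v w : TangentSpace 𝓘(ℝ, E) x) :
    mextDeriv (combForm f α) x ![v, w] =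
      ∑ i, (scalarDeriv (f i) x v * α i x ![w] - scalarDeriv (f i) x w * α i x ![v]
        + f i x * mextDeriv (α i) x ![v, w]) := by
  have hy : extChartAt 𝓘(ℝ, E) x x ∈ (extChartAt 𝓘(ℝ, E) x).target := mem_extChartAt_target x
  have hyO : (extChartAt 𝓘(ℝ, E) x).symm (extChartAt 𝓘(ℝ, E) x x) ∈ O := by
    rwa [extChartAt_to_inv]
  have hsd : ∀ i u, scalarDeriv (f i) x u = _ := fun i u =>
    scalarDeriv_eq_fderiv (((hf i).contMDiffAt (hO.mem_nhds hx)).mdifferentiableAt (by simp)) u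
  have key := fderiv_sum_smul_alt
    (fun i => (contDiffAt_comp_extChartAt_symm hO (hf i) hy hyO).differentiableAt (by simp))
    (fun i => (contDiffAt_flatLin_iff.2 ((hα i).contDiffAt hO hy hyO)).differentiableAt (by simp))
    v w
  rw [← flatLin_chartForm_combForm] at key
  refine (mextDeriv_one_self hO (SmoothFormOn.combForm hO hf hα) hx v w).trans (key.trans ?_)
  refine Finset.sum_congr rfl fun i _ => ?_
  rw [hsd, hsd, extChartAt_to_inv]
  exact congrArg₂ (· + ·) (congrArg₂ (· - ·)
    (congrArg _ (flatLin_chartForm_self (α i) x w)) (congrArg _ (flatLin_chartForm_self (α i) x v)))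
    (congrArg _ (mextDeriv_one_self hO (hα i) hx v w).symm)

/-- The differential of a function as a 1-form. -/
def dForm (f : M → ℂ) : Form E M 1 ℂ := fun x =>
  ContinuousAlternatingMap.ofSubsingleton ℝ (TangentSpace 𝓘(ℝ, E) x) ℂ (0 : Fin 1)
    (mfderiv 𝓘(ℝ, E) 𝓘(ℝ, ℂ) f x)

omit [IsManifold 𝓘(ℝ, E) ∞ M] in
theorem dForm_apply (f : M → ℂ) (x : M) (v : TangentSpace 𝓘(ℝ, E) x) :
    dForm f x ![v] = scalarDeriv f x v := rfl

theorem SmoothFormOn.dForm {f : M → ℂ} {O : Set M} (hO : IsOpen O)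
    (hf : ContMDiffOn 𝓘(ℝ, E) 𝓘(ℝ, ℂ) ∞ f O) : SmoothFormOn (dForm (E := E) f) O := by
  refine smoothFormOn_of_contDiffAt fun x₀ y hy hyO => ?_
  rw [← contDiffAt_flatLin_iff]
  refine ((contDiffAt_comp_extChartAt_symm hO hf hy hyO).fderiv_right
    (m := ∞) (by simp)).congr_of_eventuallyEq ?_
  filter_upwards [eventually_extChartAt_target hy,
    (continuousAt_extChartAt_symm_of_mem hy).preimage_mem_nhds (hO.mem_nhds hyO)] with z hz hzO
  ext v
  rw [flatLin_chartForm_apply, dForm_apply, scalarDeriv]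
  have h := mfderiv_comp z
    ((hf.contMDiffAt (hO.mem_nhds hzO)).mdifferentiableAt (by simp))
    (mdifferentiableAt_extChartAt_symm' hz)
  rw [mfderiv_eq_fderiv] at h
  exact (congrArg (fun L : E →L[ℝ] ℂ => L v) h).symm

end Combinations

/-! ### The first Bianchi identity -/

section FlatBianchi

variable {E : Type*} [NormedAddCommGroup E] [NormedSpace ℝ E] {ι : Type*} [Fintype ι]

/-- The curvature `dΓ + Γ ∧ Γ` of a matrix of 1-forms on a vector space. -/
def flatCurv (Γ : ι → ι → E → E →L[ℝ] ℂ) (y : E) (i j : ι) (v w : E) : ℂ :=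
  fderiv ℝ (Γ i j) y v w - fderiv ℝ (Γ i j) y w v
    + ∑ k, (Γ i k y v * Γ k j y w - Γ i k y w * Γ k j y v)

/-- Differentiate du + Γ ∧ u = 0 and sum cyclically. Symmetry of second derivatives removes ddu, and
replacing du by -Γ ∧ u in the remaining term turns dΓ ∧ u - Γ ∧ du into (dΓ + Γ ∧ Γ) ∧ u. -/
theorem flat_bianchi {u : ι → E → E →L[ℝ] ℂ} {Γ : ι → ι → E → E →L[ℝ] ℂ} {y : E}
    (hu : ∀ i, ContDiffAt ℝ ∞ (u i) y) (hΓ : ∀ i j, DifferentiableAt ℝ (Γ i j) y)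
    (h : ∀ᶠ z in 𝓝 y, ∀ i v w, fderiv ℝ (u i) z v w - fderiv ℝ (u i) z w v
      + ∑ j, (Γ i j z v * u j z w - Γ i j z w * u j z v) = 0) (i : ι) (a b c : E) :
    ∑ j, (flatCurv Γ y i j a b * u j y c + flatCurv Γ y i j b c * u j y a
      + flatCurv Γ y i j c a * u j y b) = 0 := by
  have hud : ∀ i, DifferentiableAt ℝ (u i) y := fun i => (hu i).differentiableAt (by simp)
  have hu2 : ∀ i, DifferentiableAt ℝ (fderiv ℝ (u i)) y := fun i =>
    ((hu i).fderiv_right (m := ∞) (by simp)).differentiableAt (by simp)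
  have hsymm : ∀ a b c, fderiv ℝ (fderiv ℝ (u i)) y a b c = fderiv ℝ (fderiv ℝ (u i)) y b a c := by
    intro a b c
    have := (hu i).isSymmSndFDerivAt (by
      rw [minSmoothness_of_isRCLikeNormedField]
      exact WithTop.coe_le_coe.2 le_top)
    rw [this a b]
  -- The equation on fixed v, w is a scalar function that vanishes near y; this is its derivative in
  -- the direction a.
  have key : ∀ a v w, fderiv ℝ (fderiv ℝ (u i)) y a v w - fderiv ℝ (fderiv ℝ (u i)) y a w v
      + ∑ j, (fderiv ℝ (Γ i j) y a v * u j y w + Γ i j y v * fderiv ℝ (u j) y a w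
        - (fderiv ℝ (Γ i j) y a w * u j y v + Γ i j y w * fderiv ℝ (u j) y a v)) = 0 := by
    intro a v w
    have hz : (fun z => fderiv ℝ (u i) z v w - fderiv ℝ (u i) z w v
      + ∑ j, (Γ i j z v * u j z w - Γ i j z w * u j z v)) =ᶠ[𝓝 y] fun _ => (0 : ℂ) := by
      filter_upwards [h] with z hz using hz i v w
    have hev : ∀ (L : E → E →L[ℝ] ℂ), DifferentiableAt ℝ L y → ∀ v,
        HasFDerivAt (fun z => L z v) ((ContinuousLinearMap.apply ℝ ℂ v).comp (fderiv ℝ L y)) y :=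
      fun L hL v => (ContinuousLinearMap.apply ℝ ℂ v).hasFDerivAt.comp y hL.hasFDerivAt
    have hev2 : ∀ v w, ∃ L : E →L[ℝ] ℂ, HasFDerivAt (fun z => fderiv ℝ (u i) z v w) L y ∧
        ∀ a, L a = fderiv ℝ (fderiv ℝ (u i)) y a v w := fun v w =>
      ⟨_, ((hu2 i).hasFDerivAt.clm_apply (hasFDerivAt_const v y)).clm_apply (hasFDerivAt_const w y),
        fun a => by simp⟩
    obtain ⟨L₁, hL₁, hL₁'⟩ := hev2 v w
    obtain ⟨L₂, hL₂, hL₂'⟩ := hev2 w v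
    have hd := (hL₁.sub hL₂).add (HasFDerivAt.fun_sum (u := Finset.univ) fun j _ =>
      ((hev _ (hΓ i j) v).mul (hev _ (hud j) w)).sub ((hev _ (hΓ i j) w).mul (hev _ (hud j) v)))
    have h0 := (hd.congr_of_eventuallyEq hz.symm).unique (hasFDerivAt_const (0 : ℂ) y)
    have h1 := congrArg (fun L : E →L[ℝ] ℂ => L a) h0
    simp only [_root_.add_apply, _root_.sub_apply,
      _root_.sum_apply, ContinuousLinearMap.comp_apply,
      ContinuousLinearMap.apply_apply, _root_.smul_apply, smul_eq_mul,
      _root_.zero_apply, hL₁', hL₂'] at h1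
    rw [← h1]
    congr 1
    exact Finset.sum_congr rfl fun j _ => by ring
  have hself := h.self_of_nhds
  -- The equation at y itself is used to eliminate du; this produces the quadratic terms of the
  -- curvature.
  have hswap : ∀ v w x, ∑ j, Γ i j y v * (fderiv ℝ (u j) y w x - fderiv ℝ (u j) y x w)
      = - ∑ j, (∑ k, Γ i k y v * Γ k j y w) * u j y x
        + ∑ j, (∑ k, Γ i k y v * Γ k j y x) * u j y w := by
    intro v w x
    have h1 : ∀ j, Γ i j y v * (fderiv ℝ (u j) y w x - fderiv ℝ (u j) y x w)
        = - ∑ k, Γ i j y v * Γ j k y w * u k y x + ∑ k, Γ i j y v * Γ j k y x * u k y w := by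
      intro j
      have h2 := hself j w x
      rw [Finset.sum_sub_distrib] at h2
      simp only [mul_assoc, ← Finset.mul_sum]
      linear_combination (Γ i j y v) * h2
    simp only [h1, Finset.sum_add_distrib, Finset.sum_neg_distrib]
    congr 1
    · rw [Finset.sum_comm]
      simp only [Finset.sum_mul]
    · rw [Finset.sum_comm]
      simp only [Finset.sum_mul]
  have e1 := key a b c
  have e2 := key b c a
  have e3 := key c a b
  have s1 := hswap a b c
  have s2 := hswap b c a
  have s3 := hswap c a b
  have c1 := hsymm a b c
  have c2 := hsymm b c a
  have c3 := hsymm c a b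
  simp only [flatCurv, Finset.sum_sub_distrib, Finset.sum_add_distrib, add_mul, sub_mul, mul_sub]
    at e1 e2 e3 s1 s2 s3 ⊢
  linear_combination e1 + e2 + e3 + s1 + s2 + s3 - c1 - c2 - c3

/-- Apply `flat_bianchi` to the single connection m ⊗ 1 + 1 ⊗ s on pairs of indices. Its curvature
is the sum of the two curvatures, because the two factors act on different indices and commute. -/
theorem flat_bianchi_tensor {κ : Type*} [Fintype κ] {u : κ → ι → E → E →L[ℝ] ℂ}
    {m : κ → κ → E → E →L[ℝ] ℂ} {s : ι → ι → E → E →L[ℝ] ℂ} {y : E}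
    (hu : ∀ A i, ContDiffAt ℝ ∞ (u A i) y) (hm : ∀ A B, DifferentiableAt ℝ (m A B) y)
    (hs : ∀ i j, DifferentiableAt ℝ (s i j) y)
    (h : ∀ᶠ z in 𝓝 y, ∀ A i v w, fderiv ℝ (u A i) z v w - fderiv ℝ (u A i) z w v
      + ∑ B, (m A B z v * u B i z w - m A B z w * u B i z v)
      + ∑ j, (s i j z v * u A j z w - s i j z w * u A j z v) = 0) (A : κ) (i : ι) (a b c : E) :
    ∑ B, (flatCurv m y A B a b * u B i y c + flatCurv m y A B b c * u B i y a
      + flatCurv m y A B c a * u B i y b)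
    + ∑ j, (flatCurv s y i j a b * u A j y c + flatCurv s y i j b c * u A j y a
      + flatCurv s y i j c a * u A j y b) = 0 := by
  classical
  -- Kronecker deltas known only through their contraction rules, so that `ring` treats them as
  -- atoms.
  obtain ⟨d, hd, hd'⟩ : ∃ d : κ → κ → ℂ, (∀ A (X : κ → ℂ), ∑ B, d A B * X B = X A) ∧
      (∀ A (X : κ → ℂ), ∑ B, d B A * X B = X A) :=
    ⟨fun A B => if A = B then 1 else 0, by simp, by simp⟩
  obtain ⟨e, he, he'⟩ : ∃ e : ι → ι → ℂ, (∀ i (X : ι → ℂ), ∑ j, e i j * X j = X i) ∧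
      (∀ i (X : ι → ℂ), ∑ j, e j i * X j = X i) :=
    ⟨fun i j => if i = j then 1 else 0, by simp, by simp⟩
  obtain ⟨Γ, hΓ⟩ : ∃ Γ : κ × ι → κ × ι → E → E →L[ℝ] ℂ, ∀ p q z,
    Γ p q z = e p.2 q.2 • m p.1 q.1 z + d p.1 q.1 • s p.2 q.2 z := ⟨_, fun _ _ _ => rfl⟩
  have hΓd : ∀ p q, HasFDerivAt (Γ p q) (e p.2 q.2 • fderiv ℝ (m p.1 q.1) y
      + d p.1 q.1 • fderiv ℝ (s p.2 q.2) y) y := by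
    intro p q
    rw [funext (hΓ p q)]
    exact ((hm p.1 q.1).hasFDerivAt.fun_const_smul (e p.2 q.2)).fun_add
      ((hs p.2 q.2).hasFDerivAt.fun_const_smul (d p.1 q.1))
  have key := flat_bianchi (u := fun p : κ × ι => u p.1 p.2) (Γ := Γ) (fun p => hu _ _)
    (fun p q => (hΓd p q).differentiableAt) ?_ (A, i) a b c
  · have hK : ∀ B j v w, flatCurv Γ y (A, i) (B, j) v w
        = e i j * flatCurv m y A B v w + d A B * flatCurv s y i j v w := by
      intro B j v w
      -- The two mixed products together are symmetric under exchanging v and w, hence drop out of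
      -- the antisymmetrized curvature.
      have e1 : ∀ v w, ∑ k : κ × ι, Γ (A, i) k y v * Γ k (B, j) y w
          = e i j * ∑ C, m A C y v * m C B y w + m A B y v * s i j y w + s i j y v * m A B y w
            + d A B * ∑ k, s i k y v * s k j y w := by
        intro v w
        have e2 : ∀ C k, Γ (A, i) (C, k) y v * Γ (C, k) (B, j) y w
            = e i k * (e k j * (m A C y v * m C B y w))
            + e i k * (d C B * (m A C y v * s k j y w))
            + e k j * (d A C * (s i k y v * m C B y w))
            + d A C * (d C B * (s i k y v * s k j y w)) := by
          intro C k
          simp only [hΓ, _root_.add_apply, _root_.smul_apply, smul_eq_mul]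
          ring
        simp only [Fintype.sum_prod_type, e2, Finset.sum_add_distrib]
        congr 1
        · simp only [he, he', hd, hd', ← Finset.mul_sum]
        · rw [Finset.sum_comm]
          simp only [hd, Finset.mul_sum]
      simp only [flatCurv, (hΓd _ _).fderiv, _root_.add_apply, Finset.sum_sub_distrib,
        _root_.smul_apply, smul_eq_mul, e1]
      ring
    simp only [Fintype.sum_prod_type, hK] at key
    rw [← key, ← hd A (fun B => ∑ j, (flatCurv s y i j a b * u B j y c
      + flatCurv s y i j b c * u B j y a + flatCurv s y i j c a * u B j y b)),
      ← Finset.sum_add_distrib]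
    refine Finset.sum_congr rfl fun B _ => ?_
    rw [Finset.mul_sum, ← he i (fun j => flatCurv m y A B a b * u B j y c
      + flatCurv m y A B b c * u B j y a + flatCurv m y A B c a * u B j y b),
      ← Finset.sum_add_distrib]
    exact Finset.sum_congr rfl fun j _ => by ring
  · filter_upwards [h] with z hz
    rintro ⟨A, i⟩ v w
    rw [← hz A i v w, add_assoc]
    congr 1
    rw [Fintype.sum_prod_type]
    simp only [hΓ, _root_.add_apply, _root_.smul_apply, smul_eq_mul]
    rw [← hd A (fun B => ∑ j, (s i j z v * u B j z w - s i j z w * u B j z v)),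
      ← Finset.sum_add_distrib]
    refine Finset.sum_congr rfl fun B _ => ?_
    rw [Finset.mul_sum, ← he i (fun j => m A B z v * u B j z w - m A B z w * u B j z v),
      ← Finset.sum_add_distrib]
    exact Finset.sum_congr rfl fun j _ => by ring

end FlatBianchi

section FrameBianchi

variable {n : ℕ} {E : Type*} [NormedAddCommGroup E] [NormedSpace ℝ E]
  {M : Type*} [TopologicalSpace M] [ChartedSpace E M] [IsManifold 𝓘(ℝ, E) ∞ M]

namespace Frame

variable (D : Frame n E M)

/-- The `SU(2)` connection matrix in the preferred chart at `x`. -/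
def flatSU2 (x : M) (A B : Fin 2) (y : E) : E →L[ℝ] ℂ :=
  ∑ c, (Complex.I / 2 * pauli c B A) •
    Complex.ofRealCLM.comp (flatLin (chartForm (D.su2Form c) x) y)

/-- The curvature of the `SU(2)` connection as a matrix acting on `U^{Bα}`. -/
def su2CurvMat (A B : Fin 2) (x : M) (v w : TangentSpace 𝓘(ℝ, E) x) : ℂ :=
  ∑ c, Complex.I / 2 * pauli c B A * (D.su2Curv c x v w : ℂ)

omit [IsManifold 𝓘(ℝ, E) ∞ M] in
theorem flatSU2_apply (x : M) (A B : Fin 2) (y v : E) :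
    D.flatSU2 x A B y v = D.su2Conn ((extChartAt 𝓘(ℝ, E) x).symm y)
      (mfderiv 𝓘(ℝ, E) 𝓘(ℝ, E) (extChartAt 𝓘(ℝ, E) x).symm y v) A B := by
  simp only [flatSU2, _root_.sum_apply, _root_.smul_apply,
    ContinuousLinearMap.comp_apply, flatLin_chartForm_apply, Complex.ofRealCLM_apply, smul_eq_mul,
    su2Conn, Finset.mul_sum, om]
  exact Finset.sum_congr rfl fun c _ => by ring

variable {D}

theorem hasFDerivAt_flatSU2 {x : M} {y : E}
    (h : ∀ c, DifferentiableAt ℝ (flatLin (chartForm (D.su2Form c) x)) y) (A B : Fin 2) :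
    DifferentiableAt ℝ (D.flatSU2 x A B) y ∧ ∀ v w, fderiv ℝ (D.flatSU2 x A B) y v w =
      ∑ c, Complex.I / 2 * pauli c B A *
        (fderiv ℝ (flatLin (chartForm (D.su2Form c) x)) y v w : ℂ) := by
  have hd := HasFDerivAt.fun_sum (u := Finset.univ) fun c _ =>
    (((ContinuousLinearMap.compL ℝ E ℝ ℂ Complex.ofRealCLM).hasFDerivAt.comp y
      (h c).hasFDerivAt).const_smul (Complex.I / 2 * pauli c B A))
  have hd' : HasFDerivAt (D.flatSU2 x A B) _ y := hd
  refine ⟨hd'.differentiableAt, fun v w => ?_⟩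
  rw [hd'.fderiv]
  simp

/-- The commutators of the Pauli matrices turn Γ ∧ Γ for Γ = (i/2) ω^x σ_x into the term ½ ε^{xyz}
ω^y ∧ ω^z. The transposition in (σ_x)^A_B reverses the sign of the commutator and so fixes the sign
of that term. -/
theorem chart_su2Curv {lam : ℝ} (hD : D.IsQuaternionic lam) {x : M} (hx : x ∈ D.dom)
    (A B : Fin 2) (v w : E) :
    flatCurv (D.flatSU2 x) (extChartAt 𝓘(ℝ, E) x x) A B v w = D.su2CurvMat A B x v w := by
  have hy : extChartAt 𝓘(ℝ, E) x x ∈ (extChartAt 𝓘(ℝ, E) x).target := mem_extChartAt_target x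
  have hyO : (extChartAt 𝓘(ℝ, E) x).symm (extChartAt 𝓘(ℝ, E) x x) ∈ D.dom := by
    rwa [extChartAt_to_inv]
  have hd : ∀ c, DifferentiableAt ℝ (flatLin (chartForm (D.su2Form c) x))
      (extChartAt 𝓘(ℝ, E) x x) := fun c => (contDiffAt_flatLin_iff.2
    ((hD.smooth_su2 c).contDiffAt hD.isOpen_dom hy hyO)).differentiableAt (by simp)
  have hm : ∀ c, mextDeriv (D.su2Form c) x ![v, w] = _ := fun c =>
    mextDeriv_one_self hD.isOpen_dom (hD.smooth_su2 c) hx v w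
  obtain ⟨o, ho⟩ : ∃ o : Fin 3 → E → ℝ, ∀ c v,
    flatLin (chartForm (D.su2Form c) x) (extChartAt 𝓘(ℝ, E) x x) v = o c v ∧ D.om c x v = o c v :=
    ⟨fun c v => D.om c x v, fun c v => ⟨flatLin_chartForm_self _ _ _, rfl⟩⟩
  have hf : ∀ A B (v : E), D.flatSU2 x A B (extChartAt 𝓘(ℝ, E) x x) v
      = ∑ c, Complex.I / 2 * pauli c B A * (o c v : ℂ) := by
    intro A B v
    simp only [flatSU2, _root_.sum_apply, _root_.smul_apply,
      ContinuousLinearMap.comp_apply, (ho _ _).1, Complex.ofRealCLM_apply, smul_eq_mul]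
  have hc : ∀ c, D.su2Curv c x v w = fderiv ℝ (flatLin (chartForm (D.su2Form c) x))
      (extChartAt 𝓘(ℝ, E) x x) v w - fderiv ℝ (flatLin (chartForm (D.su2Form c) x))
      (extChartAt 𝓘(ℝ, E) x x) w v + (o (c + 1) v * o (c + 2) w
        - o (c + 1) w * o (c + 2) v) := fun c => by
    rw [← (ho (c + 1) v).2, ← (ho (c + 1) w).2, ← (ho (c + 2) v).2, ← (ho (c + 2) w).2, ← hm c]
    rfl
  have c10 : (1 : Fin 3) + 1 = 2 := rfl
  have c11 : (1 : Fin 3) + 2 = 0 := rfl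
  have c20 : (2 : Fin 3) + 1 = 0 := rfl
  have c21 : (2 : Fin 3) + 2 = 1 := rfl
  have hr : D.su2CurvMat A B x v w
      = ∑ c, Complex.I / 2 * pauli c B A * (D.su2Curv c x v w : ℂ) := rfl
  rw [hr]
  simp only [flatCurv, (hasFDerivAt_flatSU2 hd _ _).2, hf, hc, Fin.sum_univ_two,
    Fin.sum_univ_three, c10, c11, c20, c21, zero_add]
  have hI : Complex.I ^ 3 = -Complex.I := by rw [pow_succ, Complex.I_sq]; ring
  fin_cases A <;> fin_cases B <;> simp [pauli] <;> ring_nf <;> (try simp only [hI, Complex.I_sq]) <;> (try ring)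

theorem chart_spCurv {lam : ℝ} (hD : D.IsQuaternionic lam) {x : M} (hx : x ∈ D.dom)
    (α β : Idx n) (v w : E) :
    flatCurv (fun α β => flatLin (chartForm (D.spForm α β) x)) (extChartAt 𝓘(ℝ, E) x x) α β v w
      = D.spCurv α β x v w := by
  have h := mextDeriv_one_self hD.isOpen_dom (hD.smooth_sp α β) hx v w
  have ho : ∀ α β (v : E), flatLin (chartForm (D.spForm α β) x) (extChartAt 𝓘(ℝ, E) x x) v
      = D.de α β x v := fun α β v => flatLin_chartForm_self _ _ _
  refine congrArg₂ (· + ·) h.symm (Finset.sum_congr rfl fun γ _ => ?_)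
  simp only [ho]
  rfl

theorem bianchi {lam : ℝ} (hD : D.IsQuaternionic lam) {x : M} (hx : x ∈ D.dom)
    (A : Fin 2) (α : Idx n) (a b c : E) :
    ∑ B, (D.su2CurvMat A B x a b * D.u B α x c + D.su2CurvMat A B x b c * D.u B α x a
      + D.su2CurvMat A B x c a * D.u B α x b)
    + ∑ β, (D.spCurv α β x a b * D.u A β x c + D.spCurv α β x b c * D.u A β x a
      + D.spCurv α β x c a * D.u A β x b) = 0 := by
  set y := extChartAt 𝓘(ℝ, E) x x with hy0
  have hy : y ∈ (extChartAt 𝓘(ℝ, E) x).target := mem_extChartAt_target x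
  have hyO : (extChartAt 𝓘(ℝ, E) x).symm y ∈ D.dom := by rwa [extChartAt_to_inv]
  have hU : ∀ A α, ContDiffAt ℝ ∞ (flatLin (chartForm (D.U A α) x)) y :=
    fun A α => contDiffAt_flatLin_iff.2 ((hD.smooth_U A α).contDiffAt hD.isOpen_dom hy hyO)
  have hsp : ∀ α β, DifferentiableAt ℝ (flatLin (chartForm (D.spForm α β) x)) y := fun α β =>
    (contDiffAt_flatLin_iff.2
      ((hD.smooth_sp α β).contDiffAt hD.isOpen_dom hy hyO)).differentiableAt (by simp)
  have hsu : ∀ A B, DifferentiableAt ℝ (D.flatSU2 x A B) y := fun A B =>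
    (hasFDerivAt_flatSU2 (fun c => (contDiffAt_flatLin_iff.2
      ((hD.smooth_su2 c).contDiffAt hD.isOpen_dom hy hyO)).differentiableAt (by simp)) A B).1
  have key := flat_bianchi_tensor (u := fun A α => flatLin (chartForm (D.U A α) x))
    (m := D.flatSU2 x) (s := fun α β => flatLin (chartForm (D.spForm α β) x)) hU hsu hsp ?_ A α a b c
  · simp only [chart_su2Curv hD hx, y] at key
    rw [← key]
    simp only [flatLin_chartForm_self]
    refine congrArg _ (Finset.sum_congr rfl fun β _ => ?_)
    rw [← chart_spCurv hD hx, ← chart_spCurv hD hx, ← chart_spCurv hD hx]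
    rfl
  -- The flat identity needs the torsion equation on a whole neighbourhood: it is evaluated at every
  -- nearby point on the images of constant coordinate vectors.
  · filter_upwards [eventually_extChartAt_target hy,
      (continuousAt_extChartAt_symm_of_mem hy).preimage_mem_nhds
        (hD.isOpen_dom.mem_nhds hyO)] with z hz hzO
    intro A α v w
    have ht := hD.torsion _ hzO (mfderiv 𝓘(ℝ, E) 𝓘(ℝ, E) (extChartAt 𝓘(ℝ, E) x).symm z v)
      (mfderiv 𝓘(ℝ, E) 𝓘(ℝ, E) (extChartAt 𝓘(ℝ, E) x).symm z w) A α
    rw [← ht, mextDeriv_one_apply hD.isOpen_dom (hD.smooth_U A α) hz hzO v w]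
    simp only [flatSU2_apply, flatLin_chartForm_apply]
    rfl

end Frame
end FrameBianchi

/-! ### Pointwise algebra of a vielbein -/

section Coframe

variable {n : ℕ} {T : Type*} [AddCommGroup T] [Module ℝ T]

/-- The element of the real form of `ℂ² ⊗ ℂ²ⁿ` whose `A = 1` components are given. -/
def realForm (z : Idx n → ℂ) : Fin 2 → Idx n → ℂ :=
  ![z, Sum.elim (fun I => -(starRingEnd ℂ) (z (.inr I))) (fun I => (starRingEnd ℂ) (z (.inl I)))]

@[simp] theorem realForm_zero (z : Idx n → ℂ) (α : Idx n) : realForm z 0 α = z α := rfl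

@[simp] theorem realForm_one_inl (z : Idx n → ℂ) (I : Fin n) :
    realForm z 1 (.inl I) = -(starRingEnd ℂ) (z (.inr I)) := rfl

@[simp] theorem realForm_one_inr (z : Idx n → ℂ) (I : Fin n) :
    realForm z 1 (.inr I) = (starRingEnd ℂ) (z (.inl I)) := rfl

theorem sum_symp_mul_inl (I : Fin n) (z : Idx n → ℂ) : ∑ β, symp n (.inl I) β * z β = z (.inr I) := by
  simp [symp, Fintype.sum_sum_type, Matrix.one_apply]

theorem sum_symp_mul_inr (I : Fin n) (z : Idx n → ℂ) :
    ∑ β, symp n (.inr I) β * z β = -z (.inl I) := by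
  simp [symp, Fintype.sum_sum_type, Matrix.one_apply]

theorem symp_antisymm (α β : Idx n) : symp n α β = -symp n β α := by
  cases α <;> cases β <;> simp [symp, Matrix.one_apply, eq_comm]

/-- The numerical identity C Cᵀ = 1: raising undoes lowering. -/
theorem sum_symp_mul_symp (α β : Idx n) (z : Idx n → ℂ) :
    ∑ ρ, symp n α ρ * ∑ β, symp n β ρ * z β = z α := by
  have h : ∀ ρ, ∑ β, symp n β ρ * z β = - ∑ β, symp n ρ β * z β := by
    intro ρ
    rw [← Finset.sum_neg_distrib]
    exact Finset.sum_congr rfl fun β _ => by rw [symp_antisymm β ρ]; ring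
  simp only [h]
  cases α with
  | inl I => rw [sum_symp_mul_inl, sum_symp_mul_inr, neg_neg]
  | inr I => rw [sum_symp_mul_inr, sum_symp_mul_inl, neg_neg]

theorem realForm_reality (z : Idx n → ℂ) (A : Fin 2) (α : Idx n) :
    (starRingEnd ℂ) (realForm z A α) = ∑ B, ∑ β, eps A B * symp n α β * realForm z B β := by
  simp only [mul_assoc, ← Finset.mul_sum]
  cases α <;> fin_cases A <;> simp [eps, sum_symp_mul_inl, sum_symp_mul_inr, -Fintype.sum_sum_type]

/-- The reality condition determines the A = 2 half from the A = 1 half, so U^{1α} alone are complex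
coordinates on the tangent space. -/
theorem eq_realForm {z : Fin 2 → Idx n → ℂ}
    (h : ∀ A α, (starRingEnd ℂ) (z A α) = ∑ B, ∑ β, eps A B * symp n α β * z B β) :
    z = realForm (z 0) := by
  have hl : ∀ I, (starRingEnd ℂ) (z 0 (.inl I)) = z 1 (.inr I) := fun I => by
    rw [h]
    simp only [mul_assoc, ← Finset.mul_sum]
    simp [eps, sum_symp_mul_inl, -Fintype.sum_sum_type]
  have hr : ∀ I, (starRingEnd ℂ) (z 0 (.inr I)) = -z 1 (.inl I) := fun I => by
    rw [h]
    simp only [mul_assoc, ← Finset.mul_sum]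
    simp [eps, sum_symp_mul_inr, -Fintype.sum_sum_type]
  funext A α
  fin_cases A
  · rfl
  · cases α with
    | inl I => simp [hr]
    | inr I => simp [hl]

variable (θ : T ≃ₗ[ℝ] (Idx n → ℂ))

/-- Real and imaginary parts of the complex vectors dual to the vielbein. -/
def dualVec : Fin 2 → Idx n → Fin 2 → T :=
  ![fun α k => θ.symm (Pi.single α (![1, Complex.I] k)),
    fun α k => θ.symm (Pi.single α.swap (![1, Complex.I] k))]

/-- The coefficients of the complex vectors dual to the vielbein. -/
def dualCoef : Fin 2 → Idx n → Fin 2 → ℂ :=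
  ![fun _ => ![1 / 2, -(Complex.I / 2)],
    Sum.elim (fun _ => ![-(1 / 2), -(Complex.I / 2)]) (fun _ => ![1 / 2, Complex.I / 2])]

/-- The components of a complex valued linear form with respect to the vielbein. -/
def comp₁ (f : T → ℂ) (A : Fin 2) (α : Idx n) : ℂ :=
  ∑ k, dualCoef A α k * f (dualVec θ A α k)

/-- The components of a complex valued bilinear form with respect to the vielbein. -/
def comp₂ (S : T → T → ℂ) (A : Fin 2) (α : Idx n) (B : Fin 2) (β : Idx n) : ℂ :=
  ∑ k, ∑ l, dualCoef A α k * dualCoef B β l * S (dualVec θ A α k) (dualVec θ B β l)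

/-- The coefficients are those of the Wirtinger derivatives ½(∂_x ∓ i ∂_y). For A = 2 the conjugate
derivative in the swapped slot is used, with a sign, because U^{2α} is plus or minus the conjugate
of U^{1β} with β the swap of α. -/
theorem comp₁_realForm (A B : Fin 2) (α β : Idx n) :
    comp₁ θ (fun v => realForm (θ v) A α) B β = if A = B ∧ α = β then 1 else 0 := by
  have hI := Complex.I_mul_I
  fin_cases A <;> fin_cases B <;> cases α <;> cases β <;>
    simp [comp₁, dualCoef, dualVec, Pi.single_apply, apply_ite] <;> (try split_ifs) <;>
    (try subst_vars) <;> simp_all [div_mul_eq_mul_div] <;> norm_num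

/-- A real linear form with complex values is a complex combination of the dz and the conjugate dz̄;
hence the U^{Aα} form a basis of the complexified cotangent space. -/
theorem linear_eq_sum_comp₁ (f : T →ₗ[ℝ] ℂ) (v : T) :
    f v = ∑ A, ∑ α, realForm (θ v) A α * comp₁ θ f A α := by
  have h1 : f v = ∑ α, ((θ v α).re * f (θ.symm (Pi.single α 1))
      + (θ v α).im * f (θ.symm (Pi.single α Complex.I))) := by
    have h2 : v = ∑ α, ((θ v α).re • θ.symm (Pi.single α 1)
      + (θ v α).im • θ.symm (Pi.single α Complex.I)) := by
      apply θ.injective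
      funext β
      simp only [map_sum, map_add, map_smul, LinearEquiv.apply_symm_apply, Finset.sum_apply,
        Pi.add_apply, Pi.smul_apply, Pi.single_apply]
      simp [Finset.sum_add_distrib, Complex.re_add_im]
    conv_lhs => rw [h2]
    simp [map_sum, map_add, map_smul]
  have key : ∀ (z a b : ℂ), (z.re : ℂ) * a + z.im * b
      = z * (1 / 2 * a + -(Complex.I / 2) * b) + (starRingEnd ℂ) z * (1 / 2 * a + Complex.I / 2 * b) := by
    intro z a b
    have h1 := Complex.re_add_im z
    have h2 : (starRingEnd ℂ) z = z.re - z.im * Complex.I := by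
      apply Complex.ext <;> simp
    rw [h2]
    nth_rewrite 3 [← h1]
    ring_nf
    rw [Complex.I_sq]; ring
  rw [h1]
  simp only [key, Finset.sum_add_distrib, Fin.sum_univ_two, Fintype.sum_sum_type, comp₁, dualCoef,
    dualVec, Matrix.cons_val_zero, Matrix.cons_val_one, realForm_zero, realForm_one_inl,
    realForm_one_inr, Sum.elim_inl, Sum.elim_inr, Sum.swap_inl, Sum.swap_inr]
  have h3 : ∀ I, -(starRingEnd ℂ) (θ v (.inr I)) * (-(1 / 2) * f (θ.symm (Pi.single (.inr I) 1))
      + -(Complex.I / 2) * f (θ.symm (Pi.single (.inr I) Complex.I)))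
      = (starRingEnd ℂ) (θ v (.inr I)) * (1 / 2 * f (θ.symm (Pi.single (.inr I) 1))
      + Complex.I / 2 * f (θ.symm (Pi.single (.inr I) Complex.I))) := fun I => by ring
  simp only [h3]
  ring

/-- A function of two vectors is real bilinear. -/
def IsBilin (S : T → T → ℂ) : Prop := ∃ L : T →ₗ[ℝ] T →ₗ[ℝ] ℂ, ∀ v w, S v w = L v w

theorem IsBilin.eq_sum {S : T → T → ℂ} (hS : IsBilin S) (v w : T) :
    S v w = ∑ A, ∑ α, ∑ B, ∑ β, realForm (θ v) A α * realForm (θ w) B β * comp₂ θ S A α B β := by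
  obtain ⟨L, hL⟩ := hS
  have h1 : ∀ v, S v w = ∑ B, ∑ β, realForm (θ w) B β * comp₁ θ (fun w => S v w) B β := by
    intro v
    simp only [hL]
    exact linear_eq_sum_comp₁ θ (L v) w
  have h2 : ∀ B β, comp₁ θ (fun w => S v w) B β
      = ∑ A, ∑ α, realForm (θ v) A α * comp₂ θ S A α B β := by
    intro B β
    let f : T →ₗ[ℝ] ℂ := ∑ k, dualCoef B β k • L.flip (dualVec θ B β k)
    have hf : ∀ v, f v = comp₁ θ (fun w => S v w) B β := by
      intro v
      simp [f, comp₁, hL]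
    rw [← hf, linear_eq_sum_comp₁ θ f v]
    refine Finset.sum_congr rfl fun A _ => Finset.sum_congr rfl fun α _ => ?_
    congr 1
    simp only [comp₁, comp₂, hf]
    refine Finset.sum_congr rfl fun k _ => ?_
    rw [Finset.mul_sum]
    exact Finset.sum_congr rfl fun l _ => by ring
  rw [h1]
  simp only [h2, Finset.mul_sum]
  rw [Finset.sum_congr rfl fun B _ => (Finset.sum_comm.trans
    (Finset.sum_congr rfl fun A _ => Finset.sum_comm)), Finset.sum_comm]
  refine Finset.sum_congr rfl fun A _ => ?_
  rw [Finset.sum_comm]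
  refine Finset.sum_congr rfl fun α _ => Finset.sum_congr rfl fun B _ =>
    Finset.sum_congr rfl fun β _ => by ring

theorem comp₂_antisymm {S : T → T → ℂ} (hS : ∀ v w, S v w = -S w v) (A B : Fin 2) (α β : Idx n) :
    comp₂ θ S A α B β = -comp₂ θ S B β A α := by
  simp only [comp₂, ← Finset.sum_neg_distrib]
  rw [Finset.sum_comm]
  refine Finset.sum_congr rfl fun k _ => Finset.sum_congr rfl fun l _ => ?_
  rw [hS]; ring

/-- The cyclic identity evaluated on three dual vectors: in each summand the vielbein factor pairs
with one dual vector and selects a single component of Q, or gives zero if the type A does not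
match. -/
theorem comp₂_bianchi {Q : Idx n → T → T → ℂ} {A : Fin 2}
    (h : ∀ a b c, ∑ β, (Q β a b * realForm (θ c) A β + Q β b c * realForm (θ a) A β
      + Q β c a * realForm (θ b) A β) = 0) (B C D : Fin 2) (β γ δ : Idx n) :
    (if A = D then comp₂ θ (Q δ) B β C γ else 0) + (if A = B then comp₂ θ (Q β) C γ D δ else 0)
      + (if A = C then comp₂ θ (Q γ) D δ B β else 0) = 0 := by
  have h1 : ∀ (P : Prop) [Decidable P] (δ : Idx n) (F : Idx n → ℂ), (if P then F δ else 0)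
      = ∑ ε, F ε * (if P ∧ ε = δ then 1 else 0) := by
    intro P _ δ F
    by_cases hP : P <;> simp [hP]
  rw [h1 (A = D) δ (fun ε => comp₂ θ (Q ε) B β C γ), h1 (A = B) β (fun ε => comp₂ θ (Q ε) C γ D δ),
    h1 (A = C) γ (fun ε => comp₂ θ (Q ε) D δ B β)]
  simp only [← comp₁_realForm θ, ← Finset.sum_add_distrib]
  -- Dual vectors are complex combinations of real ones, so the identity on them is this combination
  -- of instances of `h`.
  have h2 : ∑ k, ∑ l, ∑ m, dualCoef B β k * dualCoef C γ l * dualCoef D δ m *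
      ∑ ε, (Q ε (dualVec θ B β k) (dualVec θ C γ l) * realForm (θ (dualVec θ D δ m)) A ε
        + Q ε (dualVec θ C γ l) (dualVec θ D δ m) * realForm (θ (dualVec θ B β k)) A ε
        + Q ε (dualVec θ D δ m) (dualVec θ B β k) * realForm (θ (dualVec θ C γ l)) A ε) = 0 := by
    simp only [h, mul_zero, Finset.sum_const_zero]
  rw [← h2]
  simp only [Finset.mul_sum]
  simp only [Fin.sum_univ_two, comp₂, comp₁, ← Finset.sum_add_distrib]
  exact Finset.sum_congr rfl fun ε _ => by ring

/-- Coefficients along U^{1γ} ∧ U^{2δ} can be read off from a two-form; this gives uniqueness of the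
symmetric tensor. -/
theorem comp₂_wedge (X : Idx n → Idx n → ℂ) (γ δ : Idx n) :
    comp₂ θ (fun v w => ∑ γ, ∑ δ, X γ δ *
      wedge (fun t => realForm (θ t) 0 γ) (fun t => realForm (θ t) 1 δ) v w) 0 γ 1 δ = X γ δ := by
  have h1 : X γ δ = ∑ γ', ∑ δ', X γ' δ' * (comp₁ θ (fun v => realForm (θ v) 0 γ') 0 γ
      * comp₁ θ (fun v => realForm (θ v) 1 δ') 1 δ
      - comp₁ θ (fun v => realForm (θ v) 0 γ') 1 δ * comp₁ θ (fun v => realForm (θ v) 1 δ') 0 γ) := by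
    simp only [comp₁_realForm]
    simp [-Fintype.sum_sum_type]
  rw [h1]
  simp only [comp₂, comp₁, wedge, Fin.sum_univ_two, Finset.mul_sum, ← Finset.sum_add_distrib]
  refine Finset.sum_congr rfl fun γ' _ => Finset.sum_congr rfl fun δ' _ => by ring

/-- Both ε and the wedge are antisymmetric, so for symmetric X the (2,1) term repeats the (1,2)
term; this is the origin of the factor 2. -/
theorem sum_eps_wedge_symm {X : Idx n → Idx n → ℂ} (hX : ∀ γ δ, X γ δ = X δ γ)
    (u : Fin 2 → Idx n → T → ℂ) (v w : T) :
    ∑ A, ∑ B, ∑ γ, ∑ δ, wedge (u A γ) (u B δ) v w * eps A B * X γ δ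
      = ∑ γ, ∑ δ, (2 * X γ δ) * wedge (u 0 γ) (u 1 δ) v w := by
  have h : ∑ γ, ∑ δ, X γ δ * wedge (u 1 γ) (u 0 δ) v w
      = - ∑ γ, ∑ δ, X γ δ * wedge (u 0 γ) (u 1 δ) v w := by
    rw [Finset.sum_comm]
    simp only [← Finset.sum_neg_distrib]
    refine Finset.sum_congr rfl fun γ _ => Finset.sum_congr rfl fun δ _ => ?_
    rw [hX δ γ, wedge, wedge]; ring
  have e00 : eps 0 0 = 0 := rfl
  have e01 : eps 0 1 = 1 := rfl
  have e10 : eps 1 0 = -1 := rfl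
  have e11 : eps 1 1 = 0 := rfl
  simp only [Fin.sum_univ_two, e00, e01, e10, e11, mul_zero, zero_mul, Finset.sum_const_zero,
    zero_add, add_zero, mul_one]
  have h2 : ∀ γ δ, wedge (u 1 γ) (u 0 δ) v w * -1 * X γ δ
      = -(X γ δ * wedge (u 1 γ) (u 0 δ) v w) := fun γ δ => by ring
  have h3 : ∀ γ δ, (2 * X γ δ) * wedge (u 0 γ) (u 1 δ) v w
      = wedge (u 0 γ) (u 1 δ) v w * X γ δ + X γ δ * wedge (u 0 γ) (u 1 δ) v w := fun γ δ => by ring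
  simp only [h2, h3, Finset.sum_neg_distrib, Finset.sum_add_distrib, h, neg_neg]

/-- The algebraic Bianchi identity determines the totally symmetric part of the curvature. -/
theorem existsUnique_symmetric_tensor {Q : Idx n → Idx n → T → T → ℂ}
    (hb : ∀ α β, IsBilin (Q α β)) (ha : ∀ α β v w, Q α β v w = -Q α β w v)
    (hs : ∀ ρ β v w, ∑ α, symp n α ρ * Q α β v w = ∑ α, symp n α β * Q α ρ v w)
    (hB : ∀ A α a b c, ∑ β, (Q α β a b * realForm (θ c) A β + Q α β b c * realForm (θ a) A β
      + Q α β c a * realForm (θ b) A β) = 0) :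
    ∃! X : Idx n → Idx n → Idx n → Idx n → ℂ,
      (∀ α β γ δ, X β α γ δ = X α β γ δ) ∧ (∀ α β γ δ, X α γ β δ = X α β γ δ) ∧
      (∀ α β γ δ, X α β δ γ = X α β γ δ) ∧
      ∀ α β v w, Q α β v w = ∑ A, ∑ B, ∑ γ, ∑ δ, ∑ ρ,
        wedge (fun t => realForm (θ t) A γ) (fun t => realForm (θ t) B δ) v w
          * eps A B * symp n α ρ * X ρ β γ δ := by
  -- Q with its first index lowered; being in sp(2n), it is symmetric in its two indices.
  let L : Idx n → Idx n → T → T → ℂ := fun ρ β v w => ∑ α, symp n α ρ * Q α β v w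
  have hLQ : ∀ α β v w, Q α β v w = ∑ ρ, symp n α ρ * L ρ β v w := fun α β v w =>
    (sum_symp_mul_symp α β (fun α => Q α β v w)).symm
  have hLs : ∀ ρ β, L ρ β = L β ρ := fun ρ β => by funext v w; exact hs ρ β v w
  have hLa : ∀ ρ β v w, L ρ β v w = -L ρ β w v := by
    intro ρ β v w
    simp only [L, ← Finset.sum_neg_distrib]
    exact Finset.sum_congr rfl fun α _ => by rw [ha]; ring
  have hLb : ∀ ρ β, IsBilin (L ρ β) := by
    intro ρ β
    choose K hK using fun α => hb α β
    refine ⟨∑ α, symp n α ρ • K α, fun v w => ?_⟩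
    simp [L, hK, LinearMap.sum_apply, -Fintype.sum_sum_type]
  have hLB : ∀ A ρ a b c, ∑ β, (L ρ β a b * realForm (θ c) A β + L ρ β b c * realForm (θ a) A β
      + L ρ β c a * realForm (θ b) A β) = 0 := by
    intro A ρ a b c
    have : ∑ α, symp n α ρ * ∑ β, (Q α β a b * realForm (θ c) A β
        + Q α β b c * realForm (θ a) A β + Q α β c a * realForm (θ b) A β) = 0 := by
      simp only [hB, mul_zero, Finset.sum_const_zero]
    rw [← this]
    simp only [Finset.mul_sum]
    rw [Finset.sum_comm]
    refine Finset.sum_congr rfl fun β _ => ?_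
    simp only [L, Finset.sum_mul, ← Finset.sum_add_distrib]
    exact Finset.sum_congr rfl fun α _ => by ring
  let W : Idx n → Idx n → Idx n → Idx n → ℂ := fun ρ β γ δ => comp₂ θ (L ρ β) 0 γ 1 δ
  have w12 : ∀ α β γ δ, W β α γ δ = W α β γ δ := fun α β γ δ => by simp only [W, hLs]
  -- With two vectors of type 1 and one of type 2, the A = 1 identity has two surviving terms, and
  -- antisymmetry of Q makes them a transposition of W. The A = 2 identity gives `w24`; together
  -- with `w12` these transpositions generate all permutations.
  have w23 : ∀ α β γ δ, W α γ β δ = W α β γ δ := by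
    intro α β γ δ
    have h := comp₂_bianchi θ (Q := L α) (A := 0) (hLB 0 α) 0 1 0 β δ γ
    simp only [if_true, zero_ne_one, if_false, add_zero] at h
    rw [comp₂_antisymm θ (hLa α β)] at h
    exact add_neg_eq_zero.1 h
  have w24 : ∀ α β γ δ, W α δ γ β = W α β γ δ := by
    intro α β γ δ
    have h := comp₂_bianchi θ (Q := L α) (A := 1) (hLB 1 α) 1 0 1 δ γ β
    simp only [if_true, one_ne_zero, if_false, add_zero] at h
    rw [comp₂_antisymm θ (hLa α β)] at h
    have h' := neg_add_eq_zero.1 h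
    exact h'.symm
  have w34 : ∀ α β γ δ, W α β δ γ = W α β γ δ := fun α β γ δ => by
    rw [← w24 α β γ δ, w23 α γ δ β, w24 α β δ γ]
  -- Only one of the three vectors matches the type A here, so the cyclic sum reduces to the single
  -- component in question.
  have h00 : ∀ α ε γ δ, comp₂ θ (L α ε) 0 γ 0 δ = 0 := by
    intro α ε γ δ
    have h := comp₂_bianchi θ (Q := L α) (A := 1) (hLB 1 α) 0 0 1 γ δ ε
    simpa using h
  have h11 : ∀ α ε γ δ, comp₂ θ (L α ε) 1 γ 1 δ = 0 := by
    intro α ε γ δ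
    have h := comp₂_bianchi θ (Q := L α) (A := 0) (hLB 0 α) 1 1 0 γ δ ε
    simpa using h
  have hLW : ∀ ρ β v w, L ρ β v w = ∑ γ, ∑ δ, W ρ β γ δ *
      wedge (fun t => realForm (θ t) 0 γ) (fun t => realForm (θ t) 1 δ) v w := by
    intro ρ β v w
    rw [(hLb ρ β).eq_sum θ v w]
    simp only [Fin.sum_univ_two, h00, h11, mul_zero, Finset.sum_const_zero, add_zero, zero_add]
    have : ∑ γ, ∑ δ, realForm (θ v) 1 γ * realForm (θ w) 0 δ * comp₂ θ (L ρ β) 1 γ 0 δ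
        = ∑ γ, ∑ δ, -(realForm (θ v) 1 δ * realForm (θ w) 0 γ * W ρ β γ δ) := by
      rw [Finset.sum_comm]
      refine Finset.sum_congr rfl fun γ _ => Finset.sum_congr rfl fun δ _ => ?_
      rw [comp₂_antisymm θ (hLa ρ β)]
      ring
    rw [this, ← Finset.sum_add_distrib]
    refine Finset.sum_congr rfl fun γ _ => ?_
    rw [← Finset.sum_add_distrib]
    refine Finset.sum_congr rfl fun δ _ => ?_
    simp only [wedge, W]
    ring
  have hform : ∀ (X : Idx n → Idx n → Idx n → Idx n → ℂ), (∀ α β γ δ, X α β δ γ = X α β γ δ) →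
      ∀ α β v w, ∑ A, ∑ B, ∑ γ, ∑ δ, ∑ ρ,
        wedge (fun t => realForm (θ t) A γ) (fun t => realForm (θ t) B δ) v w
          * eps A B * symp n α ρ * X ρ β γ δ = ∑ ρ, symp n α ρ * ∑ γ, ∑ δ, (2 * X ρ β γ δ) *
      wedge (fun t => realForm (θ t) 0 γ) (fun t => realForm (θ t) 1 δ) v w := by
    intro X hX α β v w
    calc _ = ∑ A, ∑ B, ∑ γ, ∑ δ,
          wedge (fun t => realForm (θ t) A γ) (fun t => realForm (θ t) B δ) v w * eps A B *
            ∑ ρ, symp n α ρ * X ρ β γ δ := by simp only [Finset.mul_sum, mul_assoc]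
      _ = ∑ γ, ∑ δ, (2 * ∑ ρ, symp n α ρ * X ρ β γ δ) *
          wedge (fun t => realForm (θ t) 0 γ) (fun t => realForm (θ t) 1 δ) v w :=
        sum_eps_wedge_symm (X := fun γ δ => ∑ ρ, symp n α ρ * X ρ β γ δ)
          (fun γ δ => by simp only [hX _ _ γ δ]) (fun A γ t => realForm (θ t) A γ) v w
      _ = _ := by
          simp only [Finset.mul_sum, Finset.sum_mul]
          conv_rhs => rw [Finset.sum_comm]
          refine Finset.sum_congr rfl fun γ _ => ?_
          conv_rhs => rw [Finset.sum_comm]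
          refine Finset.sum_congr rfl fun δ _ => Finset.sum_congr rfl fun ρ _ => by ring
  -- The division compensates the factor 2 of `sum_eps_wedge_symm`.
  refine ⟨fun ρ β γ δ => W ρ β γ δ / 2, ⟨fun α β γ δ => by simp only [w12], fun α β γ δ => by
    simp only [w23], fun α β γ δ => by simp only [w34 α β γ δ], ?_⟩, ?_⟩
  · intro α β v w
    rw [hLQ]
    refine Eq.trans ?_ (hform (fun ρ β γ δ => W ρ β γ δ / 2)
      (fun α β γ δ => by simp only [w34 α β γ δ]) α β v w).symm
    simp only [hLW, mul_div_cancel₀ _ (two_ne_zero' ℂ)]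
  · rintro X ⟨-, -, hX34, hX⟩
    have hLX : ∀ ρ β, L ρ β = fun v w => ∑ γ, ∑ δ, (2 * X ρ β γ δ) *
        wedge (fun t => realForm (θ t) 0 γ) (fun t => realForm (θ t) 1 δ) v w := by
      intro ρ β
      funext v w
      simp only [L, hX, hform X hX34]
      set Y : Idx n → ℂ := fun ρ => ∑ γ, ∑ δ, (2 * X ρ β γ δ) *
        wedge (fun t => realForm (θ t) 0 γ) (fun t => realForm (θ t) 1 δ) v w with hY
      have h4 : ∀ α, ∑ ρ, symp n α ρ * Y ρ = - ∑ ρ, symp n ρ α * Y ρ := by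
        intro α
        rw [← Finset.sum_neg_distrib]
        exact Finset.sum_congr rfl fun β _ => by rw [symp_antisymm α β]; ring
      have h5 := sum_symp_mul_symp ρ ρ Y
      refine Eq.trans (Finset.sum_congr rfl fun α _ => ?_) h5
      show symp n α ρ * ∑ ρ', symp n α ρ' * Y ρ' = _
      rw [h4, symp_antisymm α ρ]; ring
    funext ρ β γ δ
    have h6 : W ρ β γ δ = 2 * X ρ β γ δ := by
      simp only [W, hLX]
      exact comp₂_wedge θ (fun γ δ => 2 * X ρ β γ δ) γ δ
    rw [h6]; ring

end Coframe

/-! ### Multilinearity of forms at a point and the symplectic pairing. -/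

theorem oneForm_add {E : Type*} [NormedAddCommGroup E] [NormedSpace ℝ E] {V : Type*}
    [NormedAddCommGroup V] [NormedSpace ℝ V] (η : E [⋀^Fin 1]→L[ℝ] V) (v w : E) :
    η ![v + w] = η ![v] + η ![w] :=
  η.map_vecCons_add _ _ _

theorem oneForm_smul {E : Type*} [NormedAddCommGroup E] [NormedSpace ℝ E] {V : Type*}
    [NormedAddCommGroup V] [NormedSpace ℝ V] (η : E [⋀^Fin 1]→L[ℝ] V) (c : ℝ) (v : E) :
    η ![c • v] = c • η ![v] :=
  η.map_vecCons_smul _ _ _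

theorem twoForm_swap {E : Type*} [NormedAddCommGroup E] [NormedSpace ℝ E] {V : Type*}
    [NormedAddCommGroup V] [NormedSpace ℝ V] (η : E [⋀^Fin 2]→L[ℝ] V) (v w : E) :
    η ![v, w] = -η ![w, v] := by
  have h := η.toAlternatingMap.map_swap ![w, v] (i := 0) (j := 1) (by decide)
  have h2 : (![w, v] ∘ Equiv.swap (0 : Fin 2) 1) = ![v, w] := by
    ext i; fin_cases i <;> simp
  rw [h2] at h
  exact h

theorem twoForm_isBilin {E : Type*} [NormedAddCommGroup E] [NormedSpace ℝ E]
    (η : E [⋀^Fin 2]→L[ℝ] ℂ) : IsBilin (fun v w => η ![v, w]) := by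
  have ha : ∀ v v' w, η ![v + v', w] = η ![v, w] + η ![v', w] := fun v v' w =>
    η.map_vecCons_add _ _ _
  have hs : ∀ (c : ℝ) v w, η ![c • v, w] = c • η ![v, w] := fun c v w =>
    η.map_vecCons_smul _ _ _
  refine ⟨LinearMap.mk₂ ℝ (fun v w => η ![v, w]) ha hs (fun v w w' => ?_) (fun c v w => ?_),
    fun v w => rfl⟩
  · rw [twoForm_swap, ha, twoForm_swap η v w, twoForm_swap η v w']; ring
  · rw [twoForm_swap, hs, twoForm_swap η v w, smul_neg]

section Bilin

variable {T : Type*} [AddCommGroup T] [Module ℝ T]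

theorem IsBilin.add {S S' : T → T → ℂ} (h : IsBilin S) (h' : IsBilin S') :
    IsBilin (fun v w => S v w + S' v w) := by
  obtain ⟨L, hL⟩ := h
  obtain ⟨L', hL'⟩ := h'
  exact ⟨L + L', fun v w => by simp [hL, hL']⟩

theorem IsBilin.const_mul {S : T → T → ℂ} (c : ℂ) (h : IsBilin S) :
    IsBilin (fun v w => c * S v w) := by
  obtain ⟨L, hL⟩ := h
  exact ⟨c • L, fun v w => by simp [hL]⟩

theorem IsBilin.sum {κ : Type*} [Fintype κ] {S : κ → T → T → ℂ} (h : ∀ k, IsBilin (S k)) :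
    IsBilin (fun v w => ∑ k, S k v w) := by
  choose L hL using h
  exact ⟨∑ k, L k, fun v w => by simp [hL, LinearMap.sum_apply]⟩

theorem IsBilin.wedge (f g : T →ₗ[ℝ] ℂ) : IsBilin (wedge f g) := by
  refine ⟨LinearMap.mk₂ ℝ (fun v w => f v * g w - f w * g v) ?_ ?_ ?_ ?_, fun v w => rfl⟩ <;>
    intros <;> simp <;> ring

end Bilin

/-- The symplectic pairing `C_{αβ} z^α w^β`. -/
def sympPair {n : ℕ} (z w : Idx n → ℂ) : ℂ :=
  ∑ I : Fin n, (z (.inl I) * w (.inr I) - z (.inr I) * w (.inl I))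

theorem sympPair_swap {n : ℕ} (z w : Idx n → ℂ) : sympPair w z = -sympPair z w := by
  simp only [sympPair, ← Finset.sum_neg_distrib]
  exact Finset.sum_congr rfl fun I _ => by ring

theorem sum_symp_eq_sympPair {n : ℕ} (z w : Idx n → ℂ) :
    ∑ α, ∑ β, symp n α β * (z α * w β) = sympPair z w := by
  have h : ∀ α, ∑ β, symp n α β * (z α * w β) = z α * ∑ β, symp n α β * w β := fun α => by
    rw [Finset.mul_sum]
    exact Finset.sum_congr rfl fun β _ => by ring
  simp only [h, Fintype.sum_sum_type (α₁ := Fin n) (α₂ := Fin n) (fun α => z α * _),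
    sum_symp_mul_inl, sum_symp_mul_inr, sympPair, sub_eq_add_neg,
    Finset.sum_add_distrib, Finset.sum_neg_distrib, mul_neg]

/-! ### The curvatures of a frame expressed by symplectic pairings. -/

namespace Frame

variable {n : ℕ} {E : Type*} [NormedAddCommGroup E] [NormedSpace ℝ E]
  {M : Type*} [TopologicalSpace M] [ChartedSpace E M]

/-- The vielbein as a linear map. -/
def uLinear (D : Frame n E M) (A : Fin 2) (α : Idx n) (x : M) :
    TangentSpace 𝓘(ℝ, E) x →ₗ[ℝ] ℂ where
  toFun v := D.u A α x v
  map_add' v w := oneForm_add (E := E) (D.U A α x) v w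
  map_smul' c v := oneForm_smul (E := E) (D.U A α x) c v

/-- The `Sp(2n)` connection as a linear map. -/
def deLinear (D : Frame n E M) (α β : Idx n) (x : M) :
    TangentSpace 𝓘(ℝ, E) x →ₗ[ℝ] ℂ where
  toFun v := D.de α β x v
  map_add' v w := oneForm_add (E := E) (D.spForm α β x) v w
  map_smul' c v := oneForm_smul (E := E) (D.spForm α β x) c v

variable {D : Frame n E M} {lam : ℝ}

theorem u_eq_realForm (hD : D.IsQuaternionic lam) {x : M} (hx : x ∈ D.dom)
    (v : TangentSpace 𝓘(ℝ, E) x) (A : Fin 2) (α : Idx n) :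
    D.u A α x v = realForm (fun α => D.u 0 α x v) A α :=
  congrFun (congrFun (eq_realForm (z := fun A α => D.u A α x v)
    (fun A α => hD.reality x hx v A α)) A) α

/-- A vielbein identifies the tangent space with `ℂ²ⁿ`. -/
def theta (hD : D.IsQuaternionic lam) {x : M} (hx : x ∈ D.dom) :
    TangentSpace 𝓘(ℝ, E) x ≃ₗ[ℝ] (Idx n → ℂ) :=
  LinearEquiv.ofBijective (LinearMap.pi fun α => D.uLinear 0 α x) (by
    constructor
    · rw [← LinearMap.ker_eq_bot, LinearMap.ker_eq_bot']
      intro v hv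
      refine hD.injective x hx v fun A α => ?_
      have h0 : (fun α => D.u 0 α x v) = 0 := hv
      rw [u_eq_realForm hD hx, h0]
      fin_cases A <;> cases α <;> simp
    · intro z
      obtain ⟨v, hv⟩ := hD.surjective x hx (realForm z) (fun A α => realForm_reality z A α)
      exact ⟨v, funext fun α => hv 0 α⟩)

theorem u_eq_theta (hD : D.IsQuaternionic lam) {x : M} (hx : x ∈ D.dom)
    (v : TangentSpace 𝓘(ℝ, E) x) (A : Fin 2) (α : Idx n) :
    D.u A α x v = realForm (theta hD hx v) A α :=
  u_eq_realForm hD hx v A α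

/-- The pairing `C_{αβ} U^{Aα} U^{Bβ}` of tangent vectors. -/
def uPair (D : Frame n E M) (A B : Fin 2) (x : M) (v w : TangentSpace 𝓘(ℝ, E) x) : ℂ :=
  sympPair (fun α => D.u A α x v) (fun β => D.u B β x w)

theorem uPair_swap (D : Frame n E M) (A B : Fin 2) (x : M) (v w : TangentSpace 𝓘(ℝ, E) x) :
    D.uPair B A x w v = -D.uPair A B x v w := sympPair_swap _ _

theorem su2Curv_eq_uPair (hD : D.IsQuaternionic lam) {x : M} (hx : x ∈ D.dom) (c : Fin 3)
    (v w : TangentSpace 𝓘(ℝ, E) x) : (D.su2Curv c x v w : ℂ) = Complex.I * lam *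
      ∑ A, ∑ B, pauliLow c A B * (D.uPair A B x v w - D.uPair A B x w v) := by
  rw [hD.su2Curv_eq x hx]
  congr 1
  refine Finset.sum_congr rfl fun A _ => Finset.sum_congr rfl fun B _ => ?_
  simp only [uPair, ← sum_symp_eq_sympPair, ← Finset.sum_sub_distrib, Finset.mul_sum]
  refine Finset.sum_congr rfl fun α _ => Finset.sum_congr rfl fun β _ => ?_
  rw [wedge]; ring

/-- Lowered with ε, σ_1 and σ_2 are diagonal, so only the pairings of U^1 with U^1 and of U^2 with
U^2 enter Ω^1 and Ω^2, while σ_3 leads to the mixed pairing in Ω^3. The two diagonal pairings are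
conjugate (`uPair_one_one`), which makes Ω^1 and Ω^2 the imaginary and the real part of one complex
form. -/
theorem su2Curv_zero (hD : D.IsQuaternionic lam) {x : M} (hx : x ∈ D.dom)
    (v w : TangentSpace 𝓘(ℝ, E) x) : (D.su2Curv 0 x v w : ℂ) = 2 * Complex.I * lam *
      (D.uPair 0 0 x v w - D.uPair 1 1 x v w) := by
  rw [su2Curv_eq_uPair hD hx]
  simp [pauliLow, pauli, eps, Fin.sum_univ_two]
  rw [D.uPair_swap 0 0 x v w, D.uPair_swap 1 1 x v w]
  ring

theorem su2Curv_one (hD : D.IsQuaternionic lam) {x : M} (hx : x ∈ D.dom)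
    (v w : TangentSpace 𝓘(ℝ, E) x) : (D.su2Curv 1 x v w : ℂ) = 2 * lam *
      (D.uPair 0 0 x v w + D.uPair 1 1 x v w) := by
  rw [su2Curv_eq_uPair hD hx]
  simp [pauliLow, pauli, eps, Fin.sum_univ_two]
  rw [D.uPair_swap 0 0 x v w, D.uPair_swap 1 1 x v w]
  ring_nf
  rw [Complex.I_sq]; ring

theorem su2Curv_two (hD : D.IsQuaternionic lam) {x : M} (hx : x ∈ D.dom)
    (v w : TangentSpace 𝓘(ℝ, E) x) : (D.su2Curv 2 x v w : ℂ) = -(2 * Complex.I * lam) *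
      (D.uPair 0 1 x v w - D.uPair 0 1 x w v) := by
  rw [su2Curv_eq_uPair hD hx]
  simp [pauliLow, pauli, eps, Fin.sum_univ_two]
  rw [D.uPair_swap 0 1 x v w, D.uPair_swap 0 1 x w v]
  ring

theorem su2CurvMat_eq (hD : D.IsQuaternionic lam) {x : M} (hx : x ∈ D.dom)
    (v w : TangentSpace 𝓘(ℝ, E) x) :
    D.su2CurvMat 0 0 x v w = lam * (D.uPair 0 1 x v w - D.uPair 0 1 x w v) ∧
    D.su2CurvMat 0 1 x v w = -(2 * lam) * D.uPair 0 0 x v w ∧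
    D.su2CurvMat 1 0 x v w = 2 * lam * D.uPair 1 1 x v w ∧
    D.su2CurvMat 1 1 x v w = -lam * (D.uPair 0 1 x v w - D.uPair 0 1 x w v) := by
  simp only [su2CurvMat, Fin.sum_univ_three, su2Curv_zero hD hx, su2Curv_one hD hx,
    su2Curv_two hD hx]
  refine ⟨?_, ?_, ?_, ?_⟩ <;> simp [pauli] <;> ring_nf <;> (try simp only [Complex.I_sq]) <;>
    (try ring)

/-- The part of the `Sp(2n)` curvature determined by the metric. -/
def spCurv₀ (D : Frame n E M) (lam : ℝ) (α β : Idx n) (x : M) (v w : TangentSpace 𝓘(ℝ, E) x) : ℂ :=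
  lam * (∑ A, ∑ B, eps A B * wedge (D.u A α x) (D.uLow B β x) v w)

theorem spCurv₀_eq (D : Frame n E M) (α β : Idx n) (x : M) (v w : TangentSpace 𝓘(ℝ, E) x) :
    D.spCurv₀ lam α β x v w = lam * (wedge (D.u 0 α x) (D.uLow 1 β x) v w
      - wedge (D.u 1 α x) (D.uLow 0 β x) v w) := by
  simp [spCurv₀, Fin.sum_univ_two, eps, sub_eq_add_neg]

theorem sum_uLow_mul_u (A B : Fin 2) (x : M) (b c : TangentSpace 𝓘(ℝ, E) x) :
    ∑ β, D.uLow B β x b * D.u A β x c = D.uPair A B x c b := by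
  simp only [uPair, ← sum_symp_eq_sympPair, uLow, Finset.sum_mul]
  exact Finset.sum_congr rfl fun β _ => Finset.sum_congr rfl fun γ _ => by ring

/-- The λ-terms of the two curvatures cancel in the Bianchi identity, as for a quaternionic
projective space; what is left of the Sp(2n) curvature satisfies the cyclic identity alone. -/
theorem bianchi_spCurv₀ (hD : D.IsQuaternionic lam) {x : M} (hx : x ∈ D.dom)
    (A : Fin 2) (α : Idx n) (a b c : TangentSpace 𝓘(ℝ, E) x) :
    ∑ B, (D.su2CurvMat A B x a b * D.u B α x c + D.su2CurvMat A B x b c * D.u B α x a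
      + D.su2CurvMat A B x c a * D.u B α x b)
    + ∑ β, (D.spCurv₀ lam α β x a b * D.u A β x c + D.spCurv₀ lam α β x b c * D.u A β x a
      + D.spCurv₀ lam α β x c a * D.u A β x b) = 0 := by
  have h : ∀ a b c, ∑ β, D.spCurv₀ lam α β x a b * D.u A β x c
      = lam * (D.u 0 α x a * D.uPair A 1 x c b - D.u 0 α x b * D.uPair A 1 x c a
        - D.u 1 α x a * D.uPair A 0 x c b + D.u 1 α x b * D.uPair A 0 x c a) := by
    intro a b c
    simp only [← sum_uLow_mul_u, Finset.mul_sum, ← Finset.sum_sub_distrib,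
      ← Finset.sum_add_distrib, spCurv₀_eq, wedge]
    exact Finset.sum_congr rfl fun β _ => by ring
  simp only [Finset.sum_add_distrib, h]
  have s := D.uPair_swap
  obtain ⟨f1, f2, f3, f4⟩ := su2CurvMat_eq hD hx a b
  obtain ⟨g1, g2, g3, g4⟩ := su2CurvMat_eq hD hx b c
  obtain ⟨k1, k2, k3, k4⟩ := su2CurvMat_eq hD hx c a
  fin_cases A
  · simp only [Fin.sum_univ_two, Fin.zero_eta, f1, f2, g1, g2, k1, k2]
    rw [s 0 0 x a b, s 0 0 x b c, s 0 0 x c a]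
    ring
  · simp only [Fin.sum_univ_two, Fin.mk_one, f3, f4, g3, g4, k3, k4]
    rw [s 1 1 x a b, s 1 1 x b c, s 1 1 x c a, s 0 1 x a b, s 0 1 x b c, s 0 1 x c a,
      s 0 1 x b a, s 0 1 x c b, s 0 1 x a c]
    ring

theorem spCurv₀_symm (ρ β : Idx n) (x : M) (v w : TangentSpace 𝓘(ℝ, E) x) :
    ∑ α, symp n α ρ * D.spCurv₀ lam α β x v w = ∑ α, symp n α β * D.spCurv₀ lam α ρ x v w := by
  have h : ∀ ρ β, ∑ α, symp n α ρ * D.spCurv₀ lam α β x v w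
      = lam * (-wedge (D.uLow 0 ρ x) (D.uLow 1 β x) v w + wedge (D.uLow 1 ρ x) (D.uLow 0 β x) v w) := by
    intro ρ β
    have e : ∀ A v, D.uLow A ρ x v = -∑ α, symp n α ρ * D.u A α x v := by
      intro A v
      rw [uLow, ← Finset.sum_neg_distrib]
      exact Finset.sum_congr rfl fun α _ => by rw [symp_antisymm]; ring
    simp only [wedge, e _ v, e _ w]
    rw [← e 1 w, ← e 1 v, ← e 0 w, ← e 0 v]
    simp only [spCurv₀_eq, wedge]
    have e' : ∀ A v, ∑ α, symp n α ρ * D.u A α x v = -D.uLow A ρ x v := fun A v => by rw [e]; ring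
    have : ∀ α, symp n α ρ * (lam * (D.u 0 α x v * D.uLow 1 β x w - D.u 0 α x w * D.uLow 1 β x v
        - (D.u 1 α x v * D.uLow 0 β x w - D.u 1 α x w * D.uLow 0 β x v)))
        = lam * (D.uLow 1 β x w * (symp n α ρ * D.u 0 α x v)
          - D.uLow 1 β x v * (symp n α ρ * D.u 0 α x w)
          - D.uLow 0 β x w * (symp n α ρ * D.u 1 α x v)
          + D.uLow 0 β x v * (symp n α ρ * D.u 1 α x w)) := fun α => by ring
    simp only [this]
    rw [← Finset.mul_sum]
    simp only [Finset.sum_add_distrib, Finset.sum_sub_distrib]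
    simp only [← Finset.mul_sum, e']
    ring
  rw [h, h]
  simp only [wedge]
  ring

end Frame

section

variable {E : Type*} [NormedAddCommGroup E] [NormedSpace ℝ E]
  {M : Type*} [TopologicalSpace M] [ChartedSpace E M] [IsManifold 𝓘(ℝ, E) ∞ M]
  {k : ℕ} {V : Type*} [NormedAddCommGroup V] [NormedSpace ℝ V]

theorem chartForm_eventuallyEq {α β : Form E M k V} {O : Set M} (hO : IsOpen O)
    (h : ∀ x ∈ O, α x = β x) {x₀ : M} {y : E} (hy : y ∈ (extChartAt 𝓘(ℝ, E) x₀).target)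
    (hyO : (extChartAt 𝓘(ℝ, E) x₀).symm y ∈ O) : chartForm α x₀ =ᶠ[𝓝 y] chartForm β x₀ := by
  filter_upwards [(continuousAt_extChartAt_symm_of_mem hy).preimage_mem_nhds
    (hO.mem_nhds hyO)] with z hz
  simp only [chartForm, h _ hz]

theorem mextDeriv_congr {α β : Form E M k V} {O : Set M} (hO : IsOpen O)
    (h : ∀ x ∈ O, α x = β x) {x : M} (hx : x ∈ O) : mextDeriv α x = mextDeriv β x :=
  (chartForm_eventuallyEq hO h (mem_extChartAt_target x)
    (by rwa [extChartAt_to_inv])).extDeriv_eq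

theorem mextDeriv_combForm_const {ι : Type*} [Fintype ι] (c : ι → ℂ) {α : ι → Form E M 1 ℂ}
    {O : Set M} (hO : IsOpen O) (hα : ∀ i, SmoothFormOn (α i) O) {x : M} (hx : x ∈ O)
    (v w : TangentSpace 𝓘(ℝ, E) x) :
    mextDeriv (combForm (fun i _ => c i) α) x ![v, w] = ∑ i, c i * mextDeriv (α i) x ![v, w] := by
  rw [mextDeriv_combForm hO (fun i => contMDiffOn_const) hα hx]
  refine Finset.sum_congr rfl fun i _ => ?_
  have h : ∀ v : TangentSpace 𝓘(ℝ, E) x, scalarDeriv (fun _ : M => c i) x v = 0 := by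
    intro v
    rw [scalarDeriv, mfderiv_const]
    rfl
  rw [h, h]; ring

end

/-! ### The symmetric tensor of the Sp(2n) curvature. -/

namespace Frame

variable {n : ℕ} {E : Type*} [NormedAddCommGroup E] [NormedSpace ℝ E]
  {M : Type*} [TopologicalSpace M] [ChartedSpace E M] {D : Frame n E M} {lam : ℝ}

theorem spCurv_swap (α β : Idx n) (x : M) (v w : TangentSpace 𝓘(ℝ, E) x) :
    D.spCurv α β x v w = -D.spCurv α β x w v := by
  rw [spCurv, spCurv, neg_add, ← Finset.sum_neg_distrib]
  refine congrArg₂ (· + ·) (twoForm_swap (E := E) _ v w) (Finset.sum_congr rfl fun γ _ => ?_)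
  simp only [wedge]; ring

theorem spCurv_isBilin (α β : Idx n) (x : M) : IsBilin (D.spCurv α β x) :=
  (twoForm_isBilin (E := E) (mextDeriv (D.spForm α β) x)).add
    (IsBilin.sum fun γ => IsBilin.wedge (D.deLinear α γ x) (D.deLinear γ β x))

theorem spCurv₀_swap (α β : Idx n) (x : M) (v w : TangentSpace 𝓘(ℝ, E) x) :
    D.spCurv₀ lam α β x v w = -D.spCurv₀ lam α β x w v := by
  simp only [spCurv₀_eq, wedge]; ring

theorem spCurv₀_isBilin (α β : Idx n) (x : M) : IsBilin (D.spCurv₀ lam α β x) := by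
  refine IsBilin.const_mul _ (IsBilin.sum fun A => IsBilin.sum fun B => IsBilin.const_mul _ ?_)
  have h : D.uLow B β x = (∑ γ, symp n β γ • D.uLinear B γ x :
      TangentSpace 𝓘(ℝ, E) x →ₗ[ℝ] ℂ) := by
    funext v
    simp only [LinearMap.sum_apply, LinearMap.smul_apply, smul_eq_mul]
    rfl
  rw [h]
  exact IsBilin.wedge (D.uLinear A α x) _

/-- The Lie algebra condition in index form: X with its upper index lowered is symmetric. -/
theorem symm_of_mem_sp {X : Matrix (Idx n) (Idx n) ℂ} :
    Xᵀ * symp n + symp n * X = 0 ↔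
      ∀ ρ β, ∑ α, symp n α ρ * X α β = ∑ α, symp n α β * X α ρ := by
  rw [← Matrix.ext_iff]
  refine forall_congr' fun ρ => forall_congr' fun β => ?_
  have h : (Xᵀ * symp n + symp n * X) ρ β
      = ∑ α, symp n α β * X α ρ - ∑ α, symp n α ρ * X α β := by
    simp only [Matrix.add_apply, Matrix.mul_apply, Matrix.transpose_apply, sub_eq_add_neg,
      ← Finset.sum_neg_distrib]
    refine congrArg₂ (· + ·) (Finset.sum_congr rfl fun α _ => mul_comm _ _)
      (Finset.sum_congr rfl fun α _ => ?_)
    rw [symp_antisymm ρ α]; ring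
  rw [h, Matrix.zero_apply, sub_eq_zero, eq_comm]

variable [IsManifold 𝓘(ℝ, E) ∞ M]

theorem spCurv_symm (hD : D.IsQuaternionic lam) {x : M} (hx : x ∈ D.dom) (ρ β : Idx n)
    (v w : TangentSpace 𝓘(ℝ, E) x) :
    ∑ α, symp n α ρ * D.spCurv α β x v w = ∑ α, symp n α β * D.spCurv α ρ x v w := by
  -- The linear relation between the entries of Δ has constant coefficients and holds on the open
  -- domain, so d preserves it; the quadratic part below is a commutator in the Lie algebra.
  have h1 : ∑ α, symp n α ρ * mextDeriv (D.spForm α β) x ![v, w]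
      = ∑ α, symp n α β * mextDeriv (D.spForm α ρ) x ![v, w] := by
    rw [← mextDeriv_combForm_const (fun α => symp n α ρ) hD.isOpen_dom
        (fun α => hD.smooth_sp α β) hx,
      ← mextDeriv_combForm_const (fun α => symp n α β) hD.isOpen_dom
        (fun α => hD.smooth_sp α ρ) hx]
    congr 1
    refine mextDeriv_congr hD.isOpen_dom (fun y hy => ?_) hx
    ext t
    rw [combForm_apply, combForm_apply, vec1_eq t]
    exact symm_of_mem_sp.1 (hD.sp_symp y hy (t 0)) ρ β
  let a := D.spConn x v
  let b := D.spConn x w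
  have ha : aᵀ * symp n = -(symp n * a) := eq_neg_of_add_eq_zero_left (hD.sp_symp x hx v)
  have hb : bᵀ * symp n = -(symp n * b) := eq_neg_of_add_eq_zero_left (hD.sp_symp x hx w)
  have h2 : (a * b - b * a)ᵀ * symp n + symp n * (a * b - b * a) = 0 := by
    rw [Matrix.transpose_sub, Matrix.transpose_mul, Matrix.transpose_mul, Matrix.sub_mul,
      Matrix.mul_assoc, Matrix.mul_assoc, ha, hb, Matrix.mul_neg, Matrix.mul_neg,
      ← Matrix.mul_assoc, ← Matrix.mul_assoc, ha, hb]
    simp only [Matrix.neg_mul, Matrix.mul_sub, Matrix.mul_assoc]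
    abel
  have h3 := symm_of_mem_sp.1 h2 ρ β
  have h4 : ∀ α β, D.spCurv α β x v w = mextDeriv (D.spForm α β) x ![v, w] + (a * b - b * a) α β := by
    intro α β
    rw [spCurv, Matrix.sub_apply, Matrix.mul_apply, Matrix.mul_apply, ← Finset.sum_sub_distrib]
    refine congrArg _ (Finset.sum_congr rfl fun γ _ => ?_)
    simp only [wedge, a, b, spConn]
  simp only [h4, mul_add, Finset.sum_add_distrib, h1, h3]

/-- The symmetric tensor in the `Sp(2n)` curvature exists and is unique. -/
theorem existsUnique_omegaTensor (hD : D.IsQuaternionic lam) {x : M} (hx : x ∈ D.dom) :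
    ∃! X, D.IsOmegaTensor lam x X := by
  have key := existsUnique_symmetric_tensor (theta hD hx)
    (Q := fun α β v w => D.spCurv α β x v w + (-1) * D.spCurv₀ lam α β x v w)
    (fun α β => (spCurv_isBilin α β x).add ((spCurv₀_isBilin α β x).const_mul _))
    (fun α β v w => by rw [spCurv_swap, spCurv₀_swap]; ring)
    (fun ρ β v w => by
      have e : ∀ ρ β, ∑ α, symp n α ρ * (D.spCurv α β x v w + (-1) * D.spCurv₀ lam α β x v w)
          = ∑ α, symp n α ρ * D.spCurv α β x v w
            - ∑ α, symp n α ρ * D.spCurv₀ lam α β x v w := fun ρ β => by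
        rw [← Finset.sum_sub_distrib]
        exact Finset.sum_congr rfl fun α _ => by ring
      rw [e, e, spCurv_symm hD hx, spCurv₀_symm])
    (fun A α a b c => by
      have h1 := bianchi hD hx A α a b c
      have h2 := bianchi_spCurv₀ hD hx A α a b c
      rw [← sub_eq_zero.2 (h1.trans h2.symm), add_sub_add_left_eq_sub, ← Finset.sum_sub_distrib]
      refine Finset.sum_congr rfl fun β _ => ?_
      simp only [← u_eq_theta hD hx]
      ring)
  have hiff : ∀ X, D.IsOmegaTensor lam x X ↔
      ((∀ α β γ δ, X β α γ δ = X α β γ δ) ∧ (∀ α β γ δ, X α γ β δ = X α β γ δ) ∧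
      (∀ α β γ δ, X α β δ γ = X α β γ δ) ∧
      ∀ α β v w, D.spCurv α β x v w + (-1) * D.spCurv₀ lam α β x v w =
        ∑ A, ∑ B, ∑ γ, ∑ δ, ∑ ρ, wedge (fun t => realForm (theta hD hx t) A γ)
          (fun t => realForm (theta hD hx t) B δ) v w * eps A B * symp n α ρ * X ρ β γ δ) := by
    intro X
    simp only [← u_eq_theta hD hx]
    refine and_congr_right fun _ => and_congr_right fun _ => and_congr_right fun _ =>
      forall_congr' fun α => forall_congr' fun β => forall_congr' fun v => forall_congr' fun w => ?_
    rw [neg_one_mul, ← sub_eq_add_neg, sub_eq_iff_eq_add']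
    rfl
  simpa only [hiff] using key

end Frame

/-! ### Derivatives of matrix-valued functions -/

section MatDeriv

variable {E : Type*} [NormedAddCommGroup E] [NormedSpace ℝ E]
  {M : Type*} [TopologicalSpace M] [ChartedSpace E M]
  {κ μ ν : Type*} [Fintype κ] [Fintype μ] [Fintype ν]

/-- The entrywise differential of a matrix-valued function. -/
def matDeriv (g : M → Matrix κ μ ℂ) (y : M) (v : TangentSpace 𝓘(ℝ, E) y) : Matrix κ μ ℂ :=
  fun α β => scalarDeriv (fun z => g z α β) y v

theorem contMDiffOn_mul_complex {f g : M → ℂ} {O : Set M}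
    (hf : ContMDiffOn 𝓘(ℝ, E) 𝓘(ℝ, ℂ) ∞ f O) (hg : ContMDiffOn 𝓘(ℝ, E) 𝓘(ℝ, ℂ) ∞ g O) :
    ContMDiffOn 𝓘(ℝ, E) 𝓘(ℝ, ℂ) ∞ (fun y => f y * g y) O := by
  have h : ContDiff ℝ ∞ fun p : ℂ × ℂ => p.1 * p.2 := contDiff_fst.mul contDiff_snd
  exact h.contMDiff.comp_contMDiffOn (hf.prodMk_space hg)

theorem contMDiffOn_star_complex {f : M → ℂ} {O : Set M}
    (hf : ContMDiffOn 𝓘(ℝ, E) 𝓘(ℝ, ℂ) ∞ f O) :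
    ContMDiffOn 𝓘(ℝ, E) 𝓘(ℝ, ℂ) ∞ (fun y => star (f y)) O :=
  (Complex.conjCLE.toContinuousLinearMap.contDiff.contMDiff).comp_contMDiffOn hf

theorem contMDiffOn_sum_complex {f : κ → M → ℂ} {O : Set M}
    (hf : ∀ i, ContMDiffOn 𝓘(ℝ, E) 𝓘(ℝ, ℂ) ∞ (f i) O) :
    ContMDiffOn 𝓘(ℝ, E) 𝓘(ℝ, ℂ) ∞ (fun y => ∑ i, f i y) O := by
  have h : ContDiff ℝ ∞ fun p : κ → ℂ => ∑ i, p i := ContDiff.sum fun i _ => contDiff_apply ℝ ℂ i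
  exact h.contMDiff.comp_contMDiffOn (contMDiffOn_pi_space.2 hf)

theorem contMDiffOn_matrix_mul {f : M → Matrix κ μ ℂ} {g : M → Matrix μ ν ℂ} {O : Set M}
    (hf : ∀ α β, ContMDiffOn 𝓘(ℝ, E) 𝓘(ℝ, ℂ) ∞ (fun y => f y α β) O)
    (hg : ∀ α β, ContMDiffOn 𝓘(ℝ, E) 𝓘(ℝ, ℂ) ∞ (fun y => g y α β) O) (α : κ) (β : ν) :
    ContMDiffOn 𝓘(ℝ, E) 𝓘(ℝ, ℂ) ∞ (fun y => (f y * g y) α β) O := by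
  simp only [Matrix.mul_apply]
  exact contMDiffOn_sum_complex fun γ => contMDiffOn_mul_complex (hf α γ) (hg γ β)

theorem scalarDeriv_congr {f g : M → ℂ} {y : M} (h : f =ᶠ[𝓝 y] g)
    (v : TangentSpace 𝓘(ℝ, E) y) : scalarDeriv f y v = scalarDeriv g y v := by
  rw [scalarDeriv, scalarDeriv, h.mfderiv_eq]
  rfl

theorem scalarDeriv_const (c : ℂ) (y : M) (v : TangentSpace 𝓘(ℝ, E) y) :
    scalarDeriv (fun _ : M => c) y v = 0 := by
  rw [scalarDeriv, mfderiv_const]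
  rfl

theorem matDeriv_eq_zero_of_const {g : M → Matrix κ μ ℂ} {O : Set M} (hO : IsOpen O) {y : M}
    (hy : y ∈ O) {c : Matrix κ μ ℂ} (h : ∀ z ∈ O, g z = c) (v : TangentSpace 𝓘(ℝ, E) y) :
    matDeriv g y v = 0 := by
  ext α β
  rw [matDeriv, scalarDeriv_congr (g := fun _ => c α β)]
  · exact scalarDeriv_const _ _ _
  · filter_upwards [hO.mem_nhds hy] with z hz
    rw [h z hz]

variable [IsManifold 𝓘(ℝ, E) ∞ M]

theorem scalarDeriv_comp {V : Type*} [NormedAddCommGroup V] [NormedSpace ℝ V] {F : M → V} {φ : V → ℂ} {y : M}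
    (hF : MDifferentiableAt 𝓘(ℝ, E) 𝓘(ℝ, V) F y) (hφ : DifferentiableAt ℝ φ (F y))
    (v : TangentSpace 𝓘(ℝ, E) y) :
    scalarDeriv (fun z => φ (F z)) y v = fderiv ℝ φ (F y) (mfderiv 𝓘(ℝ, E) 𝓘(ℝ, V) F y v) := by
  have h := mfderiv_comp (I'' := 𝓘(ℝ, ℂ)) y hφ.mdifferentiableAt hF
  rw [mfderiv_eq_fderiv] at h
  exact congrArg (fun L : E →L[ℝ] ℂ => L v) h

theorem scalarDeriv_mul {f g : M → ℂ} {O : Set M} (hO : IsOpen O) {y : M} (hy : y ∈ O)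
    (hf : ContMDiffOn 𝓘(ℝ, E) 𝓘(ℝ, ℂ) ∞ f O) (hg : ContMDiffOn 𝓘(ℝ, E) 𝓘(ℝ, ℂ) ∞ g O)
    (v : TangentSpace 𝓘(ℝ, E) y) :
    scalarDeriv (fun z => f z * g z) y v = scalarDeriv f y v * g y + f y * scalarDeriv g y v := by
  have hyt := mem_extChartAt_target (I := 𝓘(ℝ, E)) y
  have hyO : (extChartAt 𝓘(ℝ, E) y).symm (extChartAt 𝓘(ℝ, E) y y) ∈ O := by rwa [extChartAt_to_inv]
  have hfg := contMDiffOn_mul_complex hf hg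
  rw [scalarDeriv_eq_fderiv ((hfg.contMDiffAt (hO.mem_nhds hy)).mdifferentiableAt (by simp)),
    scalarDeriv_eq_fderiv ((hf.contMDiffAt (hO.mem_nhds hy)).mdifferentiableAt (by simp)),
    scalarDeriv_eq_fderiv ((hg.contMDiffAt (hO.mem_nhds hy)).mdifferentiableAt (by simp))]
  have h := fderiv_fun_mul
    ((contDiffAt_comp_extChartAt_symm hO hf hyt hyO).differentiableAt (by simp))
    ((contDiffAt_comp_extChartAt_symm hO hg hyt hyO).differentiableAt (by simp))
  have key : ∀ w : E, _ = _ := fun w => congrArg (fun L : E →L[ℝ] ℂ => L w) h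
  simp only [_root_.add_apply, _root_.smul_apply, smul_eq_mul,
    extChartAt_to_inv] at key
  exact (key v).trans (by rw [add_comm, mul_comm (g y)])

theorem scalarDeriv_sum {f : κ → M → ℂ} {O : Set M} (hO : IsOpen O) {y : M} (hy : y ∈ O)
    (hf : ∀ i, ContMDiffOn 𝓘(ℝ, E) 𝓘(ℝ, ℂ) ∞ (f i) O) (v : TangentSpace 𝓘(ℝ, E) y) :
    scalarDeriv (fun z => ∑ i, f i z) y v = ∑ i, scalarDeriv (f i) y v := by
  have hyt := mem_extChartAt_target (I := 𝓘(ℝ, E)) y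
  have hyO : (extChartAt 𝓘(ℝ, E) y).symm (extChartAt 𝓘(ℝ, E) y y) ∈ O := by rwa [extChartAt_to_inv]
  rw [scalarDeriv_eq_fderiv (((contMDiffOn_sum_complex hf).contMDiffAt
    (hO.mem_nhds hy)).mdifferentiableAt (by simp))]
  have h := fderiv_fun_sum (u := Finset.univ) fun i _ =>
    (contDiffAt_comp_extChartAt_symm hO (hf i) hyt hyO).differentiableAt (by simp)
  have key : ∀ w : E, _ = _ := fun w => congrArg (fun L : E →L[ℝ] ℂ => L w) h
  simp only [_root_.sum_apply] at key
  refine (key v).trans ?_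
  exact Finset.sum_congr rfl fun i _ => (scalarDeriv_eq_fderiv
    (((hf i).contMDiffAt (hO.mem_nhds hy)).mdifferentiableAt (by simp)) v).symm

theorem scalarDeriv_star {f : M → ℂ} {O : Set M} (hO : IsOpen O) {y : M} (hy : y ∈ O)
    (hf : ContMDiffOn 𝓘(ℝ, E) 𝓘(ℝ, ℂ) ∞ f O) (v : TangentSpace 𝓘(ℝ, E) y) :
    scalarDeriv (fun z => star (f z)) y v = star (scalarDeriv f y v) := by
  refine (scalarDeriv_comp (φ := Complex.conjCLE.toContinuousLinearMap)
    ((hf.contMDiffAt (hO.mem_nhds hy)).mdifferentiableAt (by simp))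
    Complex.conjCLE.toContinuousLinearMap.differentiableAt v).trans ?_
  rw [ContinuousLinearMap.fderiv]
  rfl

theorem matDeriv_mul {f : M → Matrix κ μ ℂ} {g : M → Matrix μ ν ℂ} {O : Set M} (hO : IsOpen O)
    {y : M} (hy : y ∈ O)
    (hf : ∀ α β, ContMDiffOn 𝓘(ℝ, E) 𝓘(ℝ, ℂ) ∞ (fun y => f y α β) O)
    (hg : ∀ α β, ContMDiffOn 𝓘(ℝ, E) 𝓘(ℝ, ℂ) ∞ (fun y => g y α β) O)
    (v : TangentSpace 𝓘(ℝ, E) y) :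
    matDeriv (fun z => f z * g z) y v = matDeriv f y v * g y + f y * matDeriv g y v := by
  ext α β
  simp only [matDeriv, Matrix.add_apply, Matrix.mul_apply]
  rw [scalarDeriv_sum hO hy fun γ => contMDiffOn_mul_complex (hf α γ) (hg γ β),
    ← Finset.sum_add_distrib]
  exact Finset.sum_congr rfl fun γ _ => scalarDeriv_mul hO hy (hf α γ) (hg γ β) v

end MatDeriv

/-! ### Gauge transformations by `Sp(2n)` -/

section USp

variable {n : ℕ} {g g' : Matrix (Idx n) (Idx n) ℂ}

theorem IsUSp.conjTranspose_mul (hg : IsUSp g) : gᴴ * g = 1 := (Matrix.mem_unitaryGroup_iff').1 hg.1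

theorem IsUSp.mul_conjTranspose (hg : IsUSp g) : g * gᴴ = 1 := (Matrix.mem_unitaryGroup_iff).1 hg.1

theorem IsUSp.mul (hg : IsUSp g) (hg' : IsUSp g') : IsUSp (g * g') := by
  refine ⟨mul_mem hg.1 hg'.1, ?_⟩
  calc (g * g')ᵀ * symp n * (g * g') = g'ᵀ * (gᵀ * symp n * g) * g' := by
        rw [Matrix.transpose_mul]; simp only [Matrix.mul_assoc]
    _ = symp n := by rw [hg.2, hg'.2]

theorem IsUSp.conjTranspose (hg : IsUSp g) : IsUSp gᴴ := by
  refine ⟨?_, ?_⟩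
  · rw [Matrix.mem_unitaryGroup_iff, Matrix.star_eq_conjTranspose, Matrix.conjTranspose_conjTranspose,
      hg.conjTranspose_mul]
  · have h := hg.2
    have h2 := hg.mul_conjTranspose
    have h3 : gᴴᵀ * gᵀ = 1 := by rw [← Matrix.transpose_mul, h2, Matrix.transpose_one]
    calc gᴴᵀ * symp n * gᴴ = gᴴᵀ * (gᵀ * symp n * g) * gᴴ := by rw [h]
      _ = (gᴴᵀ * gᵀ) * symp n * (g * gᴴ) := by simp only [Matrix.mul_assoc]
      _ = symp n := by rw [h2, h3, Matrix.one_mul, Matrix.mul_one]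

/-- `gᴴᵀ` is the entrywise conjugate. A unitary symplectic matrix commutes with the antilinear
structure z ↦ C z̄, and therefore preserves the real form of ℂ² ⊗ ℂ²ⁿ. -/
theorem IsUSp.map_star_mul (hg : IsUSp g) : gᴴᵀ * symp n = symp n * g := by
  have h3 : gᴴᵀ * gᵀ = 1 := by
    rw [← Matrix.transpose_mul, hg.mul_conjTranspose, Matrix.transpose_one]
  conv_lhs => rw [← hg.2]
  rw [← Matrix.mul_assoc, ← Matrix.mul_assoc, h3, Matrix.one_mul]

theorem IsUSp.reality (hg : IsUSp g) {z : Fin 2 → Idx n → ℂ}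
    (hz : ∀ A α, (starRingEnd ℂ) (z A α) = ∑ B, ∑ β, eps A B * symp n α β * z B β) (A : Fin 2)
    (α : Idx n) : (starRingEnd ℂ) (∑ β, g α β * z A β) =
      ∑ B, ∑ β, eps A B * symp n α β * ∑ γ, g β γ * z B γ := by
  have h1 : ∀ B, ∑ β, eps A B * symp n α β * ∑ γ, g β γ * z B γ
      = eps A B * (Matrix.mulVec gᴴᵀ (Matrix.mulVec (symp n) (z B))) α := by
    intro B
    rw [Matrix.mulVec_mulVec, hg.map_star_mul, ← Matrix.mulVec_mulVec]
    simp only [Matrix.mulVec, dotProduct, Finset.mul_sum, mul_assoc]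
  simp only [h1, map_sum, map_mul, hz]
  simp only [Matrix.mulVec, dotProduct, Finset.mul_sum]
  rw [Finset.sum_comm]
  refine Finset.sum_congr rfl fun B _ => Finset.sum_congr rfl fun β _ =>
    Finset.sum_congr rfl fun γ _ => ?_
  simp only [Matrix.transpose_apply, Matrix.conjTranspose_apply, RCLike.star_def]
  ring

end USp

namespace Frame

variable {n : ℕ} {E : Type*} [NormedAddCommGroup E] [NormedSpace ℝ E]
  {M : Type*} [TopologicalSpace M] [ChartedSpace E M] {D : Frame n E M} {O : Set M}
  {g : M → Matrix (Idx n) (Idx n) ℂ} {lam : ℝ}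

/-- The frame obtained from `D` by the gauge transformation `g : O → Sp(2n)`. -/
def gaugeFrame (D : Frame n E M) (O : Set M) (g : M → Matrix (Idx n) (Idx n) ℂ) : Frame n E M where
  dom := O
  U A α := combForm (fun β y => g y α β) (fun β => D.U A β)
  su2Form := D.su2Form
  spForm α β := combForm
    (Sum.elim (fun p : Idx n × Idx n => fun y => g y α p.1 * star (g y β p.2))
      (fun γ y => -star (g y β γ)))
    (Sum.elim (fun p => D.spForm p.1 p.2) (fun γ => dForm fun y => g y α γ))

theorem gaugeFrame_u (A : Fin 2) (α : Idx n) (x : M) (v : TangentSpace 𝓘(ℝ, E) x) :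
    (gaugeFrame D O g).u A α x v = ∑ β, g x α β * D.u A β x v := combForm_apply _ _ _ _

/-- The usual law Δ' = g Δ g⁻¹ - dg g⁻¹ with the adjoint in place of the inverse, which keeps the
coefficients manifestly smooth. -/
theorem gaugeFrame_spConn (x : M) (v : TangentSpace 𝓘(ℝ, E) x) :
    (gaugeFrame D O g).spConn x v = g x * D.spConn x v * (g x)ᴴ - matDeriv g x v * (g x)ᴴ := by
  ext α β
  refine (combForm_apply _ _ _ _).trans ?_
  rw [Fintype.sum_sum_type, Fintype.sum_prod_type, Matrix.sub_apply, Matrix.mul_apply,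
    Matrix.mul_apply, sub_eq_add_neg, ← Finset.sum_neg_distrib]
  simp only [Matrix.mul_apply, Finset.sum_mul]
  congr 1
  · rw [Finset.sum_comm]
    refine Finset.sum_congr rfl fun δ _ => Finset.sum_congr rfl fun γ _ => ?_
    simp only [Sum.elim_inl, Matrix.conjTranspose_apply, spConn, de]
    ring
  · refine Finset.sum_congr rfl fun γ _ => ?_
    simp only [Sum.elim_inr, Matrix.conjTranspose_apply, dForm_apply, matDeriv]
    ring

theorem gaugeFrame_spConn_mul {x : M} (hg : IsUSp (g x)) (v : TangentSpace 𝓘(ℝ, E) x) :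
    (gaugeFrame D O g).spConn x v * g x = g x * D.spConn x v - matDeriv g x v := by
  rw [gaugeFrame_spConn, Matrix.sub_mul, Matrix.mul_assoc _ (g x)ᴴ, Matrix.mul_assoc _ (g x)ᴴ,
    hg.conjTranspose_mul, Matrix.mul_one, Matrix.mul_one]

theorem gaugeFrame_sum_wedge {x : M} (hg : IsUSp (g x)) (c : ℂ) (A B : Fin 2)
    (v w : TangentSpace 𝓘(ℝ, E) x) :
    ∑ α, ∑ β, symp n α β * c * wedge ((gaugeFrame D O g).u A α x) ((gaugeFrame D O g).u B β x) v w
      = ∑ α, ∑ β, symp n α β * c * wedge (D.u A α x) (D.u B β x) v w := by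
  have h1 : ∀ p q : Idx n → ℂ, ∑ α, ∑ β, symp n α β * (p α * q β)
      = dotProduct p (Matrix.mulVec (symp n) q) := by
    intro p q
    simp only [dotProduct, Matrix.mulVec, Finset.mul_sum]
    refine Finset.sum_congr rfl fun B _ => Finset.sum_congr rfl fun β _ => ?_
    ring
  have h2 : ∀ f f' : Idx n → TangentSpace 𝓘(ℝ, E) x → ℂ,
      ∑ α, ∑ β, symp n α β * c * wedge (f α) (f' β) v w
      = c * (dotProduct (fun α => f α v) (Matrix.mulVec (symp n) fun β => f' β w)
        - dotProduct (fun α => f α w) (Matrix.mulVec (symp n) fun β => f' β v)) := by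
    intro f f'
    rw [← h1, ← h1]
    simp only [Finset.mul_sum, ← Finset.sum_sub_distrib, wedge]
    refine Finset.sum_congr rfl fun B _ => Finset.sum_congr rfl fun β _ => ?_
    ring
  have h3 : ∀ p q : Idx n → ℂ, dotProduct (Matrix.mulVec (g x) p)
      (Matrix.mulVec (symp n) (Matrix.mulVec (g x) q)) = dotProduct p (Matrix.mulVec (symp n) q) := by
    intro p q
    rw [← Matrix.vecMul_transpose, ← Matrix.dotProduct_mulVec, Matrix.mulVec_mulVec,
      Matrix.mulVec_mulVec, hg.2]
  have h4 : ∀ A t, (fun α => (gaugeFrame D O g).u A α x t)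
      = Matrix.mulVec (g x) (fun α => D.u A α x t) := by
    intro A t
    ext α
    exact gaugeFrame_u A α x t
  rw [h2 (fun α => (gaugeFrame D O g).u A α x), h2 (fun α => D.u A α x) (fun α => D.u B α x)]
  simp only [h4, h3]

variable [IsManifold 𝓘(ℝ, E) ∞ M]

/-- The form C is USp(2n)-invariant, so the right-hand side for Ω^x is unchanged, as is ω^x. In the
torsion the dg ∧ U of the Leibniz rule cancels the inhomogeneous term of Δ'. -/
theorem gaugeFrame_isQuaternionic (hD : D.IsQuaternionic lam) (hO : IsOpen O) (hOD : O ⊆ D.dom)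
    (hg : ∀ α β, ContMDiffOn 𝓘(ℝ, E) 𝓘(ℝ, ℂ) ∞ (fun y => g y α β) O)
    (hgu : ∀ y ∈ O, IsUSp (g y)) : (gaugeFrame D O g).IsQuaternionic lam where
  isOpen_dom := hO
  smooth_U A α := SmoothFormOn.combForm hO (hg α) fun β => (hD.smooth_U A β).mono hOD
  smooth_su2 c := (hD.smooth_su2 c).mono hOD
  smooth_sp α β := by
    refine SmoothFormOn.combForm hO ?_ ?_
    · rintro (p | γ)
      · exact contMDiffOn_mul_complex (hg α p.1) (contMDiffOn_star_complex (hg β p.2))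
      · exact (Complex.conjCLE.toContinuousLinearMap.contDiff.neg.contMDiff).comp_contMDiffOn (hg β γ)
    · rintro (p | γ)
      · exact (hD.smooth_sp p.1 p.2).mono hOD
      · exact SmoothFormOn.dForm hO (hg α γ)
  reality x hx v A α := by
    simp only [gaugeFrame_u]
    exact (hgu x hx).reality (z := fun A α => D.u A α x v) (hD.reality x (hOD hx) v) A α
  injective x hx v hv := by
    refine hD.injective x (hOD hx) v fun A α => ?_
    have h : Matrix.mulVec (g x) (fun β => D.u A β x v) = 0 := by
      ext β
      exact (gaugeFrame_u (O := O) A β x v).symm.trans (hv A β)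
    have h2 := congrArg (Matrix.mulVec (g x)ᴴ) h
    rw [Matrix.mulVec_mulVec, (hgu x hx).conjTranspose_mul, Matrix.one_mulVec,
      Matrix.mulVec_zero] at h2
    exact congrFun h2 α
  surjective x hx z hz := by
    obtain ⟨v, hv⟩ := hD.surjective x (hOD hx) (fun A α => ∑ β, (g x)ᴴ α β * z A β)
      ((hgu x hx).conjTranspose.reality hz)
    refine ⟨v, fun A α => ?_⟩
    rw [gaugeFrame_u]
    simp only [hv]
    have h : Matrix.mulVec (g x) (Matrix.mulVec (g x)ᴴ (z A)) = z A := by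
      rw [Matrix.mulVec_mulVec, (hgu x hx).mul_conjTranspose, Matrix.one_mulVec]
    exact congrFun h α
  sp_antiherm x hx v := by
    set Δ' := (gaugeFrame D O g).spConn x v with hΔ
    have h1 := gaugeFrame_spConn_mul (D := D) (O := O) (hgu x hx) v
    rw [← hΔ] at h1
    -- The derivative of gᴴg = 1: it shows that the inhomogeneous term of Δ' is antihermitian. The
    -- relation is proved sandwiched between gᴴ and g and then unwound.
    have h2 := matDeriv_mul hO hx (f := fun z => (g z)ᴴ) (g := g)
      (fun α β => contMDiffOn_star_complex (hg β α)) hg v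
    rw [matDeriv_eq_zero_of_const hO hx (c := 1) fun z hz => (hgu z hz).conjTranspose_mul] at h2
    have h3 : matDeriv (fun z => (g z)ᴴ) x v = (matDeriv g x v)ᴴ := by
      ext α β
      exact scalarDeriv_star hO hx (hg β α) v
    rw [h3] at h2
    have h4 : (g x)ᴴ * (Δ'ᴴ + Δ') * g x = 0 := by
      calc (g x)ᴴ * (Δ'ᴴ + Δ') * g x = (Δ' * g x)ᴴ * g x + (g x)ᴴ * (Δ' * g x) := by
            rw [Matrix.conjTranspose_mul]; simp only [Matrix.mul_add, Matrix.add_mul, Matrix.mul_assoc]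
        _ = (D.spConn x v)ᴴ * ((g x)ᴴ * g x) + ((g x)ᴴ * g x) * D.spConn x v
            - ((matDeriv g x v)ᴴ * g x + (g x)ᴴ * matDeriv g x v) := by
            rw [h1, Matrix.conjTranspose_sub, Matrix.conjTranspose_mul]
            simp only [Matrix.mul_sub, Matrix.sub_mul, Matrix.mul_assoc]
            abel
        _ = 0 := by
            rw [← h2, (hgu x hx).conjTranspose_mul, hD.sp_antiherm x (hOD hx) v]
            simp
    have h5 : Δ'ᴴ + Δ' = 0 := by
      have := congrArg (fun A => g x * A * (g x)ᴴ) h4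
      simp only [← Matrix.mul_assoc, (hgu x hx).mul_conjTranspose, Matrix.one_mul] at this
      rwa [Matrix.mul_assoc, (hgu x hx).mul_conjTranspose, Matrix.mul_one, Matrix.mul_zero,
        Matrix.zero_mul] at this
    exact eq_neg_of_add_eq_zero_left h5
  sp_symp x hx v := by
    set Δ' := (gaugeFrame D O g).spConn x v with hΔ
    have h1 := gaugeFrame_spConn_mul (D := D) (O := O) (hgu x hx) v
    rw [← hΔ] at h1
    have hC : ∀ α β, ContMDiffOn 𝓘(ℝ, E) 𝓘(ℝ, ℂ) ∞ (fun _ : M => symp n α β) O := fun α β =>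
      contMDiffOn_const
    -- The same argument with the derivative of gᵀCg = C.
    have h2 := matDeriv_mul hO hx (f := fun z => (g z)ᵀ * symp n) (g := g)
      (contMDiffOn_matrix_mul (fun α β => hg β α) hC) hg v
    rw [matDeriv_eq_zero_of_const hO hx (c := symp n) fun z hz => (hgu z hz).2,
      matDeriv_mul hO hx (f := fun z => (g z)ᵀ) (g := fun _ => symp n) (fun α β => hg β α) hC v,
      matDeriv_eq_zero_of_const hO hx (c := symp n) (g := fun _ => symp n) fun z hz => rfl,
      Matrix.mul_zero, add_zero] at h2
    have h3 : matDeriv (fun z => (g z)ᵀ) x v = (matDeriv g x v)ᵀ := rfl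
    rw [h3] at h2
    have h4 : (g x)ᵀ * (Δ'ᵀ * symp n + symp n * Δ') * g x = 0 := by
      calc (g x)ᵀ * (Δ'ᵀ * symp n + symp n * Δ') * g x
          = (Δ' * g x)ᵀ * symp n * g x + (g x)ᵀ * symp n * (Δ' * g x) := by
            rw [Matrix.transpose_mul]; simp only [Matrix.mul_add, Matrix.add_mul, Matrix.mul_assoc]
        _ = (D.spConn x v)ᵀ * ((g x)ᵀ * symp n * g x) + ((g x)ᵀ * symp n * g x) * D.spConn x v
            - ((matDeriv g x v)ᵀ * symp n * g x + (g x)ᵀ * symp n * matDeriv g x v) := by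
            rw [h1, Matrix.transpose_sub, Matrix.transpose_mul]
            simp only [Matrix.mul_sub, Matrix.sub_mul, Matrix.mul_assoc]
            abel
        _ = 0 := by
            rw [← h2, (hgu x hx).2, hD.sp_symp x (hOD hx) v, sub_zero]
    have h5 : (g x)ᴴᵀ * (g x)ᵀ = 1 := by
      rw [← Matrix.transpose_mul, (hgu x hx).mul_conjTranspose, Matrix.transpose_one]
    have := congrArg (fun A => (g x)ᴴᵀ * A * (g x)ᴴ) h4
    simp only [← Matrix.mul_assoc, h5, Matrix.one_mul] at this
    rwa [Matrix.mul_assoc, (hgu x hx).mul_conjTranspose, Matrix.mul_one, Matrix.mul_zero,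
      Matrix.zero_mul] at this
  torsion x hx v w A α := by
    have h1 : ∀ t γ, ∑ β, (gaugeFrame D O g).de α β x t * g x β γ
        = ∑ β, g x α β * D.de β γ x t - scalarDeriv (fun z => g z α γ) x t := by
      intro t γ
      have := congrFun (congrFun (gaugeFrame_spConn_mul (D := D) (O := O) (hgu x hx) t) α) γ
      rw [Matrix.sub_apply, Matrix.mul_apply, Matrix.mul_apply] at this
      exact this
    have h2 : ∀ s t, ∑ β, (gaugeFrame D O g).de α β x s * (gaugeFrame D O g).u A β x t
        = ∑ γ, (∑ β, g x α β * D.de β γ x s - scalarDeriv (fun z => g z α γ) x s) * D.u A γ x t := by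
      intro s t
      simp only [← h1, gaugeFrame_u, Finset.mul_sum, Finset.sum_mul]
      rw [Finset.sum_comm]
      simp only [mul_assoc]
    have h3 := mextDeriv_combForm hO (hg α) (fun β => (hD.smooth_U A β).mono hOD) hx v w
    have h4 : ∑ β, wedge ((gaugeFrame D O g).de α β x) ((gaugeFrame D O g).u A β x) v w
        = ∑ γ, (∑ β, g x α β * D.de β γ x v - scalarDeriv (fun z => g z α γ) x v) * D.u A γ x w
        - ∑ γ, (∑ β, g x α β * D.de β γ x w - scalarDeriv (fun z => g z α γ) x w) * D.u A γ x v := by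
      simp only [wedge, Finset.sum_sub_distrib]
      rw [h2, h2]
    have h5 : ∑ B, wedge (fun t => (gaugeFrame D O g).su2Conn x t A B) ((gaugeFrame D O g).u B α x) v w
        = ∑ β, g x α β * ∑ B, wedge (fun t => D.su2Conn x t A B) (D.u B β x) v w := by
      simp only [wedge, gaugeFrame_u, Finset.mul_sum]
      rw [Finset.sum_comm]
      simp only [← Finset.sum_sub_distrib]
      refine Finset.sum_congr rfl fun B _ => Finset.sum_congr rfl fun β _ => ?_
      have : ∀ t, (gaugeFrame D O g).su2Conn x t = D.su2Conn x t := fun _ => rfl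
      simp only [this]
      ring
    have h6 : ∑ β, g x α β * (mextDeriv (D.U A β) x ![v, w]
      + ∑ B, wedge (fun t => D.su2Conn x t A B) (D.u B β x) v w
      + ∑ γ, wedge (D.de β γ x) (D.u A γ x) v w) = 0 :=
      Finset.sum_eq_zero fun β _ => by rw [hD.torsion x (hOD hx) v w A β, mul_zero]
    have h7 : ∑ β, g x α β * ∑ γ, wedge (D.de β γ x) (D.u A γ x) v w
        = ∑ γ, (∑ β, g x α β * D.de β γ x v) * D.u A γ x w
        - ∑ γ, (∑ β, g x α β * D.de β γ x w) * D.u A γ x v := by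
      simp only [wedge, Finset.sum_mul, Finset.mul_sum, ← Finset.sum_sub_distrib]
      rw [Finset.sum_comm]
      refine Finset.sum_congr rfl fun B _ => Finset.sum_congr rfl fun β _ => ?_
      ring
    simp only [mul_add, Finset.sum_add_distrib] at h6
    rw [h7, ← h5] at h6
    rw [h4]
    refine (congrArg (fun c => c + _ + _) h3).trans ?_
    rw [← h6]
    simp only [Finset.sum_add_distrib, Finset.sum_sub_distrib, sub_mul]
    simp only [u]
    ring
  su2Curv_eq x hx v w c := by
    refine (hD.su2Curv_eq x (hOD hx) v w c).trans (congrArg (fun z : ℂ => Complex.I * lam * z) ?_)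
    exact Finset.sum_congr rfl fun A _ => Finset.sum_congr rfl fun B _ =>
      (gaugeFrame_sum_wedge (hgu x hx) (pauliLow c A B) A B v w).symm

theorem gaugeFrame_isGauge (hO : IsOpen O) (hOD : O ⊆ D.dom)
    (hg : ∀ α β, ContMDiffOn 𝓘(ℝ, E) 𝓘(ℝ, ℂ) ∞ (fun y => g y α β) O)
    (hgu : ∀ y ∈ O, IsUSp (g y)) : D.IsGauge (gaugeFrame D O g) O (fun _ => 1) g where
  isOpen := hO
  subset y hy := ⟨hOD hy, hy⟩
  smooth_a A B := contMDiffOn_const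
  smooth_g := hg
  mem_SU2 _ _ := one_mem _
  mem_USp := hgu
  vielbein y hy v A α := by
    rw [gaugeFrame_u, Finset.sum_eq_single A (fun B _ hB => by
      simp [Matrix.one_apply_ne hB.symm]) (by simp)]
    simp
  su2 y hy v A B := by
    rw [scalarDeriv_const, Matrix.mul_one, Matrix.one_mul, sub_zero]
    rfl
  sp y hy v α β := congrFun (congrFun (gaugeFrame_spConn_mul (hgu y hy) v) α) β

theorem IsGauge.gaugeFrame {D₀ : Frame n E M} {O' : Set M} {a : M → Matrix (Fin 2) (Fin 2) ℂ}
    {g₀ : M → Matrix (Idx n) (Idx n) ℂ} (h : D₀.IsGauge D O' a g₀) (hO : IsOpen O)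
    (hg : ∀ α β, ContMDiffOn 𝓘(ℝ, E) 𝓘(ℝ, ℂ) ∞ (fun y => g y α β) O)
    (hgu : ∀ y ∈ O, IsUSp (g y)) :
    D₀.IsGauge (gaugeFrame D O g) (O ∩ O') a (fun y => g y * g₀ y) where
  isOpen := hO.inter h.isOpen
  subset y hy := ⟨(h.subset hy.2).1, hy.1⟩
  smooth_a A B := (h.smooth_a A B).mono Set.inter_subset_right
  smooth_g := contMDiffOn_matrix_mul (fun α β => (hg α β).mono Set.inter_subset_left)
    (fun α β => (h.smooth_g α β).mono Set.inter_subset_right)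
  mem_SU2 y hy := h.mem_SU2 y hy.2
  mem_USp y hy := (hgu y hy.1).mul (h.mem_USp y hy.2)
  vielbein y hy v A α := by
    rw [gaugeFrame_u]
    simp only [h.vielbein y hy.2, Matrix.mul_apply, Finset.mul_sum, Finset.sum_mul]
    rw [Finset.sum_comm]
    refine Finset.sum_congr rfl fun B _ => ?_
    rw [Finset.sum_comm]
    refine Finset.sum_congr rfl fun γ _ => Finset.sum_congr rfl fun δ _ => ?_
    ring
  su2 y hy v A B := h.su2 y hy.2 v A B
  sp y hy v α β := by
    have h1 := gaugeFrame_spConn_mul (D := D) (O := O) (hgu y hy.1) v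
    have h2 : D.spConn y v * g₀ y = g₀ y * D₀.spConn y v - matDeriv g₀ y v := by
      ext α β
      exact h.sp y hy.2 v α β
    have h3 := matDeriv_mul (hO.inter h.isOpen) hy
      (fun α β => (hg α β).mono Set.inter_subset_left)
      (fun α β => (h.smooth_g α β).mono Set.inter_subset_right) v
    refine Eq.trans ?_ (congrArg (fun X : Matrix (Idx n) (Idx n) ℂ =>
      (g y * g₀ y * D₀.spConn y v) α β - X α β) h3.symm)
    rw [← Matrix.sub_apply, ← Matrix.mul_assoc, h1, Matrix.sub_mul, Matrix.mul_assoc, h2]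
    rw [Matrix.mul_sub, Matrix.mul_assoc, sub_sub, add_comm (matDeriv g y v * g₀ y)]

/-- Maximality of the family of frames enters here: the rotated frame is gauge related to every
frame D₀ because gauge transformations compose. -/
theorem gaugeFrame_mem {S : QKStructure n E M} (hD : D ∈ S.frames) (hO : IsOpen O)
    (hOD : O ⊆ D.dom) (hg : ∀ α β, ContMDiffOn 𝓘(ℝ, E) 𝓘(ℝ, ℂ) ∞ (fun y => g y α β) O)
    (hgu : ∀ y ∈ O, IsUSp (g y)) : gaugeFrame D O g ∈ S.frames := by
  refine S.maximal _ (gaugeFrame_isQuaternionic (S.isQuaternionic D hD) hO hOD hg hgu) ?_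
  rintro D₀ hD₀ x ⟨hx, hx₀⟩
  obtain ⟨O', a, g₀, hxO', h⟩ := S.compat D₀ hD₀ D hD x ⟨hx₀, hOD hx⟩
  exact ⟨O ∩ O', a, _, ⟨hx, hxO'⟩, h.gaugeFrame hO hg hgu⟩

end Frame

/-! ### Symplectic rotations adapted to an isotropic subspace -/

section Lagrangian

variable {n : ℕ}

theorem sympPair_add_left (z z' w : Idx n → ℂ) : sympPair (z + z') w = sympPair z w + sympPair z' w := by
  simp only [sympPair, ← Finset.sum_add_distrib, Pi.add_apply]
  exact Finset.sum_congr rfl fun I _ => by ring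

theorem sympPair_smul_left (c : ℂ) (z w : Idx n → ℂ) : sympPair (c • z) w = c * sympPair z w := by
  simp only [sympPair, Finset.mul_sum, Pi.smul_apply, smul_eq_mul]
  exact Finset.sum_congr rfl fun I _ => by ring

theorem sympPair_add_right (z w w' : Idx n → ℂ) : sympPair z (w + w') = sympPair z w + sympPair z w' := by
  rw [sympPair_swap, sympPair_add_left, sympPair_swap z w, sympPair_swap z w']
  ring

theorem sympPair_smul_right (c : ℂ) (z w : Idx n → ℂ) : sympPair z (c • w) = c * sympPair z w := by
  rw [sympPair_swap, sympPair_smul_left, sympPair_swap z w]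
  ring

/-- The symplectic pairing as a bilinear form on the Euclidean space `ℂ²ⁿ`. -/
def sympBilin (n : ℕ) : LinearMap.BilinForm ℂ (EuclideanSpace ℂ (Idx n)) :=
  LinearMap.mk₂ ℂ (fun z w => sympPair z.ofLp w.ofLp)
    (fun z z' w => sympPair_add_left z.ofLp z'.ofLp w.ofLp)
    (fun c z w => sympPair_smul_left c z.ofLp w.ofLp)
    (fun z w w' => sympPair_add_right z.ofLp w.ofLp w'.ofLp)
    (fun c z w => sympPair_smul_right c z.ofLp w.ofLp)

theorem sympBilin_apply (z w : EuclideanSpace ℂ (Idx n)) :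
    sympBilin n z w = sympPair z.ofLp w.ofLp := rfl

theorem sympBilin_isRefl : (sympBilin n).IsRefl := fun z w h => by
  rw [sympBilin_apply] at h ⊢
  rw [sympPair_swap, h, neg_zero]

theorem sympPair_single_inl (I : Fin n) (z : Idx n → ℂ) :
    sympPair (Pi.single (.inl I) 1) z = z (.inr I) := by
  simp [sympPair, Pi.single_apply]

theorem sympPair_single_inr (I : Fin n) (z : Idx n → ℂ) :
    sympPair (Pi.single (.inr I) 1) z = -z (.inl I) := by
  simp [sympPair, Pi.single_apply]

theorem sympBilin_nondegenerate : (sympBilin n).Nondegenerate := by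
  refine (LinearMap.IsRefl.nondegenerate_iff_separatingRight (B := sympBilin n) sympBilin_isRefl).2 ?_
  intro z hz
  ext α
  cases α with
  | inl I =>
    have := hz (WithLp.toLp 2 (Pi.single (.inr I) 1))
    rw [sympBilin_apply, sympPair_single_inr, neg_eq_zero] at this
    exact this
  | inr I =>
    have := hz (WithLp.toLp 2 (Pi.single (.inl I) 1))
    rw [sympBilin_apply, sympPair_single_inl] at this
    exact this

/-- An isotropic set lies in a Lagrangian subspace, described by an orthonormal basis. -/
theorem exists_orthonormal_isotropic {Q : Set (Idx n → ℂ)}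
    (hQ : ∀ z ∈ Q, ∀ w ∈ Q, sympPair z w = 0) :
    ∃ e : Fin n → EuclideanSpace ℂ (Idx n), Orthonormal ℂ e ∧
      (∀ I J, sympPair (e I).ofLp (e J).ofLp = 0) ∧ ∀ I, ∀ z ∈ Q, sympPair (e I).ofLp z = 0 := by
  set B := sympBilin n
  set Q' : Set (EuclideanSpace ℂ (Idx n)) := WithLp.ofLp ⁻¹' Q
  -- The pairing is complex bilinear, so the complex span of an isotropic set is again isotropic.
  have h0 : Submodule.span ℂ Q' ≤ B.orthogonal (Submodule.span ℂ Q') := by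
    rw [Submodule.span_le]
    intro z hz w hw
    induction hw using Submodule.span_induction with
    | mem w hw => exact hQ _ hw _ hz
    | zero => exact LinearMap.map_zero₂ _ _
    | add w w' _ _ h h' =>
      show B (w + w') z = 0
      rw [map_add, LinearMap.add_apply]
      exact (congrArg₂ (· + ·) h h').trans (add_zero 0)
    | smul c w _ h =>
      show B (c • w) z = 0
      rw [map_smul, LinearMap.smul_apply]
      exact (congrArg (c • ·) h).trans (smul_zero c)
  obtain ⟨W, hW, hmax⟩ := exists_maximal_ge_of_wellFoundedGT
    (fun W : Submodule ℂ (EuclideanSpace ℂ (Idx n)) => W ≤ B.orthogonal W) _ h0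
  -- The form is alternating, so a vector orthogonal to W can be added to W without losing isotropy;
  -- maximality puts it in W.
  have hWeq : B.orthogonal W ≤ W := by
    intro v hv
    have h1 : W ⊔ Submodule.span ℂ {v} ≤ B.orthogonal (W ⊔ Submodule.span ℂ {v}) := by
      intro x hx y hy
      obtain ⟨x₁, hx₁, x₂, hx₂, rfl⟩ := Submodule.mem_sup.1 hx
      obtain ⟨y₁, hy₁, y₂, hy₂, rfl⟩ := Submodule.mem_sup.1 hy
      obtain ⟨a, rfl⟩ := Submodule.mem_span_singleton.1 hx₂
      obtain ⟨b, rfl⟩ := Submodule.mem_span_singleton.1 hy₂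
      have e1 : B y₁ x₁ = 0 := hmax.1 hx₁ y₁ hy₁
      have e2 : B y₁ v = 0 := hv y₁ hy₁
      have e3 : B v x₁ = 0 := sympBilin_isRefl _ _ (hv x₁ hx₁)
      have e4 : B v v = 0 := by
        have := sympPair_swap v.ofLp v.ofLp
        exact self_eq_neg.1 this
      show B (y₁ + b • v) (x₁ + a • v) = 0
      simp [e1, e2, e3, e4]
    exact hmax.2 h1 le_sup_left (Submodule.mem_sup_right (Submodule.mem_span_singleton_self v))
  have hWo : B.orthogonal W = W := le_antisymm hWeq hmax.1
  -- A subspace equal to its own orthogonal has half the dimension 2n.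
  have hdim : Module.finrank ℂ W = n := by
    have := LinearMap.BilinForm.finrank_orthogonal (B := B) sympBilin_nondegenerate W
    rw [hWo, finrank_euclideanSpace, Fintype.card_sum, Fintype.card_fin] at this
    have hle : Module.finrank ℂ W ≤ n + n := by
      have := Submodule.finrank_le W
      rwa [finrank_euclideanSpace, Fintype.card_sum, Fintype.card_fin] at this
    omega
  set b := (stdOrthonormalBasis ℂ W).reindex (finCongr hdim)
  refine ⟨fun I => (b I : EuclideanSpace ℂ (Idx n)), ?_, fun I J => ?_, fun I z hz => ?_⟩
  · exact b.orthonormal.comp_linearIsometry W.subtypeₗᵢ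
  · exact hmax.1 (b J).2 _ (b I).2
  · exact hmax.1 (hW (Submodule.subset_span (show WithLp.toLp 2 z ∈ Q' from hz))) _ (b I).2

/-- The matrix with rows `e_I^*` and `e_I^T C`. -/
def lagMatrix (e : Fin n → Idx n → ℂ) : Matrix (Idx n) (Idx n) ℂ :=
  Matrix.fromBlocks (fun I K => star (e I (.inl K))) (fun I K => star (e I (.inr K)))
    (fun I K => -e I (.inr K)) (fun I K => e I (.inl K))

theorem lagMatrix_mulVec_inr (e : Fin n → Idx n → ℂ) (z : Idx n → ℂ) (I : Fin n) :
    Matrix.mulVec (lagMatrix e) z (.inr I) = sympPair (e I) z := by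
  simp only [Matrix.mulVec, dotProduct, Fintype.sum_sum_type, sympPair, ← Finset.sum_add_distrib]
  refine Finset.sum_congr rfl fun K _ => ?_
  show -e I (.inr K) * z (.inl K) + e I (.inl K) * z (.inr K) = _
  ring

/-- In the product g gᴴ orthonormality of the e_I makes the diagonal blocks 1 and isotropy makes the
off-diagonal blocks 0. The block shape gives C g = ḡ C, which for a unitary g is the symplectic
condition. -/
theorem isUSp_lagMatrix {e : Fin n → EuclideanSpace ℂ (Idx n)} (he : Orthonormal ℂ e)
    (hi : ∀ I J, sympPair (e I).ofLp (e J).ofLp = 0) : IsUSp (lagMatrix fun I => (e I).ofLp) := by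
  set A : Matrix (Fin n) (Fin n) ℂ := fun I K => (e I).ofLp (.inl K)
  set B : Matrix (Fin n) (Fin n) ℂ := fun I K => (e I).ofLp (.inr K)
  have hg : lagMatrix (fun I => (e I).ofLp) = Matrix.fromBlocks Aᴴᵀ Bᴴᵀ (-B) A := rfl
  have h1 : A * Aᴴ + B * Bᴴ = 1 := by
    ext I J
    have := orthonormal_iff_ite.1 he J I
    simp only [PiLp.inner_apply, RCLike.inner_apply, Fintype.sum_sum_type] at this
    rw [Matrix.add_apply, Matrix.mul_apply, Matrix.mul_apply, Matrix.one_apply]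
    simp only [eq_comm (a := I)]
    exact this
  have h2 : A * Bᵀ = B * Aᵀ := by
    ext I J
    have := hi I J
    rw [sympPair, Finset.sum_sub_distrib, sub_eq_zero] at this
    exact this
  have h1' : Aᴴᵀ * Aᵀ + Bᴴᵀ * Bᵀ = 1 := by
    rw [← Matrix.transpose_mul, ← Matrix.transpose_mul, ← Matrix.transpose_add]
    have := congrArg Matrix.conjTranspose h1
    simp only [Matrix.conjTranspose_add, Matrix.conjTranspose_mul, Matrix.conjTranspose_conjTranspose,
      Matrix.conjTranspose_one] at this
    have := congrArg (fun X => Xᴴᵀ) this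
    simp only [Matrix.conjTranspose_add, Matrix.conjTranspose_mul, Matrix.conjTranspose_conjTranspose,
      Matrix.conjTranspose_one, Matrix.transpose_add, Matrix.transpose_mul] at this
    simpa [Matrix.transpose_mul] using this
  have h2' : Aᴴᵀ * Bᴴ = Bᴴᵀ * Aᴴ := by
    have := congrArg (fun X => Xᴴᵀ) h2
    simp only [Matrix.conjTranspose_mul, Matrix.transpose_mul] at this
    exact this
  have h3 : ∀ X : Matrix (Fin n) (Fin n) ℂ, Xᴴᵀᴴ = Xᵀ := fun X => by
    ext I J
    exact star_star _
  have hu : lagMatrix (fun I => (e I).ofLp) ∈ Matrix.unitaryGroup (Idx n) ℂ := by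
    rw [Matrix.mem_unitaryGroup_iff, Matrix.star_eq_conjTranspose, hg, Matrix.fromBlocks_conjTranspose,
      Matrix.fromBlocks_multiply, ← Matrix.fromBlocks_one]
    congr 1
    · rw [h3, h3, h1']
    · rw [Matrix.conjTranspose_neg, Matrix.mul_neg, h2', neg_add_cancel]
    · rw [h3, h3, h2, Matrix.neg_mul, neg_add_cancel]
    · rw [Matrix.conjTranspose_neg, neg_mul_neg, add_comm, h1]
  refine ⟨hu, ?_⟩
  have hC : symp n * lagMatrix (fun I => (e I).ofLp) = (lagMatrix fun I => (e I).ofLp)ᴴᵀ * symp n := by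
    rw [hg, symp, Matrix.fromBlocks_conjTranspose, Matrix.fromBlocks_transpose,
      Matrix.fromBlocks_multiply, Matrix.fromBlocks_multiply]
    congr 1 <;> simp [h3]
  rw [Matrix.mul_assoc, hC, ← Matrix.mul_assoc, ← Matrix.transpose_mul,
    ← Matrix.star_eq_conjTranspose, (Matrix.mem_unitaryGroup_iff').1 hu, Matrix.transpose_one,
    Matrix.one_mul]

/-- The dotted coordinates of the rotated vector are its pairings with a basis of a Lagrangian
subspace that contains Q. -/
theorem exists_rotation_of_isotropic {Q : Set (Idx n → ℂ)}
    (hQ : ∀ z ∈ Q, ∀ w ∈ Q, sympPair z w = 0) :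
    ∃ g, IsUSp g ∧ ∀ z ∈ Q, ∀ I, Matrix.mulVec g z (.inr I) = 0 := by
  obtain ⟨e, he, hi, hz⟩ := exists_orthonormal_isotropic hQ
  refine ⟨_, isUSp_lagMatrix he hi, fun z hzQ I => ?_⟩
  rw [lagMatrix_mulVec_inr]
  exact hz I z hzQ

theorem IsUSp.sympPair_mulVec {g : Matrix (Idx n) (Idx n) ℂ} (hg : IsUSp g) (z w : Idx n → ℂ) :
    sympPair (Matrix.mulVec g z) (Matrix.mulVec g w) = sympPair z w := by
  have h : ∀ p q : Idx n → ℂ, sympPair p q = dotProduct p (Matrix.mulVec (symp n) q) := by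
    intro p q
    rw [← sum_symp_eq_sympPair]
    simp only [dotProduct, Matrix.mulVec, Finset.mul_sum]
    exact Finset.sum_congr rfl fun α _ => Finset.sum_congr rfl fun β _ => by ring
  rw [h, h, ← Matrix.vecMul_transpose, ← Matrix.dotProduct_mulVec, Matrix.mulVec_mulVec,
    Matrix.mulVec_mulVec, hg.2]

end Lagrangian

/-! ### Isotropic tangent planes and the vanishing of U^{2I}. -/

namespace Frame

variable {n : ℕ} {E : Type*} [NormedAddCommGroup E] [NormedSpace ℝ E]
  {M : Type*} [TopologicalSpace M] [ChartedSpace E M] {D : Frame n E M} {lam : ℝ}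

section Pointwise

variable {x : M} {P : Submodule ℝ (TangentSpace 𝓘(ℝ, E) x)}

theorem uPair_zero_zero (hD : D.IsQuaternionic lam) (hx : x ∈ D.dom) (v w : TangentSpace 𝓘(ℝ, E) x) :
    D.uPair 0 0 x v w = sympPair (theta hD hx v) (theta hD hx w) := rfl

theorem uPair_one_one (hD : D.IsQuaternionic lam) (hx : x ∈ D.dom) (v w : TangentSpace 𝓘(ℝ, E) x) :
    D.uPair 1 1 x v w = (starRingEnd ℂ) (D.uPair 0 0 x v w) := by
  rw [uPair_zero_zero hD hx, uPair, sympPair, sympPair, map_sum]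
  refine Finset.sum_congr rfl fun I _ => ?_
  rw [u_eq_theta hD hx, u_eq_theta hD hx, u_eq_theta hD hx, u_eq_theta hD hx]
  simp only [realForm_one_inl, realForm_one_inr, map_sub, map_mul]
  ring

/-- Ω^1 and Ω^2 are nonzero multiples of the imaginary and the real part of the symplectic pairing
of the coordinates; λ ≠ 0 is what allows dividing. -/
theorem su2CurvVanish_iff (hD : D.IsQuaternionic lam) (hlam : lam ≠ 0) (hx : x ∈ D.dom) :
    D.SU2CurvVanish x P ↔
      ∀ v ∈ P, ∀ w ∈ P, sympPair (theta hD hx v) (theta hD hx w) = 0 := by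
  have hl : (lam : ℂ) ≠ 0 := Complex.ofReal_ne_zero.2 hlam
  refine forall₄_congr fun v _ w _ => ?_
  rw [← Complex.ofReal_eq_zero, ← Complex.ofReal_eq_zero, su2Curv_zero hD hx, su2Curv_one hD hx,
    uPair_one_one hD hx, ← uPair_zero_zero hD hx]
  constructor
  · rintro ⟨h0, h1⟩
    simp only [mul_eq_zero, OfNat.ofNat_ne_zero, Complex.I_ne_zero, hl, or_self, false_or] at h0 h1
    have : 2 * D.uPair 0 0 x v w = 0 := by linear_combination h0 + h1
    simpa using this
  · intro h
    simp [h]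

/-- By reality (U^{2I})^* = -U^{1İ}, so the sum of wedges is minus the symplectic pairing. -/
theorem wedgeVanish_iff (hD : D.IsQuaternionic lam) (hx : x ∈ D.dom) :
    D.WedgeVanish x P ↔
      ∀ v ∈ P, ∀ w ∈ P, sympPair (theta hD hx v) (theta hD hx w) = 0 := by
  refine forall₄_congr fun v _ w _ => ?_
  rw [← neg_eq_zero (a := sympPair _ _), sympPair, ← Finset.sum_neg_distrib]
  refine Eq.congr_left (Finset.sum_congr rfl fun I _ => ?_)
  rw [wedge, u_eq_theta hD hx, u_eq_theta hD hx, u_eq_theta hD hx, u_eq_theta hD hx]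
  simp only [realForm_one_inl, realForm_zero, map_neg, Complex.conj_conj]
  ring

theorem halfVanish_iff (hD : D.IsQuaternionic lam) (hx : x ∈ D.dom) :
    D.HalfVanish x P ↔ ∀ v ∈ P, ∀ I, theta hD hx v (.inr I) = 0 := by
  refine forall₃_congr fun v _ I => ?_
  rw [u_eq_theta hD hx, realForm_one_inl, neg_eq_zero, map_eq_zero]

theorem HalfVanish.sympPair_eq_zero (hD : D.IsQuaternionic lam) (hx : x ∈ D.dom)
    (h : D.HalfVanish x P) {v w : TangentSpace 𝓘(ℝ, E) x} (hv : v ∈ P) (hw : w ∈ P) :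
    sympPair (theta hD hx v) (theta hD hx w) = 0 := by
  rw [halfVanish_iff hD hx] at h
  simp [sympPair, h v hv, h w hw]

/-- The undotted components of the vielbein on a subspace. -/
def halfTheta (hD : D.IsQuaternionic lam) (hx : x ∈ D.dom)
    (P : Submodule ℝ (TangentSpace 𝓘(ℝ, E) x)) : P →ₗ[ℝ] (Fin n → ℂ) :=
  (LinearMap.funLeft ℝ ℂ Sum.inl ∘ₗ (theta hD hx).toLinearMap) ∘ₗ P.subtype

/-- If the dotted coordinates vanish, the undotted ones determine the vector. -/
theorem HalfVanish.injective_halfTheta (hD : D.IsQuaternionic lam) (hx : x ∈ D.dom)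
    (h : D.HalfVanish x P) : Function.Injective (halfTheta hD hx P) := by
  rw [← LinearMap.ker_eq_bot, LinearMap.ker_eq_bot']
  intro v hv
  have h1 : theta hD hx (v : TangentSpace 𝓘(ℝ, E) x) = 0 := by
    ext α
    cases α with
    | inl I => exact congrFun hv I
    | inr I => exact (halfVanish_iff hD hx).1 h v v.2 I
  exact Subtype.ext ((theta hD hx).map_eq_zero_iff.1 h1)

theorem finrank_complex_fun : Module.finrank ℝ (Fin n → ℂ) = 2 * n := by
  rw [Module.finrank_pi_fintype]
  simp [Complex.finrank_real_complex, mul_comm]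

theorem HalfVanish.finrank_le (hD : D.IsQuaternionic lam) (hx : x ∈ D.dom)
    (h : D.HalfVanish x P) : Module.finrank ℝ P ≤ 2 * n :=
  (LinearMap.finrank_le_finrank_of_injective (h.injective_halfTheta hD hx)).trans_eq
    finrank_complex_fun

theorem HalfVanish.surjective_halfTheta (hD : D.IsQuaternionic lam) (hx : x ∈ D.dom)
    (h : D.HalfVanish x P) (hP : Module.finrank ℝ P = 2 * n) :
    Function.Surjective (halfTheta hD hx P) := by
  -- The value of `finrank` alone does not ensure this, since infinite dimension also gives 0, which
  -- is 2n for n = 0.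
  have : FiniteDimensional ℝ P :=
    FiniteDimensional.of_injective _ (h.injective_halfTheta hD hx)
  exact (LinearMap.injective_iff_surjective_of_finrank_eq_finrank
    (hP.trans finrank_complex_fun.symm)).1 (h.injective_halfTheta hD hx)

end Pointwise

end Frame

/-! ### Curvature and involution conditions on a plane. -/

namespace Frame

variable {n : ℕ} {E : Type*} [NormedAddCommGroup E] [NormedSpace ℝ E]
  {M : Type*} [TopologicalSpace M] [ChartedSpace E M] {D : Frame n E M} {lam : ℝ}

section Conditions

variable {x : M} {P : Submodule ℝ (TangentSpace 𝓘(ℝ, E) x)}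

theorem su2CurvVanish_iff_wedgeVanish (hD : D.IsQuaternionic lam) (hlam : lam ≠ 0) (hx : x ∈ D.dom) :
    D.SU2CurvVanish x P ↔ D.WedgeVanish x P :=
  (su2CurvVanish_iff hD hlam hx).trans (wedgeVanish_iff hD hx).symm

theorem HalfVanish.su2CurvVanish (hD : D.IsQuaternionic lam) (hlam : lam ≠ 0) (hx : x ∈ D.dom)
    (h : D.HalfVanish x P) : D.SU2CurvVanish x P :=
  (su2CurvVanish_iff hD hlam hx).2 fun _ hv _ hw => h.sympPair_eq_zero hD hx hv hw

theorem theta_eq_mulVec {D' : Frame n E M} (hD : D.IsQuaternionic lam) (hx : x ∈ D.dom)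
    (hD' : D'.IsQuaternionic lam) (hx' : x ∈ D'.dom) {g : Matrix (Idx n) (Idx n) ℂ}
    (h : ∀ v A α, D'.u A α x v = ∑ β, g α β * D.u A β x v) (v : TangentSpace 𝓘(ℝ, E) x) :
    theta hD' hx' v = Matrix.mulVec g (theta hD hx v) :=
  funext fun α => h v 0 α

theorem su2CurvVanish_of_rotation {D' : Frame n E M} (hD : D.IsQuaternionic lam) (hlam : lam ≠ 0)
    (hx : x ∈ D.dom) (hD' : D'.IsQuaternionic lam) (hx' : x ∈ D'.dom)
    {g : Matrix (Idx n) (Idx n) ℂ} (hg : IsUSp g)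
    (h : ∀ v A α, D'.u A α x v = ∑ β, g α β * D.u A β x v) (hP : D'.HalfVanish x P) :
    D.SU2CurvVanish x P := by
  rw [su2CurvVanish_iff hD hlam hx]
  intro v hv w hw
  have := hP.sympPair_eq_zero hD' hx' hv hw
  rwa [theta_eq_mulVec hD hx hD' hx' h, theta_eq_mulVec hD hx hD' hx' h, hg.sympPair_mulVec] at this

/-- The coordinates of P form an isotropic set. The rotation that straightens it is used as a
constant gauge transformation on the whole domain; conversely USp(2n) preserves the pairing. -/
theorem su2CurvVanish_iff_exists_rotation [IsManifold 𝓘(ℝ, E) ∞ M] {S : QKStructure n E M}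
    (hD : D ∈ S.frames) (hx : x ∈ D.dom) :
    D.SU2CurvVanish x P ↔
      ∃ g, IsUSp g ∧ ∃ D' ∈ S.frames, D'.dom = D.dom ∧ D'.su2Form = D.su2Form ∧
        (∀ y ∈ D.dom, ∀ v A α, D'.u A α y v = ∑ β, g α β * D.u A β y v) ∧
        D'.HalfVanish x P := by
  have hq := S.isQuaternionic D hD
  constructor
  · intro h
    rw [su2CurvVanish_iff hq S.lam_ne hx] at h
    obtain ⟨g, hg, hz⟩ := exists_rotation_of_isotropic (Q := (fun v => theta hq hx v) '' P) (by
      rintro _ ⟨v, hv, rfl⟩ _ ⟨w, hw, rfl⟩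
      exact h v hv w hw)
    have hmem : D.gaugeFrame D.dom (fun _ => g) ∈ S.frames :=
      gaugeFrame_mem hD hq.isOpen_dom le_rfl (fun _ _ => contMDiffOn_const) fun _ _ => hg
    have hq' := S.isQuaternionic _ hmem
    refine ⟨g, hg, _, hmem, rfl, rfl, fun y _ v A α => gaugeFrame_u A α y v, ?_⟩
    refine (halfVanish_iff hq' (x := x) hx).2 fun v hv I => ?_
    rw [theta_eq_mulVec hq hx hq' hx fun v A α => gaugeFrame_u A α x v]
    exact hz _ ⟨v, hv, rfl⟩ I
  · rintro ⟨g, hg, D', hD', hdom, -, hu, hP⟩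
    exact su2CurvVanish_of_rotation hq S.lam_ne hx (S.isQuaternionic D' hD') (hdom ▸ hx) hg
      (hu x hx) hP

theorem SU2CurvVanish.finrank_le [IsManifold 𝓘(ℝ, E) ∞ M] {S : QKStructure n E M}
    (hD : D ∈ S.frames) (hx : x ∈ D.dom) (h : D.SU2CurvVanish x P) :
    Module.finrank ℝ P ≤ 2 * n := by
  obtain ⟨g, -, D', hD', hdom, -, -, hP⟩ := (su2CurvVanish_iff_exists_rotation hD hx).1 h
  exact hP.finrank_le (S.isQuaternionic D' hD') (hdom ▸ hx)

/-- Every quadratic term in Ω^1, Ω^2 and R^I_J̇ contains a form that vanishes on P, so these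
curvatures reduce to exterior derivatives. -/
theorem ConnVanish.involution_iff (h : D.ConnVanish x P) :
    D.Involution x P ↔ D.SU2CurvVanish x P ∧ D.SpCurvVanish x P := by
  have h0 : ∀ v ∈ P, ∀ w ∈ P, D.su2Curv 0 x v w = mextDeriv (D.su2Form 0) x ![v, w] := by
    intro v hv w hw
    have : wedge (D.om (0 + 1) x) (D.om (0 + 2) x) v w = 0 := by
      rw [wedge, zero_add, (h v hv).2.1, (h w hw).2.1]; ring
    rw [su2Curv, this, add_zero]
  have h1 : ∀ v ∈ P, ∀ w ∈ P, D.su2Curv 1 x v w = mextDeriv (D.su2Form 1) x ![v, w] := by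
    intro v hv w hw
    have : wedge (D.om (1 + 1) x) (D.om (1 + 2) x) v w = 0 := by
      rw [wedge, show (1 + 2 : Fin 3) = 0 from rfl, (h v hv).1, (h w hw).1]; ring
    rw [su2Curv, this, add_zero]
  have h2 : ∀ v ∈ P, ∀ w ∈ P, ∀ I J, D.spCurv (.inl I) (.inr J) x v w
      = mextDeriv (D.spForm (.inl I) (.inr J)) x ![v, w] := by
    intro v hv w hw I J
    rw [spCurv, add_eq_left]
    -- For an undotted γ the second factor Δ^γ_J̇ vanishes, for a dotted one the first factor Δ^I_γ.
    refine Finset.sum_eq_zero fun γ _ => ?_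
    cases γ with
    | inl K => rw [wedge, (h v hv).2.2, (h w hw).2.2]; ring
    | inr K => rw [wedge, (h v hv).2.2, (h w hw).2.2]; ring
  constructor
  · intro hi
    refine ⟨fun v hv w hw => ?_, fun v hv w hw I J => ?_⟩
    · rw [h0 v hv w hw, h1 v hv w hw]
      exact ⟨(hi v hv w hw).1, (hi v hv w hw).2.1⟩
    · rw [h2 v hv w hw]
      exact (hi v hv w hw).2.2 I J
  · rintro ⟨hs, hr⟩ v hv w hw
    rw [← h0 v hv w hw, ← h1 v hv w hw]
    refine ⟨(hs v hv w hw).1, (hs v hv w hw).2, fun I J => ?_⟩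
    rw [← h2 v hv w hw]
    exact hr v hv w hw I J

theorem su2Conn_one_zero (x : M) (v : TangentSpace 𝓘(ℝ, E) x) :
    D.su2Conn x v 1 0 = Complex.I / 2 * (D.om 0 x v - Complex.I * D.om 1 x v) := by
  simp [su2Conn, Fin.sum_univ_three, pauli]
  ring

/-- In the torsion equation of U^{2I} every product has a factor U^{2K}, ω^1 - iω^2 or Δ^I_K̇, all
of which vanish on P. -/
theorem mextDeriv_half_eq_zero (hD : D.IsQuaternionic lam) (hx : x ∈ D.dom)
    (hc : D.ConnVanish x P) (hh : D.HalfVanish x P) {v w : TangentSpace 𝓘(ℝ, E) x} (hv : v ∈ P)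
    (hw : w ∈ P) (I : Fin n) : mextDeriv (D.U 1 (.inl I)) x ![v, w] = 0 := by
  have h := hD.torsion x hx v w 1 (.inl I)
  have h1 : ∑ B, wedge (fun t => D.su2Conn x t 1 B) (D.u B (.inl I) x) v w = 0 := by
    rw [Fin.sum_univ_two, wedge, wedge, hh v hv I, hh w hw I, su2Conn_one_zero, su2Conn_one_zero,
      (hc v hv).1, (hc v hv).2.1, (hc w hw).1, (hc w hw).2.1]
    simp
  have h2 : ∑ β, wedge (D.de (.inl I) β x) (D.u 1 β x) v w = 0 := by
    refine Finset.sum_eq_zero fun γ _ => ?_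
    cases γ with
    | inl K => rw [wedge, hh v hv, hh w hw]; ring
    | inr K => rw [wedge, (hc v hv).2.2, (hc w hw).2.2]; ring
  rwa [h1, h2, add_zero, add_zero] at h

theorem uLow_inr (A : Fin 2) (J : Fin n) (x : M) (v : TangentSpace 𝓘(ℝ, E) x) :
    D.uLow A (.inr J) x v = -D.u A (.inl J) x v := sum_symp_mul_inr J fun α => D.u A α x v

/-- The λ-term pairs U^{AI} with U^{BJ} for A ≠ B and so contains a vanishing U^{2·}. In the Ω-term
only U^{1K} ∧ U^{2L̇} survives, and U^{2L̇} is the conjugate of U^{1L}. -/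
theorem spCurv_of_halfVanish (hD : D.IsQuaternionic lam) (hx : x ∈ D.dom)
    {T : Idx n → Idx n → Idx n → Idx n → ℂ} (hT : D.IsOmegaTensor lam x T)
    (hh : D.HalfVanish x P) {v w : TangentSpace 𝓘(ℝ, E) x} (hv : v ∈ P) (hw : w ∈ P)
    (I J : Fin n) : D.spCurv (.inl I) (.inr J) x v w =
      2 * ∑ K, ∑ L, T (.inr I) (.inr J) (.inl K) (.inr L) *
        (D.u 0 (.inl K) x v * (starRingEnd ℂ) (D.u 0 (.inl L) x w)
          - D.u 0 (.inl K) x w * (starRingEnd ℂ) (D.u 0 (.inl L) x v)) := by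
  obtain ⟨-, -, h3, h4⟩ := hT
  have hz : ∀ v ∈ P, ∀ I, D.u 0 (.inr I) x v = 0 := (halfVanish_iff hD hx).1 hh
  have hone : ∀ t L, D.u 1 (.inr L) x t = (starRingEnd ℂ) (D.u 0 (.inl L) x t) := fun t L => by
    rw [u_eq_theta hD hx, realForm_one_inr]; rfl
  have h5 : ∑ A, ∑ B, eps A B * wedge (D.u A (.inl I) x) (D.uLow B (.inr J) x) v w = 0 := by
    simp only [Fin.sum_univ_two, wedge, uLow_inr, hh v hv, hh w hw]
    simp [eps]
  rw [h4, h5, mul_zero, zero_add]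
  have h6 : ∀ A B γ δ, ∑ ρ, wedge (D.u A γ x) (D.u B δ x) v w * eps A B * symp n (.inl I) ρ *
      T ρ (.inr J) γ δ = wedge (D.u A γ x) (D.u B δ x) v w * eps A B * T (.inr I) (.inr J) γ δ := by
    intro A B γ δ
    rw [← sum_symp_mul_inl I fun ρ => T ρ (.inr J) γ δ, Finset.mul_sum]
    exact Finset.sum_congr rfl fun ρ _ => by ring
  simp only [h6]
  rw [sum_eps_wedge_symm (fun γ δ => (h3 _ _ γ δ).symm) (fun A α => D.u A α x), Finset.mul_sum]
  rw [Fintype.sum_sum_type]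
  have h7 : ∀ K : Fin n, ∑ δ, 2 * T (.inr I) (.inr J) (.inr K) δ *
      wedge (D.u 0 (.inr K) x) (D.u 1 δ x) v w = 0 := fun K =>
    Finset.sum_eq_zero fun δ _ => by rw [wedge, hz v hv, hz w hw]; ring
  simp only [h7, Finset.sum_const_zero, add_zero]
  refine Finset.sum_congr rfl fun K _ => ?_
  rw [Fintype.sum_sum_type, Finset.mul_sum]
  have h8 : ∀ L : Fin n, 2 * T (.inr I) (.inr J) (.inl K) (.inl L) *
      wedge (D.u 0 (.inl K) x) (D.u 1 (.inl L) x) v w = 0 := fun L => by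
    rw [wedge, hh v hv, hh w hw]; ring
  simp only [h8, Finset.sum_const_zero, zero_add]
  refine Finset.sum_congr rfl fun L _ => ?_
  rw [wedge, hone, hone]
  ring

theorem involution_of_omegaVanish (hD : D.IsQuaternionic lam) (hlam : lam ≠ 0) (hx : x ∈ D.dom)
    (hc : D.ConnVanish x P) {T : Idx n → Idx n → Idx n → Idx n → ℂ}
    (hT : D.IsOmegaTensor lam x T) (hh : D.HalfVanish x P) (h : OmegaVanish T) :
    D.Involution x P := by
  refine hc.involution_iff.2 ⟨hh.su2CurvVanish hD hlam hx, fun v hv w hw I J => ?_⟩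
  rw [spCurv_of_halfVanish hD hx hT hh hv hw]
  simp [h I J]

/-- In dimension 2n the values of U^{1K} fill ℂⁿ, so the antisymmetrized sesquilinear form vanishes
for arbitrary vectors; multiplying one of them by i then isolates each coefficient. -/
theorem omegaVanish_of_involution (hD : D.IsQuaternionic lam) (hx : x ∈ D.dom)
    (hc : D.ConnVanish x P) {T : Idx n → Idx n → Idx n → Idx n → ℂ}
    (hT : D.IsOmegaTensor lam x T) (hh : D.HalfVanish x P) (hP : Module.finrank ℝ P = 2 * n)
    (h : D.Involution x P) : OmegaVanish T := by
  intro I J K L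
  have hr := (hc.involution_iff.1 h).2
  have hs := hh.surjective_halfTheta hD hx hP
  have key : ∀ z y : Fin n → ℂ, ∑ K, ∑ L, T (.inr I) (.inr J) (.inl K) (.inr L) *
      (z K * (starRingEnd ℂ) (y L) - y K * (starRingEnd ℂ) (z L)) = 0 := by
    intro z y
    obtain ⟨v, rfl⟩ := hs z
    obtain ⟨w, rfl⟩ := hs y
    have h1 := spCurv_of_halfVanish hD hx hT hh v.2 w.2 I J
    rw [hr v v.2 w w.2] at h1
    refine (mul_eq_zero.1 h1.symm).resolve_left two_ne_zero
  -- The first test gives T_{KL} - T_{LK} = 0, the second i(T_{KL} + T_{LK}) = 0, where only the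
  -- last two indices are written.
  have k1 := key (Pi.single K 1) (Pi.single L 1)
  have k2 := key (Pi.single K Complex.I) (Pi.single L 1)
  simp only [Pi.single_apply, mul_sub, Finset.sum_sub_distrib, apply_ite (starRingEnd ℂ), map_one,
    map_zero, mul_ite, mul_zero, ite_mul, zero_mul, Finset.sum_ite_eq', Finset.mem_univ, if_true,
    mul_one, one_mul, Complex.conj_I] at k1 k2
  have k3 : 2 * Complex.I * T (.inr I) (.inr J) (.inl K) (.inr L) = 0 := by
    linear_combination k2 + Complex.I * k1
  simpa using k3

end Conditions

/-! ### Forms that vanish along an immersed submanifold. -/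

section Submanifold

variable [IsManifold 𝓘(ℝ, E) ∞ M] {F : Type*} [NormedAddCommGroup F] [NormedSpace ℝ F]
  {N : Type*} [TopologicalSpace N] [ChartedSpace F N] [IsManifold 𝓘(ℝ, F) ∞ N] {ι : N → M}
  {V : Type*} [NormedAddCommGroup V] [NormedSpace ℝ V]

theorem _root_.QK.mextDeriv_zero (k : ℕ) (p : N) : mextDeriv (0 : Form F N k V) p = 0 := by
  have h : chartForm (0 : Form F N k V) p = fun _ => 0 := by
    funext y
    ext v
    rfl
  show (extDeriv (chartForm (0 : Form F N k V) p) (extChartAt 𝓘(ℝ, F) p p) : F [⋀^Fin (k + 1)]→L[ℝ] V) = 0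
  rw [h]
  ext v
  simp [extDeriv, ContinuousAlternatingMap.alternatizeUncurryFin_apply]

/-- If a 1-form vanishes along a submanifold, so does its exterior derivative. -/
theorem _root_.QK.mextDeriv_eq_zero_of_pullback {α : Form E M 1 V} {O : Set M} (hO : IsOpen O)
    (hα : SmoothFormOn α O) {W : Set N} (hW : IsOpen W) (hm : Set.MapsTo ι W O)
    (hι : ContMDiff 𝓘(ℝ, F) 𝓘(ℝ, E) ∞ ι)
    (h : ∀ q ∈ W, ∀ v : TangentSpace 𝓘(ℝ, F) q, α (ι q) ![dmap (E := E) ι q v] = 0) {p : N} (hp : p ∈ W)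
    (a b : TangentSpace 𝓘(ℝ, F) p) :
    mextDeriv α (ι p) ![dmap (E := E) ι p a, dmap (E := E) ι p b] = 0 := by
  have h1 := mextDeriv_pullbackForm (F := F) hO hα (hm hp) (Filter.Eventually.of_forall fun q => hι q)
  have h2 : mextDeriv (pullbackForm (F := F) ι α) p = mextDeriv (0 : Form F N 1 V) p := by
    refine mextDeriv_congr hW (fun q hq => ?_) hp
    ext v
    rw [vec1_eq v]
    refine Eq.trans ?_ (h q hq (v 0))
    exact congrArg (α (ι q)) (funext fun i => by fin_cases i; rfl)
  rw [h1, mextDeriv_zero] at h2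
  have h3 := congrArg (fun ξ : F [⋀^Fin 2]→L[ℝ] V => ξ ![a, b]) h2
  refine Eq.trans ?_ h3
  exact congrArg (mextDeriv α (ι p)) (funext fun i => by fin_cases i <;> rfl)

theorem involution_of_connVanish (hD : D.IsQuaternionic lam) (hι : IsSubmanifold (E := E) (F := F) ι)
    {W : Set N} (hW : IsOpen W) (hm : Set.MapsTo ι W D.dom)
    (h : ∀ p ∈ W, D.ConnVanish (ι p) (tangentPlane (F := F) ι p)) {p : N} (hp : p ∈ W) :
    D.Involution (ι p) (tangentPlane (F := F) ι p) := by
  rintro _ ⟨a, rfl⟩ _ ⟨b, rfl⟩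
  refine ⟨?_, ?_, fun I J => ?_⟩
  · exact mextDeriv_eq_zero_of_pullback hD.isOpen_dom (hD.smooth_su2 0) hW hm hι.smooth
      (fun q hq v => (h q hq _ ⟨v, rfl⟩).1) hp a b
  · exact mextDeriv_eq_zero_of_pullback hD.isOpen_dom (hD.smooth_su2 1) hW hm hι.smooth
      (fun q hq v => (h q hq _ ⟨v, rfl⟩).2.1) hp a b
  · exact mextDeriv_eq_zero_of_pullback hD.isOpen_dom (hD.smooth_sp _ _) hW hm hι.smooth
      (fun q hq v => (h q hq _ ⟨v, rfl⟩).2.2 I J) hp a b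

theorem finrank_tangentPlane (hι : IsSubmanifold (E := E) (F := F) ι) (p : N) :
    Module.finrank ℝ (tangentPlane (E := E) (F := F) ι p) = Module.finrank ℝ F :=
  LinearMap.finrank_range_of_inj (hι.immersion p)

end Submanifold

end Frame

/-! ### Smooth orthonormalization -/

section GramSchmidt

variable {m : ℕ} {κ : Type*} [Fintype κ]

/-- Induction along the Gram-Schmidt recursion. Linear independence keeps the vectors, and hence the
squared norms in the denominators, nonzero; smoothness is over ℝ because norms and conjugations
occur. -/
theorem contDiffAt_gramSchmidt {f₀ : Fin m → EuclideanSpace ℂ κ} (h : LinearIndependent ℂ f₀)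
    (i : Fin m) : ContDiffAt ℝ ∞ (fun f : Fin m → EuclideanSpace ℂ κ =>
      InnerProductSpace.gramSchmidt ℂ f i) f₀ := by
  induction i using WellFoundedLT.induction with
  | ind i ih =>
    have hf : (fun f : Fin m → EuclideanSpace ℂ κ => InnerProductSpace.gramSchmidt ℂ f i) = fun f =>
        f i - ∑ j ∈ Finset.Iio i, (inner ℂ (InnerProductSpace.gramSchmidt ℂ f j) (f i) *
          ((‖InnerProductSpace.gramSchmidt ℂ f j‖ : ℂ) ^ 2)⁻¹) • InnerProductSpace.gramSchmidt ℂ f j := by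
      funext f
      simp only [← div_eq_mul_inv]
      exact eq_sub_of_add_eq (InnerProductSpace.gramSchmidt_def'' ℂ f i).symm
    rw [hf]
    have happ : ContDiffAt ℝ ∞ (fun f : Fin m → EuclideanSpace ℂ κ => f i) f₀ :=
      (contDiff_apply ℝ _ i).contDiffAt
    refine happ.sub (ContDiffAt.sum fun j hj => ?_)
    have hj' := ih j (Finset.mem_Iio.1 hj)
    have hne := InnerProductSpace.gramSchmidt_ne_zero (𝕜 := ℂ) j h
    have h1 : ContDiffAt ℝ ∞ (fun f : Fin m → EuclideanSpace ℂ κ =>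
        ((‖InnerProductSpace.gramSchmidt ℂ f j‖ : ℂ) ^ 2)⁻¹) f₀ := by
      refine ContDiffAt.inv ?_ ?_
      · exact (Complex.ofRealCLM.contDiff.contDiffAt.comp f₀ (hj'.norm ℂ hne)).pow 2
      · exact pow_ne_zero 2 (Complex.ofReal_ne_zero.2 (norm_ne_zero_iff.2 hne))
    exact ((hj'.inner ℂ happ).mul h1).smul hj'

theorem contDiffAt_gramSchmidtNormed {f₀ : Fin m → EuclideanSpace ℂ κ} (h : LinearIndependent ℂ f₀)
    (i : Fin m) : ContDiffAt ℝ ∞ (fun f : Fin m → EuclideanSpace ℂ κ =>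
      InnerProductSpace.gramSchmidtNormed ℂ f i) f₀ := by
  have hne := InnerProductSpace.gramSchmidt_ne_zero (𝕜 := ℂ) i h
  have hi := contDiffAt_gramSchmidt h i
  have h1 : ContDiffAt ℝ ∞ (fun f : Fin m → EuclideanSpace ℂ κ =>
      (‖InnerProductSpace.gramSchmidt ℂ f i‖ : ℂ)⁻¹) f₀ :=
    (Complex.ofRealCLM.contDiff.contDiffAt.comp f₀ (hi.norm ℂ hne)).inv
      (Complex.ofReal_ne_zero.2 (norm_ne_zero_iff.2 hne))
  exact h1.smul hi

theorem sympPair_eq_zero_of_mem_span {n : ℕ} {s : Set (EuclideanSpace ℂ (Idx n))} {w : Idx n → ℂ}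
    (h : ∀ z ∈ s, sympPair z.ofLp w = 0) {z : EuclideanSpace ℂ (Idx n)}
    (hz : z ∈ Submodule.span ℂ s) : sympPair z.ofLp w = 0 := by
  induction hz using Submodule.span_induction with
  | mem z hz => exact h z hz
  | zero => simp [sympPair]
  | add z z' _ _ h h' => rw [WithLp.ofLp_add, sympPair_add_left, h, h', add_zero]
  | smul c z _ h => rw [WithLp.ofLp_smul, sympPair_smul_left, h, mul_zero]

end GramSchmidt

/-! ### Immersions are locally retracts -/

section Retraction

variable {E : Type*} [NormedAddCommGroup E] [NormedSpace ℝ E] [FiniteDimensional ℝ E]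
  {M : Type*} [TopologicalSpace M] [ChartedSpace E M] [IsManifold 𝓘(ℝ, E) ∞ M]
  {F : Type*} [NormedAddCommGroup F] [NormedSpace ℝ F] [FiniteDimensional ℝ F]
  {N : Type*} [TopologicalSpace N] [ChartedSpace F N] [IsManifold 𝓘(ℝ, F) ∞ N] {ι : N → M}

omit [FiniteDimensional ℝ E] [FiniteDimensional ℝ F] in
theorem fderiv_localMap_self {p : N} (hι : ContMDiffAt 𝓘(ℝ, F) 𝓘(ℝ, E) ∞ ι p) :
    (mfderiv 𝓘(ℝ, F) 𝓘(ℝ, E) ι p : F →L[ℝ] E) =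
      fderiv ℝ (localMap (E := E) (F := F) ι p (ι p)) (extChartAt 𝓘(ℝ, F) p p) := by
  rw [(hι.mdifferentiableAt (by simp)).mfderiv]
  simp [writtenInExtChartAt, localMap]
  rfl

/-- The chart coordinates of a point of an immersed submanifold extend to smooth functions on the
ambient manifold. -/
theorem exists_local_retraction (hι : IsSubmanifold (E := E) (F := F) ι) (p : N) {B : Set F}
    (hB : B ∈ 𝓝 (extChartAt 𝓘(ℝ, F) p p)) {O' : Set M} (hO' : IsOpen O') (hp : ι p ∈ O') :
    ∃ O ⊆ O', IsOpen O ∧ ι p ∈ O ∧ ∃ r : M → F, ContMDiffOn 𝓘(ℝ, E) 𝓘(ℝ, F) ∞ r O ∧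
      Set.MapsTo r O B ∧ ∀ᶠ q in 𝓝 p, r (ι q) = extChartAt 𝓘(ℝ, F) p q := by
  set y₀ := extChartAt 𝓘(ℝ, F) p p with hy₀
  set f := localMap (E := E) (F := F) ι p (ι p) with hf
  have hsy : (extChartAt 𝓘(ℝ, F) p).symm y₀ = p := extChartAt_to_inv p
  have hytgt : y₀ ∈ (extChartAt 𝓘(ℝ, F) p).target := mem_extChartAt_target p
  have hsm : ∀ᶠ y in 𝓝 y₀, ContDiffAt ℝ ∞ f y := by
    filter_upwards [eventually_extChartAt_target hytgt, eventually_mem_of_continuousAt hytgt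
      (isOpen_extChartAt_source (I := 𝓘(ℝ, E)) (ι p)) hι.smooth.continuous.continuousAt (by
        rw [hsy]; exact mem_extChartAt_source (ι p))] with y hy hy2
    exact localMap_contDiffAt hy (hι.smooth _) hy2
  have hinj : Function.Injective (fderiv ℝ f y₀) := by
    have h1 := hι.immersion p
    have h2 := fderiv_localMap_self (hι.smooth p)
    rw [← h2]
    exact h1
  -- Composing the local expression f of the immersion with a left inverse L of its differential
  -- gives φ = L ∘ f with identity derivative at y₀. The retraction is φ⁻¹ ∘ L ∘ chart.
  obtain ⟨L₀, hL₀⟩ := LinearMap.exists_leftInverse_of_injective (fderiv ℝ f y₀).toLinearMap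
    (LinearMap.ker_eq_bot.2 hinj)
  set L : E →L[ℝ] F := L₀.toContinuousLinearMap with hL
  set φ : F → F := fun y => L (f y) with hφ
  have hφs : ∀ y, ContDiffAt ℝ ∞ f y → ContDiffAt ℝ ∞ φ y := fun y hy =>
    L.contDiff.contDiffAt.comp y hy
  have hφ0 := hφs y₀ hsm.self_of_nhds
  have hφd : fderiv ℝ φ y₀ = ((ContinuousLinearEquiv.refl ℝ F : F ≃L[ℝ] F) : F →L[ℝ] F) := by
    have : fderiv ℝ φ y₀ = L.comp (fderiv ℝ f y₀) :=
      (L.hasFDerivAt.comp y₀ ((hsm.self_of_nhds.differentiableAt (by simp)).hasFDerivAt)).fderiv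
    rw [this]
    ext v
    exact LinearMap.congr_fun hL₀ v
  have hφd' : HasFDerivAt φ ((ContinuousLinearEquiv.refl ℝ F : F ≃L[ℝ] F) : F →L[ℝ] F) y₀ := by
    rw [← hφd]
    exact (hφ0.differentiableAt (by simp)).hasFDerivAt
  set Φ := hφ0.toOpenPartialHomeomorph φ hφd' (by simp) with hΦ
  have hΦc : (Φ : F → F) = φ := rfl
  have hΦs : y₀ ∈ Φ.source := hφ0.mem_toOpenPartialHomeomorph_source hφd' (by simp)
  -- Smoothness of φ⁻¹ on a neighbourhood needs dφ invertible there; invertibility is an open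
  -- condition.
  have hequiv : ∀ᶠ y in 𝓝 y₀, fderiv ℝ φ y ∈ Set.range ((↑) : (F ≃L[ℝ] F) → (F →L[ℝ] F)) := by
    refine (hφ0.continuousAt_fderiv (by simp)).eventually ?_
    rw [hφd]
    exact ContinuousLinearEquiv.nhds _
  have hA : ∀ᶠ y in 𝓝 y₀, ContDiffAt ℝ ∞ φ y ∧
      fderiv ℝ φ y ∈ Set.range ((↑) : (F ≃L[ℝ] F) → (F →L[ℝ] F)) ∧ y ∈ B :=
    (hsm.mono hφs).and (hequiv.and hB)
  set chM := extChartAt 𝓘(ℝ, E) (ι p) with hchM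
  have hval : L (chM (ι p)) = Φ y₀ := by
    rw [hΦc, hφ]
    simp only [hf, localMap, Function.comp_apply, hsy]
    rfl
  set r : M → F := fun x => Φ.symm (L (chM x)) with hr
  have hcont : ContinuousAt (fun x => L (chM x)) (ι p) :=
    L.continuous.continuousAt.comp (continuousAt_extChartAt (ι p))
  have htgt : L (chM (ι p)) ∈ Φ.target := by
    rw [hval]; exact Φ.map_source hΦs
  have hr0 : r (ι p) = y₀ := by
    rw [hr]
    show Φ.symm (L (chM (ι p))) = y₀
    rw [hval, Φ.left_inv hΦs]
  have hrc : ContinuousAt r (ι p) :=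
    ContinuousAt.comp (f := fun x => L (chM x)) (Φ.continuousAt_symm htgt) hcont
  have hev : ∀ᶠ x in 𝓝 (ι p), x ∈ O' ∧ x ∈ chM.source ∧ L (chM x) ∈ Φ.target ∧
      ContDiffAt ℝ ∞ φ (r x) ∧
      fderiv ℝ φ (r x) ∈ Set.range ((↑) : (F ≃L[ℝ] F) → (F →L[ℝ] F)) ∧ r x ∈ B := by
    filter_upwards [hO'.mem_nhds hp, extChartAt_source_mem_nhds (I := 𝓘(ℝ, E)) (ι p),
      hcont.eventually (Φ.open_target.mem_nhds htgt), hrc.eventually (hr0.symm ▸ hA)]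
      with x h1 h2 h3 h4
    exact ⟨h1, h2, h3, h4⟩
  obtain ⟨O, hO, hOo, hpO⟩ := eventually_nhds_iff.1 hev
  refine ⟨O, fun x hx => (hO x hx).1, hOo, hpO, r, fun x hx => ?_, fun x hx => (hO x hx).2.2.2.2.2, ?_⟩
  · obtain ⟨-, hxs, hxt, hc, ⟨e, he⟩, -⟩ := hO x hx
    have h1 : ContDiffAt ℝ ∞ Φ.symm (L (chM x)) := by
      refine Φ.contDiffAt_symm hxt (f₀' := e) ?_ hc
      rw [he]
      exact (hc.differentiableAt (by simp)).hasFDerivAt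
    have h2 : ContMDiffAt 𝓘(ℝ, E) 𝓘(ℝ, F) ∞ (fun x => L (chM x)) x :=
      L.contDiff.contMDiff.contMDiffAt.comp x (contMDiffAt_extChartAt' (by simpa [hchM] using hxs))
    exact (h1.contMDiffAt.comp x h2).contMDiffWithinAt
  · filter_upwards [extChartAt_source_mem_nhds (I := 𝓘(ℝ, F)) p,
      (continuousAt_extChartAt (I := 𝓘(ℝ, F)) p).eventually (Φ.open_source.mem_nhds hΦs)] with q hq hq2
    have h1 : L (chM (ι q)) = Φ (extChartAt 𝓘(ℝ, F) p q) := by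
      rw [hΦc, hφ]
      simp only [hf, localMap, Function.comp_apply, (extChartAt 𝓘(ℝ, F) p).left_inv hq]
      rfl
    show Φ.symm (L (chM (ι q))) = _
    rw [h1, Φ.left_inv hq2]

end Retraction

/-! ### Smooth rotation of a frame along an isotropic submanifold. -/

namespace Frame

variable {n : ℕ} {E : Type*} [NormedAddCommGroup E] [NormedSpace ℝ E]
  {M : Type*} [TopologicalSpace M] [ChartedSpace E M] [IsManifold 𝓘(ℝ, E) ∞ M]
  {F : Type*} [NormedAddCommGroup F] [NormedSpace ℝ F] [FiniteDimensional ℝ F]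
  {N : Type*} [TopologicalSpace N] [ChartedSpace F N] [IsManifold 𝓘(ℝ, F) ∞ N] {ι : N → M}
  {D : Frame n E M} {S : QKStructure n E M}

section VielbeinField

/-- The vielbein of the tangent vector of `N` with coordinates `v`, in the chart at `p`. -/
def thetaChart (D : Frame n E M) (ι : N → M) (p : N) (v : F) (y : F) : EuclideanSpace ℂ (Idx n) :=
  WithLp.toLp 2 fun α => flatLin (chartForm (pullbackForm (F := F) ι (D.U 0 α)) p) y v

omit [IsManifold 𝓘(ℝ, E) ∞ M] [FiniteDimensional ℝ F] [IsManifold 𝓘(ℝ, F) ∞ N] in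
theorem thetaChart_apply (D : Frame n E M) (ι : N → M) (p : N) (v y : F) (α : Idx n) :
    (thetaChart D ι p v y).ofLp α = D.u 0 α (ι ((extChartAt 𝓘(ℝ, F) p).symm y))
      (dmap ι ((extChartAt 𝓘(ℝ, F) p).symm y)
        (mfderiv 𝓘(ℝ, F) 𝓘(ℝ, F) (extChartAt 𝓘(ℝ, F) p).symm y v)) := by
  show flatLin (chartForm (pullbackForm (F := F) ι (D.U 0 α)) p) y v = _
  rw [flatLin_chartForm_apply]
  exact congrArg (D.U 0 α (ι ((extChartAt 𝓘(ℝ, F) p).symm y))) (funext fun i => by fin_cases i; rfl)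

omit [IsManifold 𝓘(ℝ, E) ∞ M] [FiniteDimensional ℝ F] in
theorem thetaChart_self (D : Frame n E M) (ι : N → M) (p : N) (v : F) (α : Idx n) :
    (thetaChart D ι p v (extChartAt 𝓘(ℝ, F) p p)).ofLp α = D.u 0 α (ι p) (dmap ι p v) := by
  show flatLin (chartForm (pullbackForm (F := F) ι (D.U 0 α)) p) (extChartAt 𝓘(ℝ, F) p p) v = _
  rw [flatLin_chartForm_self]
  exact congrArg (D.U 0 α (ι p)) (funext fun i => by fin_cases i; rfl)

variable {lam : ℝ}

omit [FiniteDimensional ℝ F] in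
theorem contDiffAt_thetaChart (hD : D.IsQuaternionic lam) (hι : ContMDiff 𝓘(ℝ, F) 𝓘(ℝ, E) ∞ ι)
    {W : Set N} (hW : IsOpen W) (hm : Set.MapsTo ι W D.dom) {p : N} {y : F}
    (hy : y ∈ (extChartAt 𝓘(ℝ, F) p).target) (hyW : (extChartAt 𝓘(ℝ, F) p).symm y ∈ W) (v : F) :
    ContDiffAt ℝ ∞ (thetaChart D ι p v) y := by
  rw [contDiffAt_piLp]
  intro α
  exact (contDiffAt_flatLin_iff.2 (((hD.smooth_U 0 α).pullbackForm hD.isOpen_dom hm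
    (fun q _ => hι q) hW).contDiffAt hW hy hyW)).clm_apply contDiffAt_const

end VielbeinField

/-- After a rotation the plane maps onto ℂⁿ. Vectors over the standard basis are independent over ℂ,
and so are their coordinates in the original frame, because a complex linear map relates the two. -/
theorem exists_adapted_basis {x : M} (hD : D ∈ S.frames) (hx : x ∈ D.dom)
    {P : Submodule ℝ (TangentSpace 𝓘(ℝ, E) x)} (h : D.SU2CurvVanish x P)
    (hP : Module.finrank ℝ P = 2 * n) :
    ∃ v : Fin n → P, LinearIndependent ℂ fun I => (WithLp.toLp 2 fun α => D.u 0 α x (v I) :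
      EuclideanSpace ℂ (Idx n)) := by
  obtain ⟨g, hg, D', hD', hdom, -, hu, hh⟩ := (su2CurvVanish_iff_exists_rotation hD hx).1 h
  have hx' : x ∈ D'.dom := hdom ▸ hx
  have hs := hh.surjective_halfTheta (S.isQuaternionic D' hD') hx' hP
  choose v hv using fun I : Fin n => hs (Pi.single I 1)
  refine ⟨v, ?_⟩
  let f : EuclideanSpace ℂ (Idx n) →ₗ[ℂ] (Fin n → ℂ) :=
    LinearMap.funLeft ℂ ℂ Sum.inl ∘ₗ Matrix.mulVecLin g ∘ₗ
      (WithLp.linearEquiv 2 ℂ (Idx n → ℂ)).toLinearMap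
  refine LinearIndependent.of_comp f ?_
  have hf : (f ∘ fun I => (WithLp.toLp 2 fun α => D.u 0 α x (v I) : EuclideanSpace ℂ (Idx n)))
      = fun I => Pi.single I 1 := by
    funext I
    rw [← hv I]
    funext J
    exact (hu x hx (v I) 0 (.inl J)).symm
  rw [hf]
  exact Pi.linearIndependent_single_one (Fin n) ℂ

/-- The pointwise rotation depends on choices. They are made smoothly by keeping n tangent vectors
constant in a chart, orthonormalizing their coordinates, and composing the resulting USp(2n)-valued
function on N with a local retraction of M. -/
theorem exists_half_frame [FiniteDimensional ℝ E] (hι : IsSubmanifold (E := E) (F := F) ι)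
    (hF : Module.finrank ℝ F = 2 * n) (hD : D ∈ S.frames) {W : Set N} (hW : IsOpen W)
    (hm : Set.MapsTo ι W D.dom)
    (h : ∀ p ∈ W, D.SU2CurvVanish (ι p) (tangentPlane (F := F) ι p)) {p : N} (hp : p ∈ W) :
    ∃ D' ∈ S.frames, (∃ g, D.IsGauge D' D'.dom (fun _ => 1) g) ∧
      ∃ W' ∈ 𝓝 p, W' ⊆ W ∧ Set.MapsTo ι W' D'.dom ∧
        ∀ q ∈ W', D'.HalfVanish (ι q) (tangentPlane (F := F) ι q) := by
  have hq := S.isQuaternionic D hD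
  obtain ⟨w, hw⟩ := exists_adapted_basis hD (hm hp) (h p hp) ((finrank_tangentPlane hι p).trans hF)
  obtain ⟨v, hv⟩ : ∃ v : Fin n → F, ∀ I, dmap (E := E) (F := F) ι p (v I) = w I :=
    ⟨fun I => (w I).2.choose, fun I => (w I).2.choose_spec⟩
  set f : F → Fin n → EuclideanSpace ℂ (Idx n) := fun y I => thetaChart D ι p (v I) y with hf
  set y₀ := extChartAt 𝓘(ℝ, F) p p with hy₀
  have hytgt : y₀ ∈ (extChartAt 𝓘(ℝ, F) p).target := mem_extChartAt_target p
  have hsy : (extChartAt 𝓘(ℝ, F) p).symm y₀ = p := extChartAt_to_inv p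
  have hf0 : LinearIndependent ℂ (f y₀) := by
    have : f y₀ = fun I => (WithLp.toLp 2 fun α => D.u 0 α (ι p) (w I) :
        EuclideanSpace ℂ (Idx n)) := by
      funext I
      ext α
      exact (thetaChart_self D ι p (v I) α).trans (congrArg (D.u 0 α (ι p)) (hv I))
    rwa [this]
  have hfs : ∀ y ∈ (extChartAt 𝓘(ℝ, F) p).target, (extChartAt 𝓘(ℝ, F) p).symm y ∈ W →
      ContDiffAt ℝ ∞ f y := fun y hy hyW =>
    contDiffAt_pi.2 fun I => contDiffAt_thetaChart hq hι.smooth hW hm hy hyW (v I)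
  -- The region where the chosen vectors stay independent over ℂ, an open condition; the retraction
  -- is required to land in it.
  set B : Set F := {y | y ∈ (extChartAt 𝓘(ℝ, F) p).target ∧ (extChartAt 𝓘(ℝ, F) p).symm y ∈ W ∧
    LinearIndependent ℂ (f y)} with hBdef
  have hB : B ∈ 𝓝 y₀ := by
    filter_upwards [eventually_extChartAt_target hytgt,
      (continuousAt_extChartAt_symm_of_mem hytgt).preimage_mem_nhds
        (hW.mem_nhds (show (extChartAt 𝓘(ℝ, F) p).symm y₀ ∈ W by rwa [hsy])),
      (hfs y₀ hytgt (by rwa [hsy])).continuousAt.eventually hf0.eventually] with y h1 h2 h3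
    exact ⟨h1, h2, h3⟩
  set e : F → Fin n → EuclideanSpace ℂ (Idx n) := fun y I =>
    InnerProductSpace.gramSchmidtNormed ℂ (f y) I with he
  have hes : ∀ y ∈ B, ∀ I, ContDiffAt ℝ ∞ (fun y => e y I) y := fun y hy I =>
    (contDiffAt_gramSchmidtNormed hy.2.2 I).comp y (hfs y hy.1 hy.2.1)
  have hspan : ∀ y I, e y I ∈ Submodule.span ℂ (Set.range (f y)) := fun y I => by
    rw [← InnerProductSpace.span_gramSchmidt ℂ, ← InnerProductSpace.span_gramSchmidtNormed_range]
    exact Submodule.subset_span ⟨I, rfl⟩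
  -- The e_I lie in the complex span of coordinates of tangent vectors, which pairs to zero with the
  -- whole tangent plane by isotropy.
  have hiso : ∀ y ∈ B, ∀ t ∈ tangentPlane (E := E) (F := F) ι ((extChartAt 𝓘(ℝ, F) p).symm y), ∀ I,
      sympPair (e y I).ofLp (fun α => D.u 0 α (ι ((extChartAt 𝓘(ℝ, F) p).symm y)) t) = 0 := by
    intro y hy t ht I
    refine sympPair_eq_zero_of_mem_span ?_ (hspan y I)
    rintro _ ⟨J, rfl⟩
    have h1 := (su2CurvVanish_iff hq S.lam_ne (hm hy.2.1)).1 (h _ hy.2.1) _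
      ⟨mfderiv 𝓘(ℝ, F) 𝓘(ℝ, F) (extChartAt 𝓘(ℝ, F) p).symm y (v J), rfl⟩ t ht
    refine Eq.trans (congrArg (fun z => sympPair z _) (funext fun α => ?_)) h1
    exact thetaChart_apply D ι p (v J) y α
  have hiso2 : ∀ y ∈ B, ∀ I J, sympPair (e y I).ofLp (e y J).ofLp = 0 := by
    intro y hy I J
    rw [sympPair_swap, neg_eq_zero]
    refine sympPair_eq_zero_of_mem_span ?_ (hspan y J)
    rintro _ ⟨K, rfl⟩
    rw [sympPair_swap, neg_eq_zero]
    have h1 := hiso y hy _ ⟨mfderiv 𝓘(ℝ, F) 𝓘(ℝ, F) (extChartAt 𝓘(ℝ, F) p).symm y (v K), rfl⟩ I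
    refine Eq.trans (congrArg (fun z => sympPair _ z) (funext fun α => ?_)) h1
    exact thetaChart_apply D ι p (v K) y α
  have husp : ∀ y ∈ B, IsUSp (lagMatrix fun I => (e y I).ofLp) := fun y hy =>
    isUSp_lagMatrix (InnerProductSpace.gramSchmidtNormed_orthonormal hy.2.2) (hiso2 y hy)
  have hcoord : ∀ y ∈ B, ∀ I α, ContDiffAt ℝ ∞ (fun y => (e y I).ofLp α) y := fun y hy I α =>
    (contDiffAt_piLp 2).1 (hes y hy I) α
  have hlag : ∀ y ∈ B, ∀ α β, ContDiffAt ℝ ∞ (fun y => lagMatrix (fun I => (e y I).ofLp) α β) y := by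
    intro y hy α β
    rcases α with I | I <;> rcases β with K | K
    · exact Complex.conjCLE.toContinuousLinearMap.contDiff.contDiffAt.comp y (hcoord y hy I (.inl K))
    · exact Complex.conjCLE.toContinuousLinearMap.contDiff.contDiffAt.comp y (hcoord y hy I (.inr K))
    · exact (hcoord y hy I (.inr K)).neg
    · exact hcoord y hy I (.inl K)
  obtain ⟨O, hOD, hO, hpO, r, hr, hrB, hrι⟩ := exists_local_retraction hι p hB hq.isOpen_dom (hm hp)
  set g : M → Matrix (Idx n) (Idx n) ℂ := fun x => lagMatrix fun I => (e (r x) I).ofLp with hg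
  have hgs : ∀ α β, ContMDiffOn 𝓘(ℝ, E) 𝓘(ℝ, ℂ) ∞ (fun x => g x α β) O := fun α β x hx =>
    ((hlag (r x) (hrB hx) α β).contMDiffAt.comp x
      (hr.contMDiffAt (hO.mem_nhds hx))).contMDiffWithinAt
  have hgu : ∀ x ∈ O, IsUSp (g x) := fun x hx => husp (r x) (hrB hx)
  have hmem := gaugeFrame_mem hD hO hOD hgs hgu
  refine ⟨_, hmem, ⟨g, gaugeFrame_isGauge hO hOD hgs hgu⟩,
    {q | q ∈ W ∧ ι q ∈ O ∧ q ∈ (extChartAt 𝓘(ℝ, F) p).source ∧ r (ι q) = extChartAt 𝓘(ℝ, F) p q},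
    ?_, fun q hq => hq.1, fun q hq => hq.2.1, ?_⟩
  · filter_upwards [hW.mem_nhds hp, hι.smooth.continuous.continuousAt.preimage_mem_nhds
      (hO.mem_nhds hpO), extChartAt_source_mem_nhds (I := 𝓘(ℝ, F)) p, hrι] with q h1 h2 h3 h4
    exact ⟨h1, h2, h3, h4⟩
  · rintro q ⟨hqW, hqO, hqs, hqr⟩
    refine (halfVanish_iff (S.isQuaternionic _ hmem) (x := ι q) hqO).2 fun t ht I => ?_
    rw [theta_eq_mulVec hq (hOD hqO) (S.isQuaternionic _ hmem) hqO
      (fun v A α => gaugeFrame_u A α (ι q) v), hg]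
    rw [lagMatrix_mulVec_inr, hqr]
    have hyB : extChartAt 𝓘(ℝ, F) p q ∈ B := hqr ▸ hrB hqO
    have h1 := hiso _ hyB
    rw [(extChartAt 𝓘(ℝ, F) p).left_inv hqs] at h1
    exact h1 t ht I

theorem IsGauge.su2CurvVanish {D' : Frame n E M} (hD : D ∈ S.frames) (hD' : D' ∈ S.frames)
    {O : Set M} {g : M → Matrix (Idx n) (Idx n) ℂ} (h : D.IsGauge D' O (fun _ => 1) g) {x : M}
    (hx : x ∈ O) {P : Submodule ℝ (TangentSpace 𝓘(ℝ, E) x)} (hP : D'.HalfVanish x P) :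
    D.SU2CurvVanish x P := by
  refine su2CurvVanish_of_rotation (S.isQuaternionic D hD) S.lam_ne (h.subset hx).1
    (S.isQuaternionic D' hD') (h.subset hx).2 (h.mem_USp x hx) (fun v A α => ?_) hP
  rw [h.vielbein x hx, Finset.sum_eq_single A (fun B _ hB => by
      simp [Matrix.one_apply_ne hB.symm]) (by simp)]
  simp

end Frame

/-! ### Smooth tensor fields in charts -/

section Tensors

variable {F : Type*} [NormedAddCommGroup F] [NormedSpace ℝ F]
  {N : Type*} [TopologicalSpace N] [ChartedSpace F N] [IsManifold 𝓘(ℝ, F) ∞ N]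

theorem symmL_trivializationAt_apply {p₀ q : N} (hq : q ∈ (extChartAt 𝓘(ℝ, F) p₀).source) (v : F) :
    (trivializationAt F (TangentSpace 𝓘(ℝ, F)) p₀).symm q v =
      mfderiv 𝓘(ℝ, F) 𝓘(ℝ, F) (extChartAt 𝓘(ℝ, F) p₀).symm (extChartAt 𝓘(ℝ, F) p₀ q) v := by
  have : IsManifold 𝓘(ℝ, F) 1 N := IsManifold.of_le (n := ∞) (by simp)
  have h := TangentBundle.symmL_trivializationAt (I := 𝓘(ℝ, F)) (x₀ := p₀) (x := q)
    (by simpa using hq)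
  rw [modelWithCornersSelf_coe, Set.range_id, mfderivWithin_univ] at h
  have h2 := congrArg (fun L : F →L[ℝ] F => L v) h
  exact (Bundle.Trivialization.symmL_apply (R := ℝ)
    (trivializationAt F (TangentSpace 𝓘(ℝ, F)) p₀) (by simpa using hq) v).symm.trans h2

/-- The inverse of the tangent trivialization is the derivative of the inverse chart, so bundle
smoothness of J is smoothness of its matrix K in the chart. -/
theorem contMDiffAt_endomorphism
    {J : (p : N) → TangentSpace 𝓘(ℝ, F) p →L[ℝ] TangentSpace 𝓘(ℝ, F) p} {p₀ : N}
    {K : F → F →L[ℝ] F} (hs : ContDiffAt ℝ ∞ K (extChartAt 𝓘(ℝ, F) p₀ p₀))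
    (h : ∀ᶠ q in 𝓝 p₀, ∀ v : F, J q (mfderiv 𝓘(ℝ, F) 𝓘(ℝ, F) (extChartAt 𝓘(ℝ, F) p₀).symm
        (extChartAt 𝓘(ℝ, F) p₀ q) v) =
      mfderiv 𝓘(ℝ, F) 𝓘(ℝ, F) (extChartAt 𝓘(ℝ, F) p₀).symm (extChartAt 𝓘(ℝ, F) p₀ q)
        (K (extChartAt 𝓘(ℝ, F) p₀ q) v)) :
    ContMDiffAt 𝓘(ℝ, F) (𝓘(ℝ, F).prod 𝓘(ℝ, F →L[ℝ] F)) ∞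
      (fun p => Bundle.TotalSpace.mk' (F →L[ℝ] F)
        (E := fun p : N => TangentSpace 𝓘(ℝ, F) p →L[ℝ] TangentSpace 𝓘(ℝ, F) p) p (J p)) p₀ := by
  rw [contMDiffAt_hom_bundle]
  refine ⟨contMDiffAt_id, (hs.contMDiffAt.comp p₀ contMDiffAt_extChartAt).congr_of_eventuallyEq ?_⟩
  filter_upwards [extChartAt_source_mem_nhds (I := 𝓘(ℝ, F)) p₀, h] with q hq h2
  have hb : q ∈ (trivializationAt F (TangentSpace 𝓘(ℝ, F)) p₀).baseSet := by simpa using hq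
  ext v
  rw [ContinuousLinearMap.inCoordinates_eq hb hb]
  have h3 := h2 v
  rw [← symmL_trivializationAt_apply hq, ← symmL_trivializationAt_apply hq] at h3
  set e := (trivializationAt F (TangentSpace 𝓘(ℝ, F)) p₀).continuousLinearEquivAt ℝ q hb
  have h4 : ∀ w : F, e.symm w = (trivializationAt F (TangentSpace 𝓘(ℝ, F)) p₀).symm q w := fun w =>
    (congrFun (Bundle.Trivialization.symm_continuousLinearEquivAt_eq (R := ℝ) _ hb) w).trans
      (Bundle.Trivialization.symmL_apply (R := ℝ) _ hb w)
  rw [← h4, ← h4] at h3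
  show e (J q (e.symm v)) = _
  rw [h3, e.apply_symm_apply]
  rfl

theorem contMDiffAt_bilinear
    {g : (p : N) → TangentSpace 𝓘(ℝ, F) p →L[ℝ] TangentSpace 𝓘(ℝ, F) p →L[ℝ] ℝ} {p₀ : N}
    {K : F → F →L[ℝ] F →L[ℝ] ℝ} (hs : ContDiffAt ℝ ∞ K (extChartAt 𝓘(ℝ, F) p₀ p₀))
    (h : ∀ᶠ q in 𝓝 p₀, ∀ v w : F, g q (mfderiv 𝓘(ℝ, F) 𝓘(ℝ, F) (extChartAt 𝓘(ℝ, F) p₀).symm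
        (extChartAt 𝓘(ℝ, F) p₀ q) v) (mfderiv 𝓘(ℝ, F) 𝓘(ℝ, F) (extChartAt 𝓘(ℝ, F) p₀).symm
        (extChartAt 𝓘(ℝ, F) p₀ q) w) = K (extChartAt 𝓘(ℝ, F) p₀ q) v w) :
    ContMDiffAt 𝓘(ℝ, F) (𝓘(ℝ, F).prod 𝓘(ℝ, F →L[ℝ] F →L[ℝ] ℝ)) ∞
      (fun p => Bundle.TotalSpace.mk' (F →L[ℝ] F →L[ℝ] ℝ)
        (E := fun p : N => TangentSpace 𝓘(ℝ, F) p →L[ℝ] TangentSpace 𝓘(ℝ, F) p →L[ℝ] ℝ) p (g p)) p₀ := by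
  rw [contMDiffAt_hom_bundle]
  refine ⟨contMDiffAt_id, (hs.contMDiffAt.comp p₀ contMDiffAt_extChartAt).congr_of_eventuallyEq ?_⟩
  filter_upwards [extChartAt_source_mem_nhds (I := 𝓘(ℝ, F)) p₀, h] with q hq h2
  have hb : q ∈ (trivializationAt F (TangentSpace 𝓘(ℝ, F)) p₀).baseSet := by simpa using hq
  ext v w
  have h3 := h2 v w
  rw [← symmL_trivializationAt_apply hq, ← symmL_trivializationAt_apply hq] at h3
  refine Eq.trans ?_ h3
  refine (inCoordinates_apply_eq₂ (E₃ := Bundle.Trivial N ℝ) hb hb (Set.mem_univ _)).trans ?_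
  simp

/-- A vector field in the chart at `p`. -/
def chartField (p : N) (X : (q : N) → TangentSpace 𝓘(ℝ, F) q) (y : F) : F :=
  (mfderiv 𝓘(ℝ, F) 𝓘(ℝ, F) (extChartAt 𝓘(ℝ, F) p).symm y).inverse
    (X ((extChartAt 𝓘(ℝ, F) p).symm y))

theorem chartField_eq (p : N) (X : (q : N) → TangentSpace 𝓘(ℝ, F) q) :
    VectorField.mpullbackWithin 𝓘(ℝ, F) 𝓘(ℝ, F) (extChartAt 𝓘(ℝ, F) p).symm X
      (Set.range 𝓘(ℝ, F)) = chartField p X := by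
  funext y
  rw [VectorField.mpullbackWithin_apply, modelWithCornersSelf_coe, Set.range_id, mfderivWithin_univ]
  rfl

theorem isInvertible_mfderiv_symm {p : N} {y : F} (hy : y ∈ (extChartAt 𝓘(ℝ, F) p).target) :
    (mfderiv 𝓘(ℝ, F) 𝓘(ℝ, F) (extChartAt 𝓘(ℝ, F) p).symm y).IsInvertible := by
  have : IsManifold 𝓘(ℝ, F) 1 N := IsManifold.of_le (n := ∞) (by simp)
  have h := isInvertible_mfderivWithin_extChartAt_symm (I := 𝓘(ℝ, F)) hy
  rwa [modelWithCornersSelf_coe, Set.range_id, mfderivWithin_univ] at h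

theorem differentiableAt_chartField [CompleteSpace F] {p : N} {X : (q : N) → TangentSpace 𝓘(ℝ, F) q}
    (hX : MDifferentiableAt 𝓘(ℝ, F) 𝓘(ℝ, F).tangent
      (fun q => (⟨q, X q⟩ : TangentBundle 𝓘(ℝ, F) N)) p) :
    DifferentiableAt ℝ (chartField p X) (extChartAt 𝓘(ℝ, F) p p) := by
  have : IsManifold 𝓘(ℝ, F) 2 N := IsManifold.of_le (n := ∞) (WithTop.coe_le_coe.2 le_top)
  have h := (mdifferentiableWithinAt_univ.2 hX).differentiableWithinAt_mpullbackWithin_vectorField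
  rwa [chartField_eq, modelWithCornersSelf_coe, Set.range_id, Set.preimage_univ, Set.univ_inter,
    differentiableWithinAt_univ] at h

theorem mlieBracket_eq_lieBracket (p : N) (X Y : (q : N) → TangentSpace 𝓘(ℝ, F) q) :
    VectorField.mlieBracket 𝓘(ℝ, F) X Y p =
      VectorField.lieBracket ℝ (chartField p X) (chartField p Y) (extChartAt 𝓘(ℝ, F) p p) := by
  have : IsManifold 𝓘(ℝ, F) 1 N := IsManifold.of_le (n := ∞) (by simp)
  -- The chart at p has identity derivative at p, so the outer pull-back in the definition of the
  -- bracket is trivial. Abstracting all data first avoids rewriting inside dependent tangent space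
  -- types.
  have key : ∀ A B : F → F, ∀ L : F →L[ℝ] F, ∀ s : Set F, L = ContinuousLinearMap.id ℝ F →
      A = chartField p X → B = chartField p Y → s = Set.univ →
      L.inverse (VectorField.lieBracketWithin ℝ A B s (extChartAt 𝓘(ℝ, F) p p)) =
      VectorField.lieBracket ℝ (chartField p X) (chartField p Y) (extChartAt 𝓘(ℝ, F) p p) := by
    rintro A B L s rfl rfl rfl rfl
    rw [VectorField.lieBracketWithin_univ, ContinuousLinearMap.inverse_id]
    rfl
  exact key _ _ _ _ mfderiv_extChartAt_self (chartField_eq p X) (chartField_eq p Y) (by simp)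

end Tensors

/-! ### Integrability of an almost complex structure from the structure equations -/

section Nijenhuis

variable {F : Type*} [NormedAddCommGroup F] [NormedSpace ℝ F]

theorem fderiv_clm_apply_of_eventuallyEq {θ : F → F →L[ℝ] ℂ} {X X' : F → F} {y : F}
    (hθ : DifferentiableAt ℝ θ y) (hX : DifferentiableAt ℝ X y) (hX' : DifferentiableAt ℝ X' y)
    (h : ∀ᶠ z in 𝓝 y, θ z (X' z) = Complex.I * θ z (X z)) (v : F) :
    θ y (fderiv ℝ X' y v) = Complex.I * (fderiv ℝ θ y v (X y) + θ y (fderiv ℝ X y v))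
      - fderiv ℝ θ y v (X' y) := by
  have h1 := Filter.EventuallyEq.fderiv_eq (𝕜 := ℝ) h
  rw [fderiv_clm_apply hθ hX', fderiv_const_mul (hθ.clm_apply hX), fderiv_clm_apply hθ hX] at h1
  have h2 := congrArg (fun L : F →L[ℝ] ℂ => L v) h1
  simp only [_root_.add_apply, ContinuousLinearMap.comp_apply,
    ContinuousLinearMap.flip_apply, _root_.smul_apply, smul_eq_mul] at h2
  linear_combination h2

/-- X', Y' stand for JX, JY, and the θ^k are of type (1,0). As θ[X,Y] = X(θY) - Y(θX) - dθ(X,Y), the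
derivative terms cancel in the Nijenhuis combination, and the dθ terms cancel because dθ lies in the
ideal generated by the θ^l. Only the values of η occur, so η need not be linear. -/
theorem nijenhuis_flat {κ : Type*} [Fintype κ] {θ : κ → F → F →L[ℝ] ℂ} {η : κ → κ → F → ℂ} {y : F}
    (hθ : ∀ k, DifferentiableAt ℝ (θ k) y)
    (hst : ∀ k v w, fderiv ℝ (θ k) y v w - fderiv ℝ (θ k) y w v =
      -∑ l, (η k l v * θ l y w - η k l w * θ l y v))
    {X Y X' Y' : F → F} (hX : DifferentiableAt ℝ X y) (hY : DifferentiableAt ℝ Y y)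
    (hX' : DifferentiableAt ℝ X' y) (hY' : DifferentiableAt ℝ Y' y)
    (hXX' : ∀ k, ∀ᶠ z in 𝓝 y, θ k z (X' z) = Complex.I * θ k z (X z))
    (hYY' : ∀ k, ∀ᶠ z in 𝓝 y, θ k z (Y' z) = Complex.I * θ k z (Y z)) (k : κ) :
    θ k y (VectorField.lieBracket ℝ X' Y' y)
      - Complex.I * θ k y (VectorField.lieBracket ℝ X' Y y)
      - Complex.I * θ k y (VectorField.lieBracket ℝ X Y' y)
      - θ k y (VectorField.lieBracket ℝ X Y y) = 0 := by
  have eX := fderiv_clm_apply_of_eventuallyEq (hθ k) hX hX' (hXX' k)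
  have eY := fderiv_clm_apply_of_eventuallyEq (hθ k) hY hY' (hYY' k)
  simp only [VectorField.lieBracket, map_sub]
  have s1 := hst k (X' y) (Y' y)
  have s2 := hst k (X' y) (Y y)
  have s3 := hst k (X y) (Y' y)
  have s4 := hst k (X y) (Y y)
  -- The dθ part of the combination: putting a primed vector into θ multiplies it by i, and the
  -- coefficients of each value of η then add up to zero.
  have hs : -(-∑ l, (η k l (X' y) * θ l y (Y' y) - η k l (Y' y) * θ l y (X' y)))
      + Complex.I * (-∑ l, (η k l (X' y) * θ l y (Y y) - η k l (Y y) * θ l y (X' y)))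
      + Complex.I * (-∑ l, (η k l (X y) * θ l y (Y' y) - η k l (Y' y) * θ l y (X y)))
      + (-∑ l, (η k l (X y) * θ l y (Y y) - η k l (Y y) * θ l y (X y))) = 0 := by
    rw [neg_neg, mul_neg, mul_neg, Finset.mul_sum, Finset.mul_sum, ← sub_eq_add_neg,
      ← sub_eq_add_neg, ← sub_eq_add_neg, ← Finset.sum_sub_distrib, ← Finset.sum_sub_distrib,
      ← Finset.sum_sub_distrib]
    refine Finset.sum_eq_zero fun l _ => ?_
    rw [(hXX' l).self_of_nhds, (hYY' l).self_of_nhds]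
    linear_combination (η k l (Y y) * θ l y (X y) - η k l (X y) * θ l y (Y y)) * Complex.I_sq
  rw [← s1, ← s2, ← s3, ← s4] at hs
  rw [eX, eX, eY, eY]
  linear_combination hs + (θ k y (fderiv ℝ X y (Y y)) - θ k y (fderiv ℝ Y y (X y))
    + fderiv ℝ (θ k) y (Y y) (X y) - fderiv ℝ (θ k) y (X y) (Y y)) * Complex.I_sq

end Nijenhuis

/-! ### The induced almost Hermitian structure of a truncation -/

namespace Frame

section Pointwise

variable {n : ℕ} {E : Type*} [NormedAddCommGroup E] [NormedSpace ℝ E]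
  {M : Type*} [TopologicalSpace M] [ChartedSpace E M] {D D' : Frame n E M} {lam : ℝ}
  {x : M} {P : Submodule ℝ (TangentSpace 𝓘(ℝ, E) x)}

theorem HalfVanish.uPair_zero_one (hD : D.IsQuaternionic lam) (hx : x ∈ D.dom)
    (h : D.HalfVanish x P) {v : TangentSpace 𝓘(ℝ, E) x} (hv : v ∈ P)
    (w : TangentSpace 𝓘(ℝ, E) x) :
    D.uPair 0 1 x v w = ∑ I, D.u 0 (.inl I) x v * (starRingEnd ℂ) (D.u 0 (.inl I) x w) := by
  show (∑ I : Fin n, (D.u 0 (.inl I) x v * D.u 1 (.inr I) x w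
    - D.u 0 (.inr I) x v * D.u 1 (.inl I) x w)) = _
  refine Finset.sum_congr rfl fun I _ => ?_
  have h1 : D.u 0 (.inr I) x v = 0 := (halfVanish_iff hD hx).1 h v hv I
  have h2 : D.u 1 (.inr I) x w = (starRingEnd ℂ) (D.u 0 (.inl I) x w) := by
    rw [u_eq_theta hD hx, realForm_one_inr]; rfl
  rw [h1, h2, zero_mul, sub_zero]

theorem sum_symp_eps_eq_uPair (x : M) (v w : TangentSpace 𝓘(ℝ, E) x) :
    ∑ A, ∑ B, ∑ α, ∑ β, symp n α β * eps A B * D.u A α x v * D.u B β x w =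
      D.uPair 0 1 x v w + D.uPair 0 1 x w v := by
  have h : ∀ A B, ∑ α, ∑ β, symp n α β * eps A B * D.u A α x v * D.u B β x w =
      eps A B * D.uPair A B x v w := fun A B => by
    rw [uPair, ← sum_symp_eq_sympPair, Finset.mul_sum]
    refine Finset.sum_congr rfl fun α _ => ?_
    rw [Finset.mul_sum]
    exact Finset.sum_congr rfl fun β _ => by ring
  simp only [h, Fin.sum_univ_two]
  rw [uPair_swap D 0 1 x w v]
  simp [eps]

theorem sum_mul_conj_add {κ : Type*} [Fintype κ] (z w : κ → ℂ) :
    ∑ I, z I * (starRingEnd ℂ) (w I) + ∑ I, w I * (starRingEnd ℂ) (z I) =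
      ((2 * ∑ I, (z I * (starRingEnd ℂ) (w I)).re : ℝ) : ℂ) := by
  push_cast
  rw [Finset.mul_sum, ← Finset.sum_add_distrib]
  refine Finset.sum_congr rfl fun I _ => ?_
  have h := Complex.add_conj (z I * (starRingEnd ℂ) (w I))
  rw [map_mul, Complex.conj_conj, mul_comm (starRingEnd ℂ (z I))] at h
  rw [h]
  push_cast
  ring

/-- A gauge transformation whose `SU(2)` part is diagonal acts by scalars on the first row of the
vielbein. -/
theorem IsGauge.u_of_diagonal {O : Set M} {a : M → Matrix (Fin 2) (Fin 2) ℂ}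
    {g : M → Matrix (Idx n) (Idx n) ℂ} (hg : D.IsGauge D' O a g) (hx : x ∈ O) (ha : a x 0 1 = 0)
    (v : TangentSpace 𝓘(ℝ, E) x) (α : Idx n) :
    D'.u 0 α x v = a x 0 0 * ∑ β, g x α β * D.u 0 β x v := by
  rw [hg.vielbein x hx v 0 α, Fin.sum_univ_two, Finset.mul_sum, ha]
  simp [mul_assoc]

theorem IsGauge.u_inl_of_diagonal (hD : D.IsQuaternionic lam) {O : Set M}
    {a : M → Matrix (Fin 2) (Fin 2) ℂ}
    {g : M → Matrix (Idx n) (Idx n) ℂ} (hg : D.IsGauge D' O a g) (hx : x ∈ O) (ha : a x 0 1 = 0)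
    (hh : D.HalfVanish x P) {v : TangentSpace 𝓘(ℝ, E) x} (hv : v ∈ P) (I : Fin n) :
    D'.u 0 (.inl I) x v = a x 0 0 * ∑ K, g x (.inl I) (.inl K) * D.u 0 (.inl K) x v := by
  have h1 : ∀ K, D.u 0 (.inr K) x v = 0 := (halfVanish_iff hD (hg.subset hx).1).1 hh v hv
  rw [hg.u_of_diagonal hx ha, Fintype.sum_sum_type]
  simp [h1]

/-- The square of the `U(1)` part of a gauge transformation is determined by the frames. -/
theorem IsGauge.sympPair_of_diagonal {O : Set M} {a : M → Matrix (Fin 2) (Fin 2) ℂ}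
    {g : M → Matrix (Idx n) (Idx n) ℂ} (hg : D.IsGauge D' O a g) (hx : x ∈ O) (ha : a x 0 1 = 0)
    (v w : TangentSpace 𝓘(ℝ, E) x) :
    D'.uPair 0 0 x v w = a x 0 0 ^ 2 * D.uPair 0 0 x v w := by
  have h : ∀ t, (fun α => D'.u 0 α x t) = a x 0 0 • Matrix.mulVec (g x) (fun β => D.u 0 β x t) :=
    fun t => funext fun α => hg.u_of_diagonal hx ha t α
  rw [uPair, h, h, sympPair_smul_left, sympPair_smul_right, (hg.mem_USp x hx).sympPair_mulVec, uPair]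
  ring

/-- A nonzero value of the pairing, for which n > 0 is needed; it makes the factor a² in
`IsGauge.sympPair_of_diagonal` unique. -/
theorem exists_uPair_eq_one (hn : 0 < n) (hD : D.IsQuaternionic lam) (hx : x ∈ D.dom) :
    ∃ v w, D.uPair 0 0 x v w = 1 := by
  refine ⟨(theta hD hx).symm (Pi.single (.inl ⟨0, hn⟩) 1),
    (theta hD hx).symm (Pi.single (.inr ⟨0, hn⟩) 1), ?_⟩
  rw [uPair_zero_zero hD hx, LinearEquiv.apply_symm_apply, LinearEquiv.apply_symm_apply,
    sympPair_single_inl, Pi.single_eq_same]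

theorem norm_of_diagonal {a : Matrix (Fin 2) (Fin 2) ℂ}
    (ha : a ∈ Matrix.specialUnitaryGroup (Fin 2) ℂ) (h : a 0 1 = 0) : star (a 0 0) * a 0 0 = 1 := by
  have h1 := congrFun (congrFun ((Matrix.mem_unitaryGroup_iff).1
    ((Matrix.mem_specialUnitaryGroup_iff).1 ha).1) 0) 0
  rw [Matrix.mul_apply, Fin.sum_univ_two, h, Matrix.star_apply] at h1
  simpa [mul_comm] using h1

end Pointwise

variable {n : ℕ} {E : Type*} [NormedAddCommGroup E] [NormedSpace ℝ E]
  {M : Type*} [TopologicalSpace M] [ChartedSpace E M] [IsManifold 𝓘(ℝ, E) ∞ M]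
  {F : Type*} [NormedAddCommGroup F] [NormedSpace ℝ F] [FiniteDimensional ℝ F]
  {N : Type*} [TopologicalSpace N] [ChartedSpace F N] [IsManifold 𝓘(ℝ, F) ∞ N] {ι : N → M}
  {D D' : Frame n E M} {S : QKStructure n E M} {lam : ℝ}

/-- The forms `U^{1I}` on the submanifold, at a point. -/
def subTheta (D : Frame n E M) (ι : N → M) (p : N) : F →L[ℝ] (Fin n → ℂ) :=
  LinearMap.toContinuousLinearMap <|
    (LinearMap.pi fun I => uLinear D 0 (.inl I) (ι p)) ∘ₗ (dmap (E := E) (F := F) ι p).toLinearMap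

omit [IsManifold 𝓘(ℝ, E) ∞ M] [IsManifold 𝓘(ℝ, F) ∞ N] in
theorem subTheta_apply (D : Frame n E M) (ι : N → M) (p : N) (v : F) (I : Fin n) :
    subTheta D ι p v I = D.u 0 (.inl I) (ι p) (dmap ι p v) := rfl

omit [IsManifold 𝓘(ℝ, E) ∞ M] [IsManifold 𝓘(ℝ, F) ∞ N] in
theorem injective_subTheta (hι : IsSubmanifold (E := E) (F := F) ι) (hD : D.IsQuaternionic lam)
    {p : N} (hp : ι p ∈ D.dom) (hh : D.HalfVanish (ι p) (tangentPlane (F := F) ι p)) :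
    Function.Injective (subTheta (F := F) D ι p) := by
  intro v w h
  have h1 := @HalfVanish.injective_halfTheta _ _ _ _ _ _ _ _ _ _ _ hD hp hh
    ⟨dmap ι p v, v, rfl⟩ ⟨dmap ι p w, w, rfl⟩ (funext fun I => congrFun h I)
  exact hι.immersion p (congrArg Subtype.val h1)

omit [IsManifold 𝓘(ℝ, E) ∞ M] [IsManifold 𝓘(ℝ, F) ∞ N] in
theorem uPair_dmap (hD : D.IsQuaternionic lam) {p : N} (hp : ι p ∈ D.dom)
    (hh : D.HalfVanish (ι p) (tangentPlane (F := F) ι p)) (v w : F) :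
    D.uPair 0 1 (ι p) (dmap (F := F) ι p v) (dmap (F := F) ι p w) =
      ∑ I, subTheta D ι p v I * (starRingEnd ℂ) (subTheta D ι p w I) :=
  hh.uPair_zero_one hD hp ⟨v, rfl⟩ _

omit [IsManifold 𝓘(ℝ, F) ∞ N] in
-- With the dotted coordinates zero, the metric is twice the real part of the standard Hermitian
-- form of ℂⁿ.
theorem inner_dmap (hD : D ∈ S.frames) {p : N} (hp : ι p ∈ D.dom)
    (hh : D.HalfVanish (ι p) (tangentPlane (F := F) ι p)) (v w : F) :
    S.h.inner (ι p) (dmap ι p v) (dmap ι p w) =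
      2 * ∑ I, (subTheta D ι p v I * (starRingEnd ℂ) (subTheta D ι p w I)).re := by
  have hq := S.isQuaternionic D hD
  refine Complex.ofReal_injective ?_
  rw [← sum_mul_conj_add, ← uPair_dmap hq hp hh, ← uPair_dmap hq hp hh, ← sum_symp_eps_eq_uPair]
  exact S.metric_eq D hD _ hp _ _

omit [IsManifold 𝓘(ℝ, E) ∞ M] [IsManifold 𝓘(ℝ, F) ∞ N] in
-- Ω^3 is -2iλ(H - H̄) for the Hermitian form H; replacing v by v' turns H into iH, so this is -2λ
-- times twice the real part of H(v', w).
theorem su2Curv_two_dmap (hD : D.IsQuaternionic lam) {p : N} (hp : ι p ∈ D.dom)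
    (hh : D.HalfVanish (ι p) (tangentPlane (F := F) ι p)) {v v' : F}
    (hv : subTheta D ι p v' = Complex.I • subTheta D ι p v) (w : F) :
    D.su2Curv 2 (ι p) (dmap ι p v) (dmap ι p w) =
      -2 * lam * (2 * ∑ I, (subTheta D ι p v' I * (starRingEnd ℂ) (subTheta D ι p w I)).re) := by
  refine Complex.ofReal_injective ?_
  refine (su2Curv_two hD hp _ _).trans ?_
  refine (congrArg _ (congrArg₂ _ (uPair_dmap hD hp hh v w) (uPair_dmap hD hp hh w v))).trans ?_
  rw [Complex.ofReal_mul, ← sum_mul_conj_add, hv, ← Finset.sum_sub_distrib, ← Finset.sum_add_distrib,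
    Finset.mul_sum, Finset.mul_sum]
  refine Finset.sum_congr rfl fun I _ => ?_
  simp only [Pi.smul_apply, smul_eq_mul, map_mul, Complex.conj_I, subTheta_apply]
  push_cast
  ring

end Frame

section Truncation

variable {n : ℕ} {E : Type*} [NormedAddCommGroup E] [NormedSpace ℝ E]
  {M : Type*} [TopologicalSpace M] [ChartedSpace E M] [IsManifold 𝓘(ℝ, E) ∞ M]
  {F : Type*} [NormedAddCommGroup F] [NormedSpace ℝ F] [FiniteDimensional ℝ F]
  {N : Type*} [TopologicalSpace N] [ChartedSpace F N] [IsManifold 𝓘(ℝ, F) ∞ N] {ι : N → M}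
  {S : QKStructure n E M} {R : Set (Set N × Frame n E M)}

open _root_.QK.Frame

theorem IsTruncation.finrank_le [Nonempty N] (hR : IsTruncation (F := F) S ι R)
    (hι : IsSubmanifold (E := E) (F := F) ι) : Module.finrank ℝ F ≤ 2 * n := by
  obtain ⟨p⟩ := ‹Nonempty N›
  obtain ⟨r, hr, hp⟩ := hR.cover p
  rw [← finrank_tangentPlane (E := E) hι p]
  exact (hR.half r hr p hp).finrank_le (S.isQuaternionic _ (hR.mem r hr)) (hR.mapsTo r hr hp)

theorem IsTruncation.omegaVanish (hR : IsTruncation (F := F) S ι R)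
    (hι : IsSubmanifold (E := E) (F := F) ι) (hF : Module.finrank ℝ F = 2 * n)
    {r : Set N × Frame n E M} (hr : r ∈ R) {p : N} (hp : p ∈ r.1)
    {T : Idx n → Idx n → Idx n → Idx n → ℂ} (hT : r.2.IsOmegaTensor S.lam (ι p) T) :
    OmegaVanish T := by
  have hq := S.isQuaternionic _ (hR.mem r hr)
  exact omegaVanish_of_involution hq (hR.mapsTo r hr hp) (hR.conn r hr p hp) hT (hR.half r hr p hp)
    ((finrank_tangentPlane hι p).trans hF)
    (involution_of_connVanish hq hι (hR.isOpen r hr) (hR.mapsTo r hr) (hR.conn r hr) hp)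

/-- In dimension 2n the U^{1I} map the tangent plane onto ℂⁿ, so i U^{1I}(v) is attained. -/
theorem IsTruncation.isComplexSubmanifold (hR : IsTruncation (F := F) S ι R)
    (hι : IsSubmanifold (E := E) (F := F) ι) (hF : Module.finrank ℝ F = 2 * n) :
    IsComplexSubmanifold (F := F) ι R := by
  intro r hr p hp v
  obtain ⟨⟨_, w, rfl⟩, hw⟩ := (hR.half r hr p hp).surjective_halfTheta
    (S.isQuaternionic _ (hR.mem r hr)) (hR.mapsTo r hr hp) ((finrank_tangentPlane hι p).trans hF)
    (Complex.I • subTheta (F := F) r.2 ι p v)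
  exact ⟨w, fun I => congrFun hw I⟩

omit [IsManifold 𝓘(ℝ, F) ∞ N] in
/-- The complex structure does not depend on the frame. -/
theorem IsTruncation.subTheta_eq_I_smul (hR : IsTruncation (F := F) S ι R)
    {r s : Set N × Frame n E M} (hr : r ∈ R) (hs : s ∈ R) {p : N} (hpr : p ∈ r.1) (hps : p ∈ s.1)
    {v w : F} (h : subTheta r.2 ι p w = Complex.I • subTheta r.2 ι p v) :
    subTheta s.2 ι p w = Complex.I • subTheta s.2 ι p v := by
  obtain ⟨O, a, g, hO, hg, ha⟩ := hR.reduced r hr s hs p ⟨hpr, hps⟩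
  have hq := S.isQuaternionic _ (hR.mem r hr)
  have h1 := fun t : F => hg.u_inl_of_diagonal hq hO ha.self_of_nhds (hR.half r hr p hpr) ⟨t, rfl⟩
  funext I
  refine (h1 w I).trans (Eq.trans ?_ (congrArg (Complex.I * ·) (h1 v I)).symm)
  rw [mul_left_comm, Finset.mul_sum Finset.univ _ Complex.I]
  refine congrArg _ (Finset.sum_congr rfl fun K _ => ?_)
  have := congrFun h K
  rw [Pi.smul_apply, smul_eq_mul] at this
  refine (congrArg _ this).trans ?_
  rw [mul_left_comm]
  rfl

omit [IsManifold 𝓘(ℝ, F) ∞ N] in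
-- Injectivity of the U^{1I} on N makes the vector Jv unique; uniqueness yields linearity and, with
-- `subTheta_eq_I_smul`, validity in all frames at once.
theorem IsTruncation.exists_complexStructure (hR : IsTruncation (F := F) S ι R)
    (hι : IsSubmanifold (E := E) (F := F) ι) (hc : IsComplexSubmanifold (F := F) ι R) :
    ∃ J : N → F →L[ℝ] F, ∀ r ∈ R, ∀ p ∈ r.1, ∀ v,
      subTheta r.2 ι p (J p v) = Complex.I • subTheta r.2 ι p v := by
  choose r hr hp using hR.cover
  have hw : ∀ p, ∀ v : F, ∃ w : F, subTheta (r p).2 ι p w = Complex.I • subTheta (r p).2 ι p v :=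
    fun p v => (hc (r p) (hr p) p (hp p) v).imp fun w h => funext h
  choose w hw' using hw
  have hinj := fun p => injective_subTheta (F := F) hι (S.isQuaternionic _ (hR.mem _ (hr p)))
    (hR.mapsTo _ (hr p) (hp p)) (hR.half _ (hr p) p (hp p))
  refine ⟨fun p => LinearMap.toContinuousLinearMap
    { toFun := w p
      map_add' := fun v v' => hinj p (by
        rw [hw', map_add, map_add, hw', hw', smul_add])
      map_smul' := fun c v => hinj p (by
        rw [hw', map_smul, RingHom.id_apply, map_smul, hw', smul_comm]) }, ?_⟩
  intro s hs p hps v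
  exact hR.subTheta_eq_I_smul (hr p) hs (hp p) hps (hw' p v)

end Truncation

/-! ### Smoothness tools for induced tensors. -/

section Flat

variable {F : Type*} [NormedAddCommGroup F] [NormedSpace ℝ F] [FiniteDimensional ℝ F]
  {E : Type*} [NormedAddCommGroup E] [NormedSpace ℝ E]

theorem isVonNBounded_preimage {L : F →L[ℝ] E} (hL : Function.Injective L) {B : Set E}
    (hB : Bornology.IsVonNBounded ℝ B) : Bornology.IsVonNBounded ℝ (L ⁻¹' B) := by
  rw [NormedSpace.isVonNBounded_iff] at hB ⊢
  obtain ⟨K, -, hK⟩ := L.toLinearMap.exists_antilipschitzWith (LinearMap.ker_eq_bot.2 hL)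
  exact hK.isBounded_preimage hB

/-- The complex structure induced by a smoothly varying totally complex embedding is smooth. -/
theorem contDiffAt_complexStructure {κ : Type*} [Fintype κ] {Θ : F → F →L[ℝ] (κ → ℂ)}
    {J : F → F →L[ℝ] F} {y : F} (hΘ : ContDiffAt ℝ ∞ Θ y) (hi : Function.Injective (Θ y))
    (hJ : ∀ᶠ z in 𝓝 y, ∀ v, Θ z (J z v) = Complex.I • Θ z v) : ContDiffAt ℝ ∞ J y := by
  -- With ℓ a fixed left inverse of Θ(y), near y one has J = (ℓΘ)⁻¹ ℓ(iΘ), and inversion is smooth.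
  obtain ⟨ℓ₀, hℓ₀⟩ := LinearMap.exists_leftInverse_of_injective (Θ y).toLinearMap
    (LinearMap.ker_eq_bot.2 hi)
  set ℓ : (κ → ℂ) →L[ℝ] F := LinearMap.toContinuousLinearMap ℓ₀
  have hℓ : ℓ ∘L Θ y = ContinuousLinearMap.id ℝ F := by
    ext v
    exact congrArg (fun L : F →ₗ[ℝ] F => L v) hℓ₀
  set A : F → F →L[ℝ] F := fun z => ℓ ∘L Θ z with hA
  have hAs : ContDiffAt ℝ ∞ A y := contDiffAt_const.clm_comp hΘ
  have hAy : A y = ((ContinuousLinearEquiv.refl ℝ F : F ≃L[ℝ] F) : F →L[ℝ] F) := hℓ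
  have hinv : ContDiffAt ℝ ∞ (fun z => (A z).inverse) y := by
    refine ContDiffAt.comp y (g := ContinuousLinearMap.inverse) ?_ hAs
    rw [hAy]
    exact contDiffAt_map_inverse _
  have hev : ∀ᶠ z in 𝓝 y, (A z).IsInvertible := by
    refine hAs.continuousAt.eventually ?_
    rw [hAy]
    exact (ContinuousLinearEquiv.refl ℝ F).nhds
  have hT : ContDiffAt ℝ ∞ (fun z => ℓ ∘L (Complex.I • Θ z)) y :=
    contDiffAt_const.clm_comp (hΘ.const_smul _)
  refine (hinv.clm_comp hT).congr_of_eventuallyEq ?_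
  filter_upwards [hJ, hev] with z h1 h2
  ext v
  have h3 : A z (J z v) = ℓ (Complex.I • Θ z v) := congrArg ℓ (h1 v)
  refine (h2.inverse_apply_self (J z v)).symm.trans ?_
  exact congrArg _ h3

/-- The real bilinear form `2 ∑ Re (z \bar w)`. -/
def realPair (κ : Type*) [Fintype κ] : (κ → ℂ) →L[ℝ] (κ → ℂ) →L[ℝ] ℝ :=
  (2 : ℝ) • ∑ I, (innerSL ℝ (E := ℂ)).bilinearComp (ContinuousLinearMap.proj I)
    (ContinuousLinearMap.proj I)

theorem realPair_apply {κ : Type*} [Fintype κ] (z w : κ → ℂ) :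
    realPair κ z w = 2 * ∑ I, (z I * (starRingEnd ℂ) (w I)).re := by
  simp only [realPair, _root_.smul_apply, _root_.sum_apply,
    ContinuousLinearMap.bilinearComp_apply, ContinuousLinearMap.proj_apply, smul_eq_mul]
  congr 1
  refine Finset.sum_congr rfl fun I _ => ?_
  show inner ℝ (z I) (w I) = _
  rw [Complex.inner]
  simp
  ring

theorem realPair_I_smul {κ : Type*} [Fintype κ] (z w : κ → ℂ) :
    realPair κ (Complex.I • z) (Complex.I • w) = realPair κ z w := by
  rw [realPair_apply, realPair_apply]
  refine congrArg _ (Finset.sum_congr rfl fun I _ => ?_)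
  simp

/-- The pull-back of a bilinear form. -/
def pullBilin (B : E →L[ℝ] E →L[ℝ] ℝ) (L : F →L[ℝ] E) : F →L[ℝ] F →L[ℝ] ℝ := B.bilinearComp L L

omit [FiniteDimensional ℝ F] in
theorem contDiffAt_pullBilin {B : E →L[ℝ] E →L[ℝ] ℝ} {Θ : F → F →L[ℝ] E} {y : F}
    (hΘ : ContDiffAt ℝ ∞ Θ y) : ContDiffAt ℝ ∞ (fun z => pullBilin B (Θ z)) y := by
  have h : ContDiffAt ℝ ∞ (fun z =>
      (((ContinuousLinearMap.compL ℝ F E ℝ).flip (Θ z)) ∘L (B ∘L Θ z))) y :=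
    ((ContinuousLinearMap.contDiff _).contDiffAt.comp y hΘ).clm_comp
      (contDiffAt_const.clm_comp hΘ)
  exact h

end Flat

/-! ### Smoothness of the induced metric and complex structure. -/

section Truncation

variable {n : ℕ} {E : Type*} [NormedAddCommGroup E] [NormedSpace ℝ E]
  {M : Type*} [TopologicalSpace M] [ChartedSpace E M] [IsManifold 𝓘(ℝ, E) ∞ M]
  {F : Type*} [NormedAddCommGroup F] [NormedSpace ℝ F] [FiniteDimensional ℝ F]
  {N : Type*} [TopologicalSpace N] [ChartedSpace F N] [IsManifold 𝓘(ℝ, F) ∞ N] {ι : N → M}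
  {D : Frame n E M} {S : QKStructure n E M} {R : Set (Set N × Frame n E M)} {lam : ℝ}

namespace Frame

/-- The forms `U^{1I}` on the submanifold in the chart at `p`. -/
def chartTheta (D : Frame n E M) (ι : N → M) (p : N) (y : F) : F →L[ℝ] (Fin n → ℂ) :=
  ContinuousLinearMap.pi fun I => flatLin (chartForm (pullbackForm (F := F) ι (D.U 0 (.inl I))) p) y

omit [IsManifold 𝓘(ℝ, E) ∞ M] [IsManifold 𝓘(ℝ, F) ∞ N] in
theorem chartTheta_apply (D : Frame n E M) (ι : N → M) (p : N) (y v : F) :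
    chartTheta D ι p y v = subTheta (F := F) D ι ((extChartAt 𝓘(ℝ, F) p).symm y)
      ((mfderiv 𝓘(ℝ, F) 𝓘(ℝ, F) (extChartAt 𝓘(ℝ, F) p).symm y : F →L[ℝ] F) v) := by
  funext I
  show flatLin (chartForm (pullbackForm (F := F) ι (D.U 0 (.inl I))) p) y v = _
  rw [flatLin_chartForm_apply]
  exact congrArg (D.U 0 (.inl I) (ι ((extChartAt 𝓘(ℝ, F) p).symm y)))
    (funext fun i => by fin_cases i; rfl)

omit [FiniteDimensional ℝ F] in
theorem contDiffAt_chartTheta (hD : D.IsQuaternionic lam) (hι : ContMDiff 𝓘(ℝ, F) 𝓘(ℝ, E) ∞ ι)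
    {W : Set N} (hW : IsOpen W) (hm : Set.MapsTo ι W D.dom) {p : N} {y : F}
    (hy : y ∈ (extChartAt 𝓘(ℝ, F) p).target) (hyW : (extChartAt 𝓘(ℝ, F) p).symm y ∈ W) :
    ContDiffAt ℝ ∞ (chartTheta D ι p) y := by
  have h : ContDiffAt ℝ ∞ (fun y I =>
      flatLin (chartForm (pullbackForm (F := F) ι (D.U 0 (.inl I))) p) y) y :=
    contDiffAt_pi.2 fun I => contDiffAt_flatLin_iff.2 (((hD.smooth_U 0 (.inl I)).pullbackForm
      hD.isOpen_dom hm (fun q _ => hι q) hW).contDiffAt hW hy hyW)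
  exact (ContinuousLinearMap.piEquivL ℝ F (fun _ : Fin n => ℂ)).contDiff.contDiffAt.comp y h

theorem injective_chartTheta (hι : IsSubmanifold (E := E) (F := F) ι) (hD : D.IsQuaternionic lam)
    {p : N} {y : F} (hy : y ∈ (extChartAt 𝓘(ℝ, F) p).target)
    (hp : ι ((extChartAt 𝓘(ℝ, F) p).symm y) ∈ D.dom)
    (hh : D.HalfVanish _ (tangentPlane (F := F) ι ((extChartAt 𝓘(ℝ, F) p).symm y))) :
    Function.Injective (chartTheta D ι p y) := by
  intro v w h
  rw [chartTheta_apply, chartTheta_apply] at h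
  have h1 := injective_subTheta hι hD hp hh h
  have h2 : ∀ L : F →L[ℝ] F, L.IsInvertible → L v = L w → v = w := fun L hL h => by
    rw [← hL.inverse_apply_self v, h, hL.inverse_apply_self]
  exact h2 _ (isInvertible_mfderiv_symm hy) h1

end Frame

open _root_.QK.Frame

theorem eventually_symm_mem {p : N} {W : Set N} (hW : IsOpen W) (hp : p ∈ W) :
    ∀ᶠ y in 𝓝 (extChartAt 𝓘(ℝ, F) p p),
      y ∈ (extChartAt 𝓘(ℝ, F) p).target ∧ (extChartAt 𝓘(ℝ, F) p).symm y ∈ W :=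
  (eventually_extChartAt_target (mem_extChartAt_target p)).and
    ((continuousAt_extChartAt_symm_of_mem (mem_extChartAt_target p)).preimage_mem_nhds
      (hW.mem_nhds (by rwa [extChartAt_to_inv])))

theorem contDiffAt_chartTheta_self (hR : IsTruncation (F := F) S ι R)
    (hι : IsSubmanifold (E := E) (F := F) ι) {r : Set N × Frame n E M} (hr : r ∈ R) {p : N}
    (hp : p ∈ r.1) : ContDiffAt ℝ ∞ (chartTheta r.2 ι p) (extChartAt 𝓘(ℝ, F) p p) :=
  contDiffAt_chartTheta (S.isQuaternionic _ (hR.mem r hr)) hι.smooth (hR.isOpen r hr)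
    (hR.mapsTo r hr) (mem_extChartAt_target p) (by rwa [extChartAt_to_inv])

/-- An endomorphism field in the chart at `p`. -/
def chartEnd (J : N → F →L[ℝ] F) (p : N) (y : F) : F →L[ℝ] F :=
  (mfderiv 𝓘(ℝ, F) 𝓘(ℝ, F) (extChartAt 𝓘(ℝ, F) p).symm y : F →L[ℝ] F).inverse ∘L
    J ((extChartAt 𝓘(ℝ, F) p).symm y) ∘L
      (mfderiv 𝓘(ℝ, F) 𝓘(ℝ, F) (extChartAt 𝓘(ℝ, F) p).symm y : F →L[ℝ] F)

theorem mfderiv_symm_chartEnd {J : N → F →L[ℝ] F} {p : N} {y : F}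
    (hy : y ∈ (extChartAt 𝓘(ℝ, F) p).target) (v : F) :
    (mfderiv 𝓘(ℝ, F) 𝓘(ℝ, F) (extChartAt 𝓘(ℝ, F) p).symm y : F →L[ℝ] F) (chartEnd J p y v) =
      J ((extChartAt 𝓘(ℝ, F) p).symm y)
        ((mfderiv 𝓘(ℝ, F) 𝓘(ℝ, F) (extChartAt 𝓘(ℝ, F) p).symm y : F →L[ℝ] F) v) := by
  have h : ∀ L A : F →L[ℝ] F, L.IsInvertible → L ((L.inverse ∘L A ∘L L) v) = A (L v) :=
    fun L A hL => hL.self_apply_inverse (A (L v))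
  exact h _ _ (isInvertible_mfderiv_symm hy)

theorem chartTheta_chartEnd {J : N → F →L[ℝ] F}
    (hJ : ∀ r ∈ R, ∀ p ∈ r.1, ∀ v, subTheta r.2 ι p (J p v) = Complex.I • subTheta r.2 ι p v)
    {r : Set N × Frame n E M} (hr : r ∈ R) {p : N} {y : F}
    (hy : y ∈ (extChartAt 𝓘(ℝ, F) p).target) (hyr : (extChartAt 𝓘(ℝ, F) p).symm y ∈ r.1) (v : F) :
    chartTheta r.2 ι p y (chartEnd J p y v) = Complex.I • chartTheta r.2 ι p y v := by
  rw [chartTheta_apply, chartTheta_apply, mfderiv_symm_chartEnd hy]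
  exact hJ r hr _ hyr _

theorem IsTruncation.contDiffAt_chartEnd (hR : IsTruncation (F := F) S ι R)
    (hι : IsSubmanifold (E := E) (F := F) ι) {J : N → F →L[ℝ] F}
    (hJ : ∀ r ∈ R, ∀ p ∈ r.1, ∀ v, subTheta r.2 ι p (J p v) = Complex.I • subTheta r.2 ι p v)
    (p : N) : ContDiffAt ℝ ∞ (chartEnd J p) (extChartAt 𝓘(ℝ, F) p p) := by
  obtain ⟨r, hr, hp⟩ := hR.cover p
  refine contDiffAt_complexStructure (contDiffAt_chartTheta_self hR hι hr hp)
    (injective_chartTheta hι (S.isQuaternionic _ (hR.mem r hr)) (mem_extChartAt_target p)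
      (hR.mapsTo r hr (by rwa [extChartAt_to_inv])) (hR.half r hr _ (by rwa [extChartAt_to_inv]))) ?_
  filter_upwards [eventually_symm_mem (F := F) (hR.isOpen r hr) hp] with y hy
  exact chartTheta_chartEnd hJ hr hy.1 hy.2

theorem IsTruncation.contMDiff_complexStructure (hR : IsTruncation (F := F) S ι R)
    (hι : IsSubmanifold (E := E) (F := F) ι) {J : N → F →L[ℝ] F}
    (hJ : ∀ r ∈ R, ∀ p ∈ r.1, ∀ v, subTheta r.2 ι p (J p v) = Complex.I • subTheta r.2 ι p v) :
    ContMDiff 𝓘(ℝ, F) (𝓘(ℝ, F).prod 𝓘(ℝ, F →L[ℝ] F)) ∞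
    (fun p => Bundle.TotalSpace.mk' (F →L[ℝ] F)
      (E := fun p : N => TangentSpace 𝓘(ℝ, F) p →L[ℝ] TangentSpace 𝓘(ℝ, F) p) p (J p)) := by
  intro p
  refine contMDiffAt_endomorphism (hR.contDiffAt_chartEnd hι hJ p) ?_
  filter_upwards [extChartAt_source_mem_nhds (I := 𝓘(ℝ, F)) p] with q hq v
  have h := mfderiv_symm_chartEnd (J := J) ((extChartAt 𝓘(ℝ, F) p).map_source hq) v
  rw [(extChartAt 𝓘(ℝ, F) p).left_inv hq] at h
  exact h.symm

/-- The metric induced on a truncation. -/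
def IsTruncation.metric (hR : IsTruncation (F := F) S ι R)
    (hι : IsSubmanifold (E := E) (F := F) ι) :
    Bundle.ContMDiffRiemannianMetric 𝓘(ℝ, F) ∞ F (fun p : N => TangentSpace 𝓘(ℝ, F) p) where
  inner p := pullBilin (E := E) (F := F) (S.h.inner (ι p)) (dmap ι p)
  symm p v w := S.h.symm (ι p) _ _
  pos p v hv := S.h.pos (ι p) _ fun h => hv (hι.immersion p (h.trans (map_zero _).symm))
  isVonNBounded p := isVonNBounded_preimage (F := F) (E := E) (hι.immersion p) (S.h.isVonNBounded (ι p))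
  contMDiff := by
    intro p
    obtain ⟨r, hr, hp⟩ := hR.cover p
    -- In the chart the metric is the pull-back of the standard real form of ℂⁿ by the smooth field
    -- `chartTheta`.
    refine contMDiffAt_bilinear (contDiffAt_pullBilin (B := realPair (Fin n))
      (contDiffAt_chartTheta_self hR hι hr hp)) ?_
    filter_upwards [extChartAt_source_mem_nhds (I := 𝓘(ℝ, F)) p,
      (hR.isOpen r hr).mem_nhds hp] with q hq hqr v w
    have h := inner_dmap (hR.mem r hr) (hR.mapsTo r hr hqr) (hR.half r hr q hqr)
      ((mfderiv 𝓘(ℝ, F) 𝓘(ℝ, F) (extChartAt 𝓘(ℝ, F) p).symm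
        (extChartAt 𝓘(ℝ, F) p q) : F →L[ℝ] F) v) ((mfderiv 𝓘(ℝ, F) 𝓘(ℝ, F)
        (extChartAt 𝓘(ℝ, F) p).symm (extChartAt 𝓘(ℝ, F) p q) : F →L[ℝ] F) w)
    refine Eq.trans h ?_
    show _ = realPair (Fin n) (chartTheta r.2 ι p _ v) (chartTheta r.2 ι p _ w)
    rw [realPair_apply, chartTheta_apply, chartTheta_apply,
      (extChartAt 𝓘(ℝ, F) p).left_inv hq]

end Truncation

/-! ### The induced Kähler structure -/

section Truncation

variable {n : ℕ} {E : Type*} [NormedAddCommGroup E] [NormedSpace ℝ E]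
  {M : Type*} [TopologicalSpace M] [ChartedSpace E M] [IsManifold 𝓘(ℝ, E) ∞ M]
  {F : Type*} [NormedAddCommGroup F] [NormedSpace ℝ F] [FiniteDimensional ℝ F]
  {N : Type*} [TopologicalSpace N] [ChartedSpace F N] [IsManifold 𝓘(ℝ, F) ∞ N] {ι : N → M}
  {D : Frame n E M} {S : QKStructure n E M} {R : Set (Set N × Frame n E M)} {lam : ℝ}

open _root_.QK.Frame

omit [IsManifold 𝓘(ℝ, E) ∞ M] in
/-- The first structure equation on a subspace on which the truncation conditions hold. -/
theorem Frame.HalfVanish.mextDeriv_inl (hD : D.IsQuaternionic lam) {x : M} (hx : x ∈ D.dom)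
    {P : Submodule ℝ (TangentSpace 𝓘(ℝ, E) x)} (hh : D.HalfVanish x P)
    {v w : TangentSpace 𝓘(ℝ, E) x} (hv : v ∈ P) (hw : w ∈ P) (I : Fin n) :
    mextDeriv (D.U 0 (.inl I)) x ![v, w] =
      -∑ K, (((if I = K then D.su2Conn x v 0 0 else 0) + D.de (.inl I) (.inl K) x v)
          * D.u 0 (.inl K) x w
        - ((if I = K then D.su2Conn x w 0 0 else 0) + D.de (.inl I) (.inl K) x w)
          * D.u 0 (.inl K) x v) := by
  have hz : ∀ v ∈ P, ∀ I, D.u 0 (.inr I) x v = 0 := (halfVanish_iff hD hx).1 hh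
  have h := hD.torsion x hx v w 0 (.inl I)
  rw [Fin.sum_univ_two, wedge, wedge, hh v hv I, hh w hw I, Fintype.sum_sum_type] at h
  simp only [wedge, hz v hv, hz w hw, mul_zero, sub_zero, Finset.sum_const_zero, add_zero] at h
  rw [add_assoc] at h
  rw [eq_neg_of_add_eq_zero_left h]
  congr 1
  simp only [add_mul, ite_mul, zero_mul, add_sub_add_comm, Finset.sum_add_distrib,
    Finset.sum_sub_distrib, Finset.sum_ite_eq, Finset.mem_univ, if_true]

theorem IsTruncation.structureEquation (hR : IsTruncation (F := F) S ι R)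
    (hι : IsSubmanifold (E := E) (F := F) ι) {r : Set N × Frame n E M} (hr : r ∈ R) {p : N}
    (hp : p ∈ r.1) : ∃ η : Fin n → Fin n → F → ℂ, ∀ I, ∀ v w : F,
      fderiv ℝ (flatLin (chartForm (pullbackForm (F := F) ι (r.2.U 0 (.inl I))) p))
          (extChartAt 𝓘(ℝ, F) p p) v w
        - fderiv ℝ (flatLin (chartForm (pullbackForm (F := F) ι (r.2.U 0 (.inl I))) p))
          (extChartAt 𝓘(ℝ, F) p p) w v =
      -∑ K, (η I K v * subTheta r.2 ι p w K - η I K w * subTheta r.2 ι p v K) := by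
  have hq := S.isQuaternionic _ (hR.mem r hr)
  -- The U(1) part of the SU(2) connection and the undotted block of Δ: all that survives of the
  -- connection on N.
  refine ⟨fun I K v => (if I = K then r.2.su2Conn (ι p) (dmap (F := F) ι p v) 0 0 else 0)
    + r.2.de (.inl I) (.inl K) (ι p) (dmap (F := F) ι p v), fun I v w => ?_⟩
  have h1 := mextDeriv_one_self (hR.isOpen r hr) ((hq.smooth_U 0 (.inl I)).pullbackForm
    hq.isOpen_dom (hR.mapsTo r hr) (fun q _ => hι.smooth q) (hR.isOpen r hr)) hp v w
  refine h1.symm.trans ?_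
  rw [mextDeriv_pullbackForm hq.isOpen_dom (hq.smooth_U 0 (.inl I)) (hR.mapsTo r hr hp)
    (Filter.Eventually.of_forall hι.smooth)]
  refine Eq.trans (congrArg (mextDeriv (r.2.U 0 (.inl I)) (ι p))
    (funext fun i => by fin_cases i <;> rfl)) ((hR.half r hr p hp).mextDeriv_inl hq
      (hR.mapsTo r hr hp) (v := dmap (F := F) ι p v) (w := dmap (F := F) ι p w)
      ⟨v, rfl⟩ ⟨w, rfl⟩ I)

theorem chartField_eq_chartEnd {J : N → F →L[ℝ] F} {p : N} {y : F}
    (hy : y ∈ (extChartAt 𝓘(ℝ, F) p).target) (X : (q : N) → TangentSpace 𝓘(ℝ, F) q) :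
    chartField p (fun q => (J q : F →L[ℝ] F) (X q)) y = chartEnd J p y (chartField p X y) := by
  have h : ∀ L A : F →L[ℝ] F, ∀ v : F, L.IsInvertible →
    L.inverse (A v) = (L.inverse ∘L A ∘L L) (L.inverse v) := fun L A v hL =>
      (congrArg (fun u => L.inverse (A u)) (hL.self_apply_inverse v)).symm
  exact h _ _ _ (isInvertible_mfderiv_symm hy)

/-- `nijenhuis_flat` in the chart at p, where J acts by the smooth field `chartEnd`; this is what
makes JX and JY differentiable. -/
theorem IsTruncation.nijenhuis (hR : IsTruncation (F := F) S ι R)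
    (hι : IsSubmanifold (E := E) (F := F) ι) {J : N → F →L[ℝ] F}
    (hJ : ∀ r ∈ R, ∀ p ∈ r.1, ∀ v, subTheta r.2 ι p (J p v) = Complex.I • subTheta r.2 ι p v)
    (X Y : (p : N) → TangentSpace 𝓘(ℝ, F) p) (p : N)
    (hX : MDifferentiableAt 𝓘(ℝ, F) 𝓘(ℝ, F).tangent
      (fun q => (⟨q, X q⟩ : TangentBundle 𝓘(ℝ, F) N)) p)
    (hY : MDifferentiableAt 𝓘(ℝ, F) 𝓘(ℝ, F).tangent
      (fun q => (⟨q, Y q⟩ : TangentBundle 𝓘(ℝ, F) N)) p)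
    {r : Set N × Frame n E M} (hr : r ∈ R) (hp : p ∈ r.1) (k : Fin n) :
    subTheta (F := F) r.2 ι p (VectorField.mlieBracket 𝓘(ℝ, F) (fun q => (J q : F →L[ℝ] F) (X q))
        (fun q => (J q : F →L[ℝ] F) (Y q)) p) k
      - Complex.I * subTheta (F := F) r.2 ι p
        (VectorField.mlieBracket 𝓘(ℝ, F) (fun q => (J q : F →L[ℝ] F) (X q)) Y p) k
      - Complex.I * subTheta (F := F) r.2 ι p
        (VectorField.mlieBracket 𝓘(ℝ, F) X (fun q => (J q : F →L[ℝ] F) (Y q)) p) k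
      - subTheta (F := F) r.2 ι p (VectorField.mlieBracket 𝓘(ℝ, F) X Y p) k = 0 := by
  have : CompleteSpace F := FiniteDimensional.complete ℝ F
  have hq := S.isQuaternionic _ (hR.mem r hr)
  obtain ⟨η, hη⟩ := hR.structureEquation hι hr hp
  have hJd : ∀ Z : (p : N) → TangentSpace 𝓘(ℝ, F) p,
      DifferentiableAt ℝ (chartField p Z) (extChartAt 𝓘(ℝ, F) p p) →
      DifferentiableAt ℝ (chartField p fun q => (J q : F →L[ℝ] F) (Z q))
        (extChartAt 𝓘(ℝ, F) p p) := fun Z hZ => by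
    refine (((hR.contDiffAt_chartEnd hι hJ p).differentiableAt (by simp)).clm_apply
      hZ).congr_of_eventuallyEq ?_
    filter_upwards [eventually_extChartAt_target (mem_extChartAt_target p)] with y hy
    exact chartField_eq_chartEnd hy Z
  have hJI : ∀ Z : (p : N) → TangentSpace 𝓘(ℝ, F) p, ∀ k, ∀ᶠ z in 𝓝 (extChartAt 𝓘(ℝ, F) p p),
      chartTheta r.2 ι p z (chartField p (fun q => (J q : F →L[ℝ] F) (Z q)) z) k =
        Complex.I * chartTheta r.2 ι p z (chartField p Z z) k := fun Z k => by
    filter_upwards [eventually_symm_mem (F := F) (hR.isOpen r hr) hp] with y hy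
    rw [chartField_eq_chartEnd hy.1, chartTheta_chartEnd hJ hr hy.1 hy.2]
    rfl
  have hself : ∀ v k, chartTheta r.2 ι p (extChartAt 𝓘(ℝ, F) p p) v k = subTheta r.2 ι p v k := by
    intro v k
    exact (flatLin_chartForm_self (pullbackForm (F := F) ι (r.2.U 0 (.inl k))) p v).trans
      (congrArg (r.2.U 0 (.inl k) (ι p)) (funext fun i => by fin_cases i; rfl))
  have hX' := differentiableAt_chartField hX
  have hY' := differentiableAt_chartField hY
  have key := nijenhuis_flat
    (θ := fun k => flatLin (chartForm (pullbackForm (F := F) ι (r.2.U 0 (.inl k))) p))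
    (η := η) (y := extChartAt 𝓘(ℝ, F) p p)
    (fun k => (contDiffAt_flatLin_iff.2 (((hq.smooth_U 0 (.inl k)).pullbackForm
      hq.isOpen_dom (hR.mapsTo r hr) (fun q _ => hι.smooth q) (hR.isOpen r hr)).contDiffAt
      (hR.isOpen r hr) (mem_extChartAt_target p)
      (by rwa [extChartAt_to_inv]))).differentiableAt (by simp)) ?_ hX' hY' (hJd X hX') (hJd Y hY')
      (hJI X) (hJI Y) k
  · refine Eq.trans ?_ key
    have h3 : ∀ A B : (q : N) → TangentSpace 𝓘(ℝ, F) q,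
        subTheta (F := F) r.2 ι p (VectorField.mlieBracket 𝓘(ℝ, F) A B p) k =
        flatLin (chartForm (pullbackForm (F := F) ι (r.2.U 0 (.inl k))) p) (extChartAt 𝓘(ℝ, F) p p)
          (VectorField.lieBracket ℝ (chartField p A) (chartField p B)
            (extChartAt 𝓘(ℝ, F) p p)) := fun A B => by
      refine Eq.trans ?_ (hself _ k).symm
      exact congrArg (fun u : F => subTheta r.2 ι p u k) (mlieBracket_eq_lieBracket p A B)
    exact congrArg₂ _ (congrArg₂ _ (congrArg₂ _ (h3 _ _) (congrArg _ (h3 _ _)))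
      (congrArg _ (h3 _ _))) (h3 _ _)
  · intro k v w
    refine (hη k v w).trans (congrArg Neg.neg (Finset.sum_congr rfl fun l _ => ?_))
    rw [← hself, ← hself]
    rfl

end Truncation

/-! ### Locally exact forms. -/

section Forms

variable {F : Type*} [NormedAddCommGroup F] [NormedSpace ℝ F]
  {N : Type*} [TopologicalSpace N] [ChartedSpace F N] [IsManifold 𝓘(ℝ, F) ∞ N] {k : ℕ}
  {V : Type*} [NormedAddCommGroup V] [NormedSpace ℝ V]

theorem contDiffAt_extDeriv {η : F → F [⋀^Fin k]→L[ℝ] V} {y : F} (h : ContDiffAt ℝ ∞ η y) :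
    ContDiffAt ℝ ∞ (extDeriv η) y := by
  have h1 : ContDiff ℝ ∞ fun L : F →L[ℝ] F [⋀^Fin k]→L[ℝ] V =>
      ContinuousAlternatingMap.alternatizeUncurryFinCLM ℝ F V L := ContinuousLinearMap.contDiff _
  exact h1.contDiffAt.comp y (h.fderiv_right (m := ∞) (by simp))

/-- A form which is locally a constant multiple of an exact form is smooth and closed. -/
theorem smooth_closed_of_locally_exact {Φ : Form F N (k + 1) V} {c : ℝ}
    (h : ∀ p, ∃ W, IsOpen W ∧ p ∈ W ∧ ∃ α : Form F N k V, SmoothFormOn α W ∧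
      ∀ q ∈ W, Φ q = c • mextDeriv α q) :
    SmoothFormOn Φ Set.univ ∧ ∀ p, mextDeriv Φ p = 0 := by
  have key : ∀ p₀ y, y ∈ (extChartAt 𝓘(ℝ, F) p₀).target → ∃ η : F → F [⋀^Fin k]→L[ℝ] V,
      ContDiffAt ℝ ∞ η y ∧ chartForm Φ p₀ =ᶠ[𝓝 y] c • extDeriv η := by
    intro p₀ y hy
    obtain ⟨W, hW, hp, α, hα, h⟩ := h ((extChartAt 𝓘(ℝ, F) p₀).symm y)
    refine ⟨chartForm α p₀, hα.contDiffAt hW hy hp, ?_⟩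
    filter_upwards [eventually_extChartAt_target hy,
      (continuousAt_extChartAt_symm_of_mem hy).preimage_mem_nhds (hW.mem_nhds hp)] with z hz hzW
    rw [Pi.smul_apply, ← hα.chartForm_flat hW hz hzW]
    show (Φ _).compContinuousLinearMap _ = _
    rw [h _ hzW]
    rfl
  refine ⟨smoothFormOn_of_contDiffAt fun p₀ y hy _ => ?_, fun p => ?_⟩
  · obtain ⟨η, h1, h2⟩ := key p₀ y hy
    exact ((contDiffAt_extDeriv h1).const_smul c).congr_of_eventuallyEq h2
  · obtain ⟨η, h1, h2⟩ := key p _ (mem_extChartAt_target p)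
    show (extDeriv (𝕜 := ℝ) (E := F) (chartForm Φ p) (extChartAt 𝓘(ℝ, F) p p) :
      F [⋀^Fin (k + 1 + 1)]→L[ℝ] V) = 0
    rw [h2.extDeriv_eq, extDeriv_smul, extDeriv_extDeriv_apply h1 (by
      simp only [minSmoothness_of_isRCLikeNormedField]; exact WithTop.coe_le_coe.2 le_top), smul_zero]

end Forms

/-! ### Ω^3 as the Kähler form. -/

section Truncation

variable {n : ℕ} {E : Type*} [NormedAddCommGroup E] [NormedSpace ℝ E]
  {M : Type*} [TopologicalSpace M] [ChartedSpace E M] [IsManifold 𝓘(ℝ, E) ∞ M]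
  {F : Type*} [NormedAddCommGroup F] [NormedSpace ℝ F] [FiniteDimensional ℝ F]
  {N : Type*} [TopologicalSpace N] [ChartedSpace F N] [IsManifold 𝓘(ℝ, F) ∞ N] {ι : N → M}
  {D : Frame n E M} {S : QKStructure n E M} {R : Set (Set N × Frame n E M)} {lam : ℝ}

open _root_.QK.Frame

theorem IsTruncation.smooth_pullback_su2Form (hR : IsTruncation (F := F) S ι R)
    (hι : IsSubmanifold (E := E) (F := F) ι) {r : Set N × Frame n E M} (hr : r ∈ R) (c : Fin 3) :
    SmoothFormOn (pullbackForm (F := F) ι (r.2.su2Form c)) r.1 := by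
  have hq := S.isQuaternionic _ (hR.mem r hr)
  exact (hq.smooth_su2 c).pullbackForm hq.isOpen_dom (hR.mapsTo r hr) (fun q _ => hι.smooth q)
    (hR.isOpen r hr)

/-- The quadratic term of Ω^3 is ω^1 ∧ ω^2, which vanishes on N. -/
theorem IsTruncation.mextDeriv_su2Form_two (hR : IsTruncation (F := F) S ι R)
    (hι : IsSubmanifold (E := E) (F := F) ι) {r : Set N × Frame n E M} (hr : r ∈ R) {p : N}
    (hp : p ∈ r.1) (v w : F) :
    mextDeriv (pullbackForm (F := F) ι (r.2.su2Form 2)) p ![v, w] =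
      r.2.su2Curv 2 (ι p) (dmap (F := F) ι p v) (dmap (F := F) ι p w) := by
  have hq := S.isQuaternionic _ (hR.mem r hr)
  have hz := fun v : F => (hR.conn r hr p hp _ ⟨v, rfl⟩)
  have h0 : wedge (r.2.om 0 (ι p)) (r.2.om 1 (ι p)) (dmap (F := F) ι p v) (dmap (F := F) ι p w)
      = 0 := by
    have h1 : r.2.om 0 (ι p) (dmap (F := F) ι p v) = 0 := (hz v).1
    have h2 : r.2.om 0 (ι p) (dmap (F := F) ι p w) = 0 := (hz w).1
    rw [wedge, h1, h2, zero_mul, zero_mul, sub_zero]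
  rw [mextDeriv_pullbackForm hq.isOpen_dom (hq.smooth_su2 2) (hR.mapsTo r hr hp)
    (Filter.Eventually.of_forall hι.smooth)]
  refine Eq.trans (congrArg (mextDeriv (r.2.su2Form 2) (ι p))
    (funext fun i => by fin_cases i <;> rfl)) (Eq.trans (add_zero _).symm
      (congrArg (mextDeriv (r.2.su2Form 2) (ι p) ![dmap (F := F) ι p v, dmap (F := F) ι p w] + ·)
        h0.symm))

theorem IsTruncation.su2Curv_two (hR : IsTruncation (F := F) S ι R) {J : N → F →L[ℝ] F}
    (hJ : ∀ r ∈ R, ∀ p ∈ r.1, ∀ v, subTheta r.2 ι p (J p v) = Complex.I • subTheta r.2 ι p v)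
    {r : Set N × Frame n E M} (hr : r ∈ R) {p : N} (hp : p ∈ r.1) (v w : F) :
    r.2.su2Curv 2 (ι p) (dmap (F := F) ι p v) (dmap (F := F) ι p w) =
      -2 * S.lam * S.h.inner (ι p) (dmap (F := F) ι p (J p v)) (dmap (F := F) ι p w) := by
  rw [inner_dmap (hR.mem r hr) (hR.mapsTo r hr hp) (hR.half r hr p hp)]
  exact su2Curv_two_dmap (S.isQuaternionic _ (hR.mem r hr)) (hR.mapsTo r hr hp)
    (hR.half r hr p hp) (hJ r hr p hp v) w

/-- The Kähler form of a truncation. -/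
theorem IsTruncation.exists_kahlerForm (hR : IsTruncation (F := F) S ι R)
    (hι : IsSubmanifold (E := E) (F := F) ι) {J : N → F →L[ℝ] F}
    (hJ : ∀ r ∈ R, ∀ p ∈ r.1, ∀ v, subTheta r.2 ι p (J p v) = Complex.I • subTheta r.2 ι p v) :
    ∃ Φ : Form F N 2 ℝ,
      (∀ p, ∀ v w : F, Φ p ![v, w] =
        S.h.inner (ι p) (dmap (F := F) ι p (J p v)) (dmap (F := F) ι p w)) ∧
      ∀ r ∈ R, ∀ p ∈ r.1, mextDeriv (pullbackForm (F := F) ι (r.2.su2Form 2)) p =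
        (-2 * S.lam) • Φ p := by
  have hlam : -2 * S.lam ≠ 0 := mul_ne_zero (by norm_num) S.lam_ne
  choose r hr hp using hR.cover
  have h1 : ∀ s ∈ R, ∀ p ∈ s.1, ∀ v w : F,
      mextDeriv (pullbackForm (F := F) ι (s.2.su2Form 2)) p ![v, w] =
      -2 * S.lam * S.h.inner (ι p) (dmap (F := F) ι p (J p v)) (dmap (F := F) ι p w) :=
    fun s hs p hps v w => (hR.mextDeriv_su2Form_two hι hs hps v w).trans
      (hR.su2Curv_two hJ hs hps v w)
  -- A frame is chosen at each point. The expression through the metric and J, by `h1`, shows that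
  -- the choice does not matter.
  refine ⟨fun p => (-2 * S.lam)⁻¹ • mextDeriv (pullbackForm (F := F) ι ((r p).2.su2Form 2)) p,
    fun p v w => ?_, fun s hs p hps => ?_⟩
  · show (-2 * S.lam)⁻¹ * mextDeriv (pullbackForm (F := F) ι ((r p).2.su2Form 2)) p ![v, w] = _
    rw [h1 _ (hr p) p (hp p), inv_mul_cancel_left₀ hlam]
  · rw [smul_inv_smul₀ hlam]
    refine ContinuousAlternatingMap.ext fun t => ?_
    obtain ⟨v, w, rfl⟩ : ∃ v w : F, t = ![v, w] :=
      ⟨t 0, t 1, funext fun i => by fin_cases i <;> rfl⟩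
    exact (h1 s hs p hps v w).trans (h1 _ (hr p) p (hp p) v w).symm

/-- A truncation with complex tangent spaces is Kähler. -/
theorem IsTruncation.isKahler (hR : IsTruncation (F := F) S ι R)
    (hι : IsSubmanifold (E := E) (F := F) ι) {J : N → F →L[ℝ] F}
    (hJ : ∀ r ∈ R, ∀ p ∈ r.1, ∀ v, subTheta r.2 ι p (J p v) = Complex.I • subTheta r.2 ι p v)
    {Φ : Form F N 2 ℝ}
    (hΦ : ∀ p, ∀ v w : F, Φ p ![v, w] =
        S.h.inner (ι p) (dmap (F := F) ι p (J p v)) (dmap (F := F) ι p w))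
    (hd : ∀ r ∈ R, ∀ p ∈ r.1, mextDeriv (pullbackForm (F := F) ι (r.2.su2Form 2)) p =
        (-2 * S.lam) • Φ p) :
    IsKahler (hR.metric hι) J Φ := by
  have hlam : -2 * S.lam ≠ 0 := mul_ne_zero (by norm_num) S.lam_ne
  have hinj : ∀ r ∈ R, ∀ p ∈ r.1, Function.Injective (subTheta (F := F) r.2 ι p) :=
    fun r hr p hp => injective_subTheta hι (S.isQuaternionic _ (hR.mem r hr)) (hR.mapsTo r hr hp)
      (hR.half r hr p hp)
  -- On each member of the cover Φ is a constant multiple of dω^3, so no further computation is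
  -- needed for smoothness and closedness.
  have hsc := smooth_closed_of_locally_exact (Φ := Φ) (c := (-2 * S.lam)⁻¹) fun p => by
    obtain ⟨r, hr, hp⟩ := hR.cover p
    refine ⟨r.1, hR.isOpen r hr, hp, _, hR.smooth_pullback_su2Form hι hr 2, fun q hq => ?_⟩
    rw [hd r hr q hq, inv_smul_smul₀ hlam]
  have hI : ∀ z : Fin n → ℂ, Complex.I • Complex.I • z = -z := fun z => by
    rw [smul_smul, Complex.I_mul_I, neg_one_smul]
  refine ⟨hR.contMDiff_complexStructure hι hJ, fun p v => ?_, fun p v w => ?_,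
    fun X Y p hX hY => ?_, fun p v w => hΦ p v w, hsc.1, hsc.2⟩
  · obtain ⟨r, hr, hp⟩ := hR.cover p
    have h : ∀ v : F, J p (J p v) = -v := fun v => hinj r hr p hp (by
      rw [hJ r hr p hp, hJ r hr p hp, map_neg, hI])
    exact h v
  · obtain ⟨r, hr, hp⟩ := hR.cover p
    have h : ∀ v w : F, S.h.inner (ι p) (dmap (F := F) ι p v) (dmap (F := F) ι p w) =
        realPair (Fin n) (subTheta r.2 ι p v) (subTheta r.2 ι p w) := fun v w => by
      rw [inner_dmap (hR.mem r hr) (hR.mapsTo r hr hp) (hR.half r hr p hp), realPair_apply]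
    refine (h _ _).trans (Eq.trans ?_ (h _ _).symm)
    exact (congrArg₂ (fun a b => realPair (Fin n) a b) (hJ r hr p hp v) (hJ r hr p hp w)).trans
      (realPair_I_smul _ _)
  · obtain ⟨r, hr, hp⟩ := hR.cover p
    have key : ∀ A B C D : F, (∀ k, subTheta r.2 ι p A k - Complex.I * subTheta r.2 ι p B k
        - Complex.I * subTheta r.2 ι p C k - subTheta r.2 ι p D k = 0) →
        A - J p B - J p C - D = 0 := fun A B C D h => hinj r hr p hp (by
      rw [map_sub, map_sub, map_sub, hJ r hr p hp, hJ r hr p hp, map_zero]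
      exact funext h)
    exact key _ _ _ _ (hR.nijenhuis hι hJ X Y p hX hY hr hp)

end Truncation

/-! ### The Hermitian line bundle -/

section Truncation

variable {n : ℕ} {E : Type*} [NormedAddCommGroup E] [NormedSpace ℝ E]
  {M : Type*} [TopologicalSpace M] [ChartedSpace E M] [IsManifold 𝓘(ℝ, E) ∞ M]
  {F : Type*} [NormedAddCommGroup F] [NormedSpace ℝ F] [FiniteDimensional ℝ F]
  {N : Type*} [TopologicalSpace N] [ChartedSpace F N] [IsManifold 𝓘(ℝ, F) ∞ N] {ι : N → M}
  {D D' : Frame n E M} {S : QKStructure n E M} {R : Set (Set N × Frame n E M)} {lam : ℝ}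

open _root_.QK.Frame

omit [IsManifold 𝓘(ℝ, E) ∞ M] in
-- The (1,1) entry of the SU(2) gauge law: the off-diagonal products drop out because a is diagonal
-- at x and ω'^1, ω'^2 vanish on v.
theorem Frame.IsGauge.scalarDeriv_of_diagonal {O : Set M} {a : M → Matrix (Fin 2) (Fin 2) ℂ}
    {g : M → Matrix (Idx n) (Idx n) ℂ} (hg : D.IsGauge D' O a g) {x : M} (hx : x ∈ O)
    (ha : a x 0 1 = 0) {v : TangentSpace 𝓘(ℝ, E) x} (h0 : D'.om 0 x v = 0) (h1 : D'.om 1 x v = 0) :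
    scalarDeriv (fun z => a z 0 0) x v =
      Complex.I / 2 * ((D.om 2 x v - D'.om 2 x v : ℝ) : ℂ) * a x 0 0 := by
  have h := hg.su2 x hx v 0 0
  have e1 : D'.su2Conn x v 0 1 = 0 := by simp [su2Conn, Fin.sum_univ_three, h0, h1, pauli]
  have e2 : ∀ G : Frame n E M, G.su2Conn x v 0 0 = Complex.I / 2 * (G.om 2 x v : ℂ) := fun G => by
    simp [su2Conn, Fin.sum_univ_three, pauli]
  rw [Matrix.mul_apply, Matrix.mul_apply, Fin.sum_univ_two, Fin.sum_univ_two, e1, ha, e2, e2] at h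
  push_cast
  linear_combination h

omit [FiniteDimensional ℝ F] in
theorem scalarDeriv_comp_dmap {f : M → ℂ} {O : Set M} (hO : IsOpen O)
    (hf : ContMDiffOn 𝓘(ℝ, E) 𝓘(ℝ, ℂ) ∞ f O) (hι : ContMDiff 𝓘(ℝ, F) 𝓘(ℝ, E) ∞ ι) {p : N}
    (hp : ι p ∈ O) (v : TangentSpace 𝓘(ℝ, F) p) :
    scalarDeriv (fun q => f (ι q)) p v = scalarDeriv (E := E) f (ι p) (dmap ι p v) := by
  have h := mfderiv_comp p
    ((hf.contMDiffAt (hO.mem_nhds hp)).mdifferentiableAt (by simp : (∞ : WithTop ℕ∞) ≠ 0))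
    ((hι p).mdifferentiableAt (by simp : (∞ : WithTop ℕ∞) ≠ 0))
  exact congrArg (fun L : F →L[ℝ] ℂ => L v) h

/-- The transition function is the conjugate of a², where a is the U(1) part of a gauge
transformation. The frames determine a² as the ratio of their symplectic pairings, so t is
independent of the chosen gauge transformation, smooth, and multiplicative. The square also doubles
the ½ in the law for da. -/
theorem IsTruncation.isHodgeBundle (hn : 0 < n) (hR : IsTruncation (F := F) S ι R)
    (hι : IsSubmanifold (E := E) (F := F) ι) {K : Form F N 2 ℝ}
    (hK : ∀ r ∈ R, ∀ p ∈ r.1, mextDeriv (pullbackForm (F := F) ι (r.2.su2Form 2)) p = K p) :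
    IsHodgeBundle (fun r : R => r.1.1) (fun r : R => pullbackForm ι (r.1.2.su2Form 2)) K := by
  have hq := fun r : R => S.isQuaternionic _ (hR.mem r.1 r.2)
  have hex : ∀ r s : R, ∀ p, ∃ c : ℂ, p ∈ r.1.1 ∩ s.1.1 → ∀ v w,
      s.1.2.uPair 0 0 (ι p) v w = star c * r.1.2.uPair 0 0 (ι p) v w := by
    intro r s p
    by_cases hp : p ∈ r.1.1 ∩ s.1.1
    · obtain ⟨O, a, g, hO, hg, ha⟩ := hR.reduced r.1 r.2 s.1 s.2 p hp
      refine ⟨star (a (ι p) 0 0 ^ 2), fun _ v w => ?_⟩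
      rw [star_star]
      exact hg.sympPair_of_diagonal hO ha.self_of_nhds v w
    · exact ⟨0, fun h => absurd h hp⟩
  choose t ht using hex
  have huniq : ∀ r s : R, ∀ p ∈ r.1.1 ∩ s.1.1, ∀ c : ℂ,
      (∀ v w, s.1.2.uPair 0 0 (ι p) v w = c * r.1.2.uPair 0 0 (ι p) v w) → t r s p = star c := by
    intro r s p hp c hc
    obtain ⟨v, w, hvw⟩ := exists_uPair_eq_one hn (hq r) (hR.mapsTo r.1 r.2 hp.1)
    have h1 := (hc v w).symm.trans (ht r s p hp v w)
    rw [hvw, mul_one, mul_one] at h1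
    rw [h1, star_star]
  have hloc : ∀ r s : R, ∀ p ∈ r.1.1 ∩ s.1.1, ∃ O a g, ι p ∈ O ∧ r.1.2.IsGauge s.1.2 O a g ∧
      a (ι p) 0 1 = 0 ∧ t r s =ᶠ[𝓝 p] fun q => star (a (ι q) 0 0) * star (a (ι q) 0 0) := by
    intro r s p hp
    obtain ⟨O, a, g, hO, hg, ha⟩ := hR.reduced r.1 r.2 s.1 s.2 p hp
    refine ⟨O, a, g, hO, hg, ha.self_of_nhds, ?_⟩
    filter_upwards [ha, (hι.smooth p).continuousAt.preimage_mem_nhds (hg.isOpen.mem_nhds hO),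
      ((hR.isOpen r.1 r.2).inter (hR.isOpen s.1 s.2)).mem_nhds hp] with q h1 h2 h3
    rw [huniq r s q h3 _ fun v w => hg.sympPair_of_diagonal h2 h1 v w, ← star_mul, ← pow_two]
  have hsm : ∀ {O : Set M} {a : M → Matrix (Fin 2) (Fin 2) ℂ}, IsOpen O →
      (∀ A B, ContMDiffOn 𝓘(ℝ, E) 𝓘(ℝ, ℂ) ∞ (fun y => a y A B) O) →
      ContMDiffOn 𝓘(ℝ, F) 𝓘(ℝ, ℂ) ∞ (fun q => a (ι q) 0 0) (ι ⁻¹' O) := fun hO ha =>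
    (ha 0 0).comp hι.smooth.contMDiffOn (fun _ h => h)
  refine ⟨fun r => hR.isOpen r.1 r.2, fun p => ?_, fun r => hR.smooth_pullback_su2Form hι r.2 2,
    fun r p hp => hK r.1 r.2 p hp, t, fun r s p hp => ?_, fun r s p hp => ?_,
    fun r s u p hp => ?_, fun r s p hp v => ?_⟩
  · obtain ⟨r, hr, hp⟩ := hR.cover p
    exact ⟨⟨r, hr⟩, hp⟩
  · obtain ⟨O, a, g, hO, hg, -, h⟩ := hloc r s p hp
    have hf := contMDiffOn_star_complex (hsm hg.isOpen hg.smooth_a)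
    have hO' : ι ⁻¹' O ∈ 𝓝 p := (hg.isOpen.preimage hι.smooth.continuous).mem_nhds hO
    exact (((contMDiffOn_mul_complex hf hf).contMDiffAt hO').congr_of_eventuallyEq
      h).contMDiffWithinAt
  · obtain ⟨O, a, g, hO, hg, ha, h⟩ := hloc r s p hp
    have h1 := congrArg norm (norm_of_diagonal (hg.mem_SU2 _ hO) ha)
    rw [norm_mul, norm_star, norm_one] at h1
    rw [h.self_of_nhds, norm_mul, norm_star, h1]
  -- The cocycle condition is uniqueness of the ratio: the ratios from r to s and from s to u
  -- multiply to one from r to u.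
  · have h := huniq r u p ⟨hp.1.1, hp.2⟩ (star (t s u p) * star (t r s p)) fun v w => by
      rw [ht s u p ⟨hp.1.2, hp.2⟩, ht r s p hp.1, mul_assoc]
    rw [h, ← star_mul, star_star]
  · obtain ⟨O, a, g, hO, hg, ha, h⟩ := hloc r s p hp
    have hf := hsm hg.isOpen hg.smooth_a
    have hf' := contMDiffOn_star_complex hf
    have hO' : IsOpen (ι ⁻¹' O) := hg.isOpen.preimage hι.smooth.continuous
    have hc := hR.conn s.1 s.2 p hp.2 (dmap ι p v) ⟨v, rfl⟩
    have hd : scalarDeriv (fun q => a (ι q) 0 0) p v = Complex.I / 2 *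
        ((r.1.2.om 2 (ι p) (dmap ι p v) - s.1.2.om 2 (ι p) (dmap ι p v) : ℝ) : ℂ)
          * a (ι p) 0 0 :=
      (scalarDeriv_comp_dmap hg.isOpen (hg.smooth_a 0 0) hι.smooth hO v).trans
        (hg.scalarDeriv_of_diagonal hO ha hc.1 hc.2.1)
    have hom : ∀ r : R, pullbackForm (F := F) ι (r.1.2.su2Form 2) p ![v] =
        r.1.2.om 2 (ι p) (dmap ι p v) := fun r =>
      congrArg (r.1.2.su2Form 2 (ι p)) (funext fun i => by fin_cases i; rfl)
    rw [scalarDeriv_congr h, scalarDeriv_mul hO' hO hf' hf', scalarDeriv_star hO' hO hf, hd,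
      h.self_of_nhds, hom r, hom s, star_mul, star_mul]
    simp only [Complex.star_def, map_div₀, Complex.conj_I, Complex.conj_ofReal, map_ofNat]
    push_cast
    ring

theorem IsTruncation.isKahlerHodge (hn : 0 < n) (hR : IsTruncation (F := F) S ι R)
    (hι : IsSubmanifold (E := E) (F := F) ι) (hc : IsComplexSubmanifold (F := F) ι R) :
    IsKahlerHodge (F := F) S ι R := by
  obtain ⟨J, hJ⟩ := hR.exists_complexStructure hι hc
  obtain ⟨Φ, hΦ, hd⟩ := hR.exists_kahlerForm hι hJ
  refine ⟨hR.metric hι, J, Φ, fun p v w => rfl, hR.isKahler hι hJ hΦ hd,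
    fun r hr p hp v I => congrFun (hJ r hr p hp v) I, fun r hr p hp v w => ?_,
    hR.isHodgeBundle hn hι hd⟩
  exact (hR.su2Curv_two hJ hr hp v w).trans (congrArg _ (hΦ p v w).symm)

end Truncation

end QK

end

/-! ### Assembly of the theorem. -/

theorem mainTheorem1 {n : ℕ} (hn : 0 < n)
    {E : Type*} [NormedAddCommGroup E] [NormedSpace ℝ E] [FiniteDimensional ℝ E]
    {M : Type*} [TopologicalSpace M] [ChartedSpace E M] [IsManifold 𝓘(ℝ, E) ∞ M]
    {F : Type*} [NormedAddCommGroup F] [NormedSpace ℝ F] [FiniteDimensional ℝ F]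
    {N : Type*} [TopologicalSpace N] [ChartedSpace F N] [IsManifold 𝓘(ℝ, F) ∞ N]
    [Nonempty N]
    (S : QK.QKStructure n E M) :
    -- the completely symmetric tensor in the curvature exists and is unique
    (∀ D ∈ S.frames, ∀ x ∈ D.dom, ∃! T, D.IsOmegaTensor S.lam x T) ∧
    -- vanishing of the curvatures of the first two connection forms on a tangent subspace
    (∀ D ∈ S.frames, ∀ x ∈ D.dom, ∀ P : Submodule ℝ (TangentSpace 𝓘(ℝ, E) x),
      (D.SU2CurvVanish x P ↔ D.WedgeVanish x P) ∧
      (D.SU2CurvVanish x P ↔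
        ∃ g, QK.IsUSp g ∧ ∃ D' ∈ S.frames, D'.dom = D.dom ∧ D'.su2Form = D.su2Form ∧
          (∀ y ∈ D.dom, ∀ v A α, D'.u A α y v = ∑ β, g α β * D.u A β y v) ∧
          D'.HalfVanish x P) ∧
      (D.SU2CurvVanish x P → Module.finrank ℝ P ≤ 2 * n)) ∧
    -- the involution conditions on a subspace on which the connection forms vanish
    (∀ D ∈ S.frames, ∀ x ∈ D.dom, ∀ P : Submodule ℝ (TangentSpace 𝓘(ℝ, E) x),
      D.ConnVanish x P →
      (D.Involution x P ↔ D.SU2CurvVanish x P ∧ D.SpCurvVanish x P) ∧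
      ∀ T, D.IsOmegaTensor S.lam x T → D.HalfVanish x P →
        (∀ v ∈ P, ∀ w ∈ P, ∀ I, QK.mextDeriv (D.U 1 (.inl I)) x ![v, w] = 0) ∧
        (QK.OmegaVanish T → D.Involution x P) ∧
        (Module.finrank ℝ P = 2 * n → (D.Involution x P ↔ QK.OmegaVanish T))) ∧
    -- submanifolds
    (∀ ι : N → M, QK.IsSubmanifold (E := E) (F := F) ι →
      (∀ D ∈ S.frames, ∀ W : Set N, IsOpen W → Set.MapsTo ι W D.dom →
        (∀ p ∈ W, D.ConnVanish (ι p) (QK.tangentPlane (F := F) ι p)) →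
        ∀ p ∈ W, D.Involution (ι p) (QK.tangentPlane (F := F) ι p)) ∧
      (Module.finrank ℝ F = 2 * n →
        ∀ D ∈ S.frames, ∀ W : Set N, IsOpen W → Set.MapsTo ι W D.dom →
          ((∀ p ∈ W, D.SU2CurvVanish (ι p) (QK.tangentPlane (F := F) ι p)) ↔
            ∀ p ∈ W, ∃ D' ∈ S.frames, (∃ g, D.IsGauge D' D'.dom (fun _ => 1) g) ∧
              ∃ W' ∈ 𝓝 p, W' ⊆ W ∧ Set.MapsTo ι W' D'.dom ∧
                ∀ q ∈ W', D'.HalfVanish (ι q) (QK.tangentPlane (F := F) ι q))) ∧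
      ∀ R : Set (Set N × QK.Frame n E M), QK.IsTruncation (F := F) S ι R →
        Module.finrank ℝ F ≤ 2 * n ∧
        (Module.finrank ℝ F = 2 * n →
          (∀ r ∈ R, ∀ p ∈ r.1, ∀ T, r.2.IsOmegaTensor S.lam (ι p) T → QK.OmegaVanish T) ∧
          QK.IsComplexSubmanifold (F := F) ι R) ∧
        (QK.IsComplexSubmanifold (F := F) ι R → QK.IsKahlerHodge (F := F) S ι R)) := by
  refine ⟨fun D hD x hx => QK.Frame.existsUnique_omegaTensor (S.isQuaternionic D hD) hx,
    fun D hD x hx P => ⟨QK.Frame.su2CurvVanish_iff_wedgeVanish (S.isQuaternionic D hD) S.lam_ne hx,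
      QK.Frame.su2CurvVanish_iff_exists_rotation hD hx, fun h => h.finrank_le hD hx⟩,
    fun D hD x hx P hc => ⟨hc.involution_iff, fun T hT hh => ?_⟩,
    fun ι hι => ⟨fun D hD W hW hm h p hp =>
      QK.Frame.involution_of_connVanish (S.isQuaternionic D hD) hι hW hm h hp,
      fun hF D hD W hW hm => ⟨fun h p hp => QK.Frame.exists_half_frame hι hF hD hW hm h hp, ?_⟩,
      fun R hR => ?_⟩⟩
  · have hq := S.isQuaternionic D hD
    exact ⟨fun v hv w hw I => QK.Frame.mextDeriv_half_eq_zero hq hx hc hh hv hw I,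
      fun h => QK.Frame.involution_of_omegaVanish hq S.lam_ne hx hc hT hh h,
      fun hP => ⟨QK.Frame.omegaVanish_of_involution hq hx hc hT hh hP,
        fun h => QK.Frame.involution_of_omegaVanish hq S.lam_ne hx hc hT hh h⟩⟩
  · intro h p hp
    obtain ⟨D', hD', ⟨g, hg⟩, W', hW', hsub, hm', hh⟩ := h p hp
    exact hg.su2CurvVanish hD hD' (hm' (mem_of_mem_nhds hW')) (hh p (mem_of_mem_nhds hW'))
  · exact ⟨hR.finrank_le hι, fun hF => ⟨fun r hr p hp T hT => hR.omegaVanish hι hF hr hp hT,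
      hR.isComplexSubmanifold hι hF⟩, fun hc => hR.isKahlerHodge hn hι hc⟩
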